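/- Let $M$ be a smooth ($C^\infty$), Hausdorff, $\sigma$-compact manifold of dimension $n\ge 2$, and let $\eta=\mathrm{diag}(-1,1,\dots,1)$. Let $LM$ be the frame bundle of $M$, $C(LM)\to M$ the bundle of linear connections, $\Sigma\to M$ the bundle of Lorentzian metrics, and $J^1LM$, $J^1\Sigma$ the first jet bundles. On $J^1LM$, with coordinates $(x,e,e')$, let $\theta=e^{-1}dx$ be the canonical $\mathbb R^n$-valued form and $\omega=e^{-1}(de-e'\,dx)$ the canonical $\mathfrak{gl}(n)$-valued connection form, $T^i=d\theta^i+\omega^i_k\wedge\theta^k$ the torsion, $\Omega^i_j=d\omega^i_j+\omega^i_k\wedge\omega^k_j$ the curvature, and $$\mathcal I_{PG}=\big\langle \eta^{ik}\omega^j_k+\eta^{jk}\omega^i_k,\;T^i\big\rangle_{\rm diff},\qquad \lambda_{PG}=\eta^{kp}\,\theta_{kl}\wedge\Omega^l_p,\qquad \theta_{kl}=\tfrac1{(n-2)!}\epsilon_{kl i_3\cdots i_n}\theta^{i_3}\wedge\cdots\wedge\theta^{i_n}.$$ Let $p_H:J^1LM\to C(LM)\times_M\Sigma$ be the map $(e,e')\mapsto(\Gamma,g)$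 with $\Gamma(u)v=-e'(u)e^{-1}v$ and $g(v,w)=\eta(e^{-1}v,e^{-1}w)$. The reduced Palatini EDS is $\overline{\mathcal I}_{PG}=\{\alpha\in\Omega^\bullet(C(LM)\times_M\Sigma):p_H^*\alpha\in\mathcal I_{PG}\}$. Let $p_2:C(LM)\times_MJ^1\Sigma\to J^1\Sigma$ and $\Pi:C(LM)\times_MJ^1\Sigma\to C(LM)\times_M\Sigma$ be the projections, $\mathcal I^\Sigma_{\rm con}$ the contact structure of $J^1\Sigma$, and $$\mathcal J=\big\langle p_2^*\mathcal I^\Sigma_{\rm con},\;\Pi^*\overline{\mathcal I}_{PG}\big\rangle_{\rm diff}.$$ Here $\langle\cdot\rangle_{\rm diff}$ is the generated differential ideal (local: a form that coincides near every point with an element of the ideal belongs to it), and an integral manifold of $\mathcal J$ is the image of a local section of $C(LM)\times_MJ^1\Sigma\to M$ along which all forms in $\mathcal J$ pull back to zero. (1) There is an embedded submanifold $L\subset C(LM)\times_MJ^1\Sigma$ which contains every integral manifold of $\mathcal J$ and which is contained in every other subset with this property. (2) $p_2|_L:L\to J^1\Sigma$ is an isomorphism of bundles over $M$ (a diffeomorphism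 over $M$), and $(p_2|_L)^*\mathcal I^\Sigma_{\rm con}=\mathcal J|_L$. (3) Suppose that $M$ is oriented. There is a unique smooth $n$-form $\overline\lambda_{PG}$ on $C(LM)\times_M\Sigma$ with $p_H^*\overline\lambda_{PG}=\lambda_{PG}$ over the positively oriented frames, and a unique $n$-form $\lambda_{EH}$ on $J^1\Sigma$ with $(p_2|_L)^*\lambda_{EH}=(\Pi^*\overline\lambda_{PG})|_L$; it is smooth. The map $\tau\mapsto\Pi\circ\tau$ is a bijection from the extremals of $(L,\Pi^*\overline\lambda_{PG}|_L,\mathcal J|_L)$ onto the extremals of the reduced Palatini problem $(C(LM)\times_M\Sigma,\overline\lambda_{PG},\overline{\mathcal I}_{PG})$, and the map $\tau\mapsto p_2\circ\tau$ is a bijection from the same set onto the extremals of the Einstein–Hilbert problem $(J^1\Sigma,\lambda_{EH},\mathcal I^\Sigma_{\rm con})$. Hence the extremals of the last two problems are in one-to-one correspondence. An extremal of $(\Lambda\to M,\lambda,\mathcal I)$ is a smooth section $s:M\to\Lambda$ with $s^*\alpha=0$ for all $\alpha\in\mathcal I$ such that $\int_M s^*(\mathcal L_X\lambda)=0$ for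 every smooth vector field $X$ on $\Lambda$ which is vertical along $s$, whose restriction to $s$ has compact support, and which satisfies $s^*(\mathcal L_X\alpha)=0$ for all $\alpha\in\mathcal I$. -/

import Mathlib

set_option maxSynthPendingDepth 3

open scoped Manifold ContDiff Topology

noncomputable section

namespace PalatiniEH

/-- `ℝⁿ`. -/
abbrev Vec (n : ℕ) : Type := EuclideanSpace ℝ (Fin n)

section Forms

variable {E : Type*} [NormedAddCommGroup E] [NormedSpace ℝ E]
variable {E' : Type*} [NormedAddCommGroup E'] [NormedSpace ℝ E']

theorem continuous_domCoprod {k l : ℕ} (a : E [⋀^Fin k]→L[ℝ] ℝ) (b : E [⋀^Fin l]→L[ℝ] ℝ) :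
    Continuous fun v : Fin (k + l) → E =>
      ((LinearMap.mul' ℝ ℝ).compAlternatingMap
        (a.toAlternatingMap.domCoprod b.toAlternatingMap)).domDomCongr finSumFinEquiv v := by
  have h : ∀ σ : Equiv.Perm.ModSumCongr (Fin k) (Fin l), Continuous fun v : Fin (k + l) → E =>
      LinearMap.mul' ℝ ℝ (AlternatingMap.domCoprod.summand a.toAlternatingMap b.toAlternatingMap σ
        (v ∘ finSumFinEquiv)) := by
    intro σ
    induction σ using Quotient.inductionOn' with
    | _ σ =>
      have h1 : Continuous fun v : Fin (k + l) → E =>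
          a (fun i => v (finSumFinEquiv (σ (Sum.inl i)))) *
            b (fun i => v (finSumFinEquiv (σ (Sum.inr i)))) :=
        (a.cont.comp (by fun_prop)).mul (b.cont.comp (by fun_prop))
      rcases Int.units_eq_one_or (Equiv.Perm.sign σ) with hs | hs
      · simpa [AlternatingMap.domCoprod.summand_mk'', hs] using h1
      · have h2 : Continuous fun v : Fin (k + l) → E =>
            -(a (fun i => v (finSumFinEquiv (σ (Sum.inl i)))) *
              b (fun i => v (finSumFinEquiv (σ (Sum.inr i))))) := h1.neg
        simpa [AlternatingMap.domCoprod.summand_mk'', hs, -continuous_neg_iff] using h2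
  have := continuous_finsetSum Finset.univ fun σ _ => h σ
  refine this.congr fun v => ?_
  simp [AlternatingMap.domCoprod_apply, Function.comp_def]

/-- Wedge product of alternating forms, as a sum over shuffles (so that
`(a ∧ b)(v, w) = a(v) b(w) - a(w) b(v)` for 1-forms). -/
def wedgeAlt {k l : ℕ} (a : E [⋀^Fin k]→L[ℝ] ℝ) (b : E [⋀^Fin l]→L[ℝ] ℝ) :
    E [⋀^Fin (k + l)]→L[ℝ] ℝ :=
  { ((LinearMap.mul' ℝ ℝ).compAlternatingMap
      (a.toAlternatingMap.domCoprod b.toAlternatingMap)).domDomCongr finSumFinEquiv with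
    cont := continuous_domCoprod a b }

/-- Differential `k`-forms on a manifold `N` modelled on `E`: at `x` a form on the tangent space
of `N` at `x`, which Mathlib identifies with `E` by the preferred chart at `x`. Smoothness is the
separate predicate `IsSmoothForm`. -/
abbrev DForm (E : Type*) [NormedAddCommGroup E] [NormedSpace ℝ E] (N : Type*) (k : ℕ) : Type _ :=
  N → E [⋀^Fin k]→L[ℝ] ℝ

variable {N : Type*} [TopologicalSpace N] [ChartedSpace E N]
variable {N' : Type*} [TopologicalSpace N'] [ChartedSpace E' N']
variable {k l : ℕ}

/-- Wedge product of differential forms. -/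
def wedge (α : DForm E N k) (β : DForm E N l) : DForm E N (k + l) :=
  fun x => wedgeAlt (α x) (β x)

/-- Local expression of a form in the chart `c`: pullback by `c⁻¹`. -/
def inChart (c : OpenPartialHomeomorph N E) (α : DForm E N k) : E → E [⋀^Fin k]→L[ℝ] ℝ :=
  fun y => (α (c.symm y)).compContinuousLinearMap (mfderiv 𝓘(ℝ, E) 𝓘(ℝ, E) c.symm y)

/-- All local expressions are smooth. -/
def IsSmoothForm (α : DForm E N k) : Prop :=
  ∀ c ∈ atlas E N, ContDiffOn ℝ ∞ (inChart c α) c.target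

/-- Exterior derivative, computed in the preferred chart at each point. -/
def extD (α : DForm E N k) : DForm E N (k + 1) := fun x =>
  (extDeriv (inChart (chartAt E x) α) (chartAt E x x)).compContinuousLinearMap
    (mfderiv 𝓘(ℝ, E) 𝓘(ℝ, E) (chartAt E x) x)

/-- Pullback of forms. -/
def pullback (f : N' → N) (α : DForm E N k) : DForm E' N' k := fun x =>
  (α (f x)).compContinuousLinearMap (mfderiv 𝓘(ℝ, E') 𝓘(ℝ, E) f x)

/-- Vector fields. -/
abbrev VField (E : Type*) [NormedAddCommGroup E] [NormedSpace ℝ E] (N : Type*)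
    [TopologicalSpace N] [ChartedSpace E N] : Type _ := (x : N) → TangentSpace 𝓘(ℝ, E) x

/-- Smooth vector fields. -/
def IsSmoothVField [IsManifold 𝓘(ℝ, E) ∞ N] (X : VField E N) : Prop :=
  ContMDiff 𝓘(ℝ, E) 𝓘(ℝ, E).tangent ∞ fun x => (⟨x, X x⟩ : TangentBundle 𝓘(ℝ, E) N)

/-- Interior product. -/
def contract (X : VField E N) (α : DForm E N (k + 1)) : DForm E N k :=
  fun x => (α x).curryLeft (X x)

/-- Lie derivative of a form, by the formula of Cartan. -/
def lieD (X : VField E N) : {k : ℕ} → DForm E N k → DForm E N k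
  | 0, α => contract X (extD α)
  | _ + 1, α => contract X (extD α) + extD (contract X α)

/-- Sets of homogeneous differential forms. -/
abbrev FormSet (E : Type*) [NormedAddCommGroup E] [NormedSpace ℝ E] (N : Type*) : Type _ :=
  Set (Σ k : ℕ, DForm E N k)

/-- The differential ideal `⟨S⟩_diff` generated by the forms in `S`: the smallest set of forms which
contains `S`, is closed under sums, wedge products with smooth forms and exterior derivatives, and is
local, i.e. contains every form which coincides near every point with one of its elements. -/
inductive diffIdeal (S : FormSet E N) : FormSet E N
  | of (a : Σ k : ℕ, DForm E N k) (ha : a ∈ S) : diffIdeal S a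
  | zero (k : ℕ) : diffIdeal S ⟨k, 0⟩
  | add {k : ℕ} (α β : DForm E N k) (hα : diffIdeal S ⟨k, α⟩) (hβ : diffIdeal S ⟨k, β⟩) :
      diffIdeal S ⟨k, α + β⟩
  | wedge_left {k l : ℕ} (γ : DForm E N l) (hγ : IsSmoothForm γ) (α : DForm E N k)
      (hα : diffIdeal S ⟨k, α⟩) : diffIdeal S ⟨l + k, wedge γ α⟩
  | wedge_right {k l : ℕ} (γ : DForm E N l) (hγ : IsSmoothForm γ) (α : DForm E N k)
      (hα : diffIdeal S ⟨k, α⟩) : diffIdeal S ⟨k + l, wedge α γ⟩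
  | extD {k : ℕ} (α : DForm E N k) (hα : diffIdeal S ⟨k, α⟩) : diffIdeal S ⟨k + 1, extD α⟩
  | glue {k : ℕ} (β : DForm E N k) (U : N → Set N) (hU : ∀ x, IsOpen (U x)) (hx : ∀ x, x ∈ U x)
      (α : N → DForm E N k) (hα : ∀ x, diffIdeal S ⟨k, α x⟩)
      (hβ : ∀ x, ∀ y ∈ U x, α x y = β y) : diffIdeal S ⟨k, β⟩

/-- The forms `f^* α` for `α ∈ S`. -/
def pullbackSet (f : N' → N) (S : FormSet E N) : FormSet E' N' :=
  (fun a => ⟨a.1, pullback f a.2⟩) '' S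

/-- The reduced exterior differential system along `p : N' → N`: the smooth forms on `N` whose
pullback belongs to `I`. -/
def reducedEDS (p : N' → N) (I : FormSet E' N') : FormSet E N :=
  {a | IsSmoothForm a.2 ∧ (⟨a.1, pullback p a.2⟩ : Σ k : ℕ, DForm E' N' k) ∈ I}

end Forms

section Int
variable {n : ℕ} {M : Type*} [TopologicalSpace M] [ChartedSpace (Vec n) M]

/-- All coordinate changes of the given atlas of `M` preserve the orientation of `ℝⁿ`. -/
def IsOrientedAtlas (n : ℕ) (M : Type*) [TopologicalSpace M] [ChartedSpace (Vec n) M] : Prop :=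
  ∀ c ∈ atlas (Vec n) M, ∀ c' ∈ atlas (Vec n) M, ∀ x ∈ c.source ∩ c'.source,
    0 < (fderiv ℝ (c' ∘ c.symm) (c x)).det

/-- Integral of an `n`-form over `M` with an oriented atlas, by means of a partition of unity
subordinate to the preferred charts. -/
def formIntegral [T2Space M] [SigmaCompactSpace M] [IsManifold (𝓡 n) ∞ M]
    (α : DForm (Vec n) M n) : ℝ :=
  ∑ᶠ i : M, ∫ y in (chartAt (Vec n) i).target,
    (SmoothPartitionOfUnity.exists_isSubordinate_chartAt_source (𝓡 n) M).choose i
        ((chartAt (Vec n) i).symm y) *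
      inChart (chartAt (Vec n) i) α y (EuclideanSpace.basisFun (Fin n) ℝ)

/-- `s^* α` vanishes at `x` for every `α ∈ I`. -/
def IsIntegralAt {E : Type*} [NormedAddCommGroup E] [NormedSpace ℝ E] {Λ : Type*}
    [TopologicalSpace Λ] [ChartedSpace E Λ] (I : FormSet E Λ) (s : M → Λ) (x : M) : Prop :=
  ∀ a ∈ I, (pullback s a.2 : DForm (Vec n) M a.1) x = 0

/-- `s` is an extremal of the variational problem `(π : Λ → M, lam, I)`: an integral section of `I`
such that `∫ s^*(L_X lam) = 0` for all admissible variations with compact support. An admissible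
variation is a vertical vector field along `s` with an extension `X` to `Λ` such that
`s^*(L_X α) = 0` for all `α ∈ I`. -/
structure IsExtremal [T2Space M] [SigmaCompactSpace M] [IsManifold (𝓡 n) ∞ M]
    {E : Type*} [NormedAddCommGroup E] [NormedSpace ℝ E] {Λ : Type*}
    [TopologicalSpace Λ] [ChartedSpace E Λ] [IsManifold 𝓘(ℝ, E) ∞ Λ]
    (π : Λ → M) (lam : DForm E Λ n) (I : FormSet E Λ) (s : M → Λ) : Prop where
  smooth : ContMDiff (𝓡 n) 𝓘(ℝ, E) ∞ s
  section_ : ∀ x, π (s x) = x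
  integral : ∀ x, IsIntegralAt (n := n) I s x
  stationary : ∀ X : VField E Λ, IsSmoothVField X →
    (∀ x, mfderiv 𝓘(ℝ, E) (𝓡 n) π (s x) (X (s x)) = 0) →
    IsCompact (closure {x : M | X (s x) ≠ 0}) →
    (∀ a ∈ I, (pullback s (lieD X a.2) : DForm (Vec n) M a.1) = 0) →
    formIntegral (pullback s (lieD X lam) : DForm (Vec n) M n) = 0
end Int

/-- Linear endomorphisms. -/
abbrev Op (V : Type) [NormedAddCommGroup V] [NormedSpace ℝ V] : Type := V →L[ℝ] V
/-- Bilinear maps `V × V → V`. -/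
abbrev Op2 (V : Type) [NormedAddCommGroup V] [NormedSpace ℝ V] : Type := V →L[ℝ] V →L[ℝ] V

variable {V : Type} [NormedAddCommGroup V] [NormedSpace ℝ V]


/-- `b ↦ a ∘ b`. -/
abbrev postL (a : Op V) : Op V →L[ℝ] Op V := ContinuousLinearMap.compL ℝ V V V a
/-- `b ↦ b ∘ a`. -/
abbrev preL (a : Op V) : Op V →L[ℝ] Op V :=
  (ContinuousLinearMap.compL ℝ V V V).flip a

/-- A natural bundle of order two with fibre the open set `fib` in `W`, given by its transformation
law: under a change of coordinates of the base with first derivative `A`, inverse derivative `A'`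
and second derivative `B`, the fibre coordinate `w` becomes `act A A' B w`. The field `pt` is some
point of the fibre. -/
structure NatBundle (V : Type) [NormedAddCommGroup V] [NormedSpace ℝ V]
    (W : Type) [NormedAddCommGroup W] [NormedSpace ℝ W] where
  fib : Set W
  isOpen_fib : IsOpen fib
  pt : W
  pt_mem : pt ∈ fib
  act : Op V → Op V → Op2 V → W → W
  contDiff_act : ContDiff ℝ ∞ fun q : Op V × Op V × Op2 V × W => act q.1 q.2.1 q.2.2.1 q.2.2.2
  act_mem : ∀ {A A' : Op V} (B : Op2 V) {w : W}, A * A' = 1 → A' * A = 1 → w ∈ fib →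
    act A A' B w ∈ fib
  act_one : ∀ {w : W}, w ∈ fib → act 1 1 0 w = w
  act_comp : ∀ {A₁ A₁' A₂ A₂' : Op V} (B₁ B₂ : Op2 V) {w : W}, A₁ * A₁' = 1 → A₁' * A₁ = 1 →
    A₂ * A₂' = 1 → A₂' * A₂ = 1 → w ∈ fib →
    act A₂ A₂' B₂ (act A₁ A₁' B₁ w) =
      act (A₂ * A₁) (A₁' * A₂') (preL A₁ ∘L B₂ ∘L A₁ + postL A₂ ∘L B₁) w

/-- The total space over `M` of the natural bundle `b`: a point consists of its base point `x` and
its fibre coordinate with respect to the preferred chart of `M` at `x`. -/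
structure Tot {V : Type} [NormedAddCommGroup V] [NormedSpace ℝ V] {W : Type}
    [NormedAddCommGroup W] [NormedSpace ℝ W] (b : NatBundle V W) (M : Type*) where
  base : M
  val : W
  mem : val ∈ b.fib



section
variable {M : Type*} [TopologicalSpace M]

/-- First derivative at the point `x` of the change of coordinates from `c` to `c'`. -/
def jac (c c' : OpenPartialHomeomorph M V) (x : M) : Op V := fderiv ℝ (c' ∘ c.symm) (c x)
/-- Second derivative at the point `x` of the change of coordinates from `c` to `c'`. -/
def hess (c c' : OpenPartialHomeomorph M V) (x : M) : Op2 V :=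
  fderiv ℝ (fderiv ℝ (c' ∘ c.symm)) (c x)


/-- Cocycle property of coordinate changes. -/
theorem change_comp_eventuallyEq (c c' c'' : OpenPartialHomeomorph M V) {x : M}
    (hx : x ∈ c.source) (hx' : x ∈ c'.source) :
    (c'' ∘ c.symm) =ᶠ[𝓝 (c x)] (c'' ∘ c'.symm) ∘ (c' ∘ c.symm) := by
  have : (c.symm ≫ₕ c').source ∈ 𝓝 (c x) :=
    (c.symm ≫ₕ c').open_source.mem_nhds (by simp [hx, hx'])
  filter_upwards [this] with y hy
  have hy' : c.symm y ∈ c'.source := by simpa using hy.2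
  simp [c'.left_inv hy']

theorem jac_self (c : OpenPartialHomeomorph M V) {x : M} (hx : x ∈ c.source) :
    jac c c x = 1 := by
  have : (c ∘ c.symm) =ᶠ[𝓝 (c x)] id := by
    filter_upwards [c.open_target.mem_nhds (c.map_source hx)] with y hy using c.right_inv hy
  unfold jac
  rw [this.fderiv_eq, fderiv_id]; rfl

theorem hess_self (c : OpenPartialHomeomorph M V) {x : M} (hx : x ∈ c.source) :
    hess c c x = 0 := by
  have : (c ∘ c.symm) =ᶠ[𝓝 (c x)] id := by
    filter_upwards [c.open_target.mem_nhds (c.map_source hx)] with y hy using c.right_inv hy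
  unfold hess
  rw [this.fderiv.fderiv_eq]
  have : fderiv ℝ (id : V → V) = fun _ => ContinuousLinearMap.id ℝ _ := by
    ext1 y; exact fderiv_id
  rw [this]; simp

variable [ChartedSpace V M] [IsManifold 𝓘(ℝ, V) ∞ M]

theorem contDiffOn_change {c c' : OpenPartialHomeomorph M V} (hc : c ∈ atlas V M)
    (hc' : c' ∈ atlas V M) : ContDiffOn ℝ ∞ (c' ∘ c.symm) (c.symm ≫ₕ c').source := by
  have h := (contDiffGroupoid ∞ 𝓘(ℝ, V)).compatible hc hc'
  rw [contDiffGroupoid, mem_groupoid_of_pregroupoid] at h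
  simpa [contDiffPregroupoid] using h.1

theorem contDiffAt_change {c c' : OpenPartialHomeomorph M V} (hc : c ∈ atlas V M)
    (hc' : c' ∈ atlas V M) {x : M} (hx : x ∈ c.source) (hx' : x ∈ c'.source) :
    ContDiffAt ℝ ∞ (c' ∘ c.symm) (c x) := by
  refine (contDiffOn_change hc hc').contDiffAt ((c.symm ≫ₕ c').open_source.mem_nhds ?_)
  simp [hx, hx']

theorem jac_comp {c c' c'' : OpenPartialHomeomorph M V} (hc : c ∈ atlas V M)
    (hc' : c' ∈ atlas V M) (hc'' : c'' ∈ atlas V M) {x : M} (hx : x ∈ c.source)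
    (hx' : x ∈ c'.source) (hx'' : x ∈ c''.source) :
    jac c c'' x = jac c' c'' x * jac c c' x := by
  unfold jac
  rw [(change_comp_eventuallyEq c c' c'' hx hx').fderiv_eq, fderiv_comp]
  · simp [c.left_inv hx, ContinuousLinearMap.mul_def]
  · simpa [c.left_inv hx] using (contDiffAt_change hc' hc'' hx' hx'').differentiableAt (by simp)
  · exact (contDiffAt_change hc hc' hx hx').differentiableAt (by simp)

theorem jac_mul_jac {c c' : OpenPartialHomeomorph M V} (hc : c ∈ atlas V M)
    (hc' : c' ∈ atlas V M) {x : M} (hx : x ∈ c.source)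
    (hx' : x ∈ c'.source) : jac c' c x * jac c c' x = 1 := by
  rw [← jac_comp hc hc' hc hx hx' hx, jac_self c hx]

theorem hess_comp {c c' c'' : OpenPartialHomeomorph M V} (hc : c ∈ atlas V M)
    (hc' : c' ∈ atlas V M) (hc'' : c'' ∈ atlas V M) {x : M} (hx : x ∈ c.source)
    (hx' : x ∈ c'.source) (hx'' : x ∈ c''.source) :
    hess c c'' x = preL (jac c c' x) ∘L hess c' c'' x ∘L jac c c' x +
      postL (jac c' c'' x) ∘L hess c c' x := by
  have h1 := contDiffAt_change hc hc' hx hx'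
  have h2 := contDiffAt_change hc' hc'' hx' hx''
  have e0 : (c' ∘ c.symm) (c x) = c' x := by simp [c.left_inv hx]
  have key : fderiv ℝ (c'' ∘ c.symm) =ᶠ[𝓝 (c x)] fun y =>
      (fderiv ℝ (c'' ∘ c'.symm) ((c' ∘ c.symm) y)).comp (fderiv ℝ (c' ∘ c.symm) y) := by
    refine (change_comp_eventuallyEq c c' c'' hx hx').fderiv.trans ?_
    have a1 : ∀ᶠ y in 𝓝 (c x), ContDiffAt ℝ 1 (c' ∘ c.symm) y :=
      (h1.of_le (by norm_cast)).eventually (by simp)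
    have a2 : ∀ᶠ y in 𝓝 (c x), ContDiffAt ℝ 1 (c'' ∘ c'.symm) ((c' ∘ c.symm) y) := by
      refine h1.continuousAt.eventually ?_
      rw [e0]
      exact (h2.of_le (by norm_cast)).eventually (by simp)
    filter_upwards [a1, a2] with y hy1 hy2
    exact fderiv_comp _ (hy2.differentiableAt (by simp)) (hy1.differentiableAt (by simp))
  have d1 : HasFDerivAt (fderiv ℝ (c' ∘ c.symm)) (hess c c' x) (c x) :=
    ((h1.fderiv_right (m := 1) (by norm_cast)).differentiableAt (by simp)).hasFDerivAt
  have d2 : HasFDerivAt (fderiv ℝ (c'' ∘ c'.symm)) (hess c' c'' x) ((c' ∘ c.symm) (c x)) := by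
    rw [e0]
    exact ((h2.fderiv_right (m := 1) (by norm_cast)).differentiableAt (by simp)).hasFDerivAt
  have d3 : HasFDerivAt (c' ∘ c.symm) (jac c c' x) (c x) :=
    (h1.differentiableAt (by simp)).hasFDerivAt
  have := (d2.comp (c x) d3).clm_comp d1
  unfold hess
  rw [key.fderiv_eq]
  refine this.fderiv.trans ?_
  unfold jac hess
  simp only [Function.comp_apply, c.left_inv hx]
  rw [add_comm]

variable {W : Type} [NormedAddCommGroup W] [NormedSpace ℝ W]

namespace NatBundle

/-- Change of fibre coordinates from `c` to `c'` over the point `x`. -/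
def trans (b : NatBundle V W) (c c' : OpenPartialHomeomorph M V) (x : M) (w : W) : W :=
  b.act (jac c c' x) (jac c' c x) (hess c c' x) w

variable (b : NatBundle V W)

theorem trans_mem {c c' : OpenPartialHomeomorph M V} (hc : c ∈ atlas V M)
    (hc' : c' ∈ atlas V M) {x : M} (hx : x ∈ c.source) (hx' : x ∈ c'.source) {w : W}
    (hw : w ∈ b.fib) : b.trans c c' x w ∈ b.fib :=
  b.act_mem _ (jac_mul_jac hc' hc hx' hx) (jac_mul_jac hc hc' hx hx') hw

theorem trans_self (c : OpenPartialHomeomorph M V) {x : M} (hx : x ∈ c.source) {w : W}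
    (hw : w ∈ b.fib) : b.trans c c x w = w := by
  rw [trans, jac_self c hx, hess_self c hx, b.act_one hw]

theorem trans_trans {c c' c'' : OpenPartialHomeomorph M V} (hc : c ∈ atlas V M)
    (hc' : c' ∈ atlas V M) (hc'' : c'' ∈ atlas V M) {x : M} (hx : x ∈ c.source)
    (hx' : x ∈ c'.source) (hx'' : x ∈ c''.source) {w : W} (hw : w ∈ b.fib) :
    b.trans c' c'' x (b.trans c c' x w) = b.trans c c'' x w := by
  unfold trans
  rw [b.act_comp _ _ (jac_mul_jac hc' hc hx' hx) (jac_mul_jac hc hc' hx hx')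
    (jac_mul_jac hc'' hc' hx'' hx') (jac_mul_jac hc' hc'' hx' hx'') hw,
    ← jac_comp hc hc' hc'' hx hx' hx'', ← jac_comp hc'' hc' hc hx'' hx' hx,
    ← hess_comp hc hc' hc'' hx hx' hx'']

open Classical in
/-- The point of the total space over `x` with fibre coordinate `w` (a default value if `w` is not
in the model fibre). -/
def mkTot (x : M) (w : W) : Tot b M := if h : w ∈ b.fib then ⟨x, w, h⟩ else ⟨x, b.pt, b.pt_mem⟩

theorem mkTot_base (x : M) (w : W) : (b.mkTot x w).base = x := by
  unfold mkTot; split_ifs <;> rfl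

theorem mkTot_of_mem (x : M) {w : W} (hw : w ∈ b.fib) : b.mkTot x w = ⟨x, w, hw⟩ := dif_pos hw

/-- The bundle chart induced by the chart `c` of the base. -/
def chart (c : OpenPartialHomeomorph M V) (hc : c ∈ atlas V M) :
    PartialEquiv (Tot b M) (V × W) where
  toFun p := (c p.base, b.trans (chartAt V p.base) c p.base p.val)
  invFun q := b.mkTot (c.symm q.1) (b.trans c (chartAt V (c.symm q.1)) (c.symm q.1) q.2)
  source := {p | p.base ∈ c.source}
  target := c.target ×ˢ b.fib
  map_source' p hp := ⟨c.map_source hp, b.trans_mem (chart_mem_atlas _ _) hc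
    (mem_chart_source _ _) hp p.mem⟩
  map_target' q hq := by
    rw [Set.mem_ofPred_eq, mkTot_base]
    exact c.map_target hq.1
  left_inv' := by
    rintro ⟨x, w, hw⟩ hp
    have hx : x ∈ c.source := hp
    have key : b.trans c (chartAt V x) x (b.trans (chartAt V x) c x w) = w := by
      rw [b.trans_trans (chart_mem_atlas _ _) hc (chart_mem_atlas _ _) (mem_chart_source _ _) hx
        (mem_chart_source _ _) hw, b.trans_self _ (mem_chart_source _ _) hw]
    simp only [c.left_inv hx, key, b.mkTot_of_mem _ hw]
  right_inv' := by
    rintro ⟨y, w⟩ ⟨hy, hw⟩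
    have hx := c.map_target hy
    have hmem := b.trans_mem hc (chart_mem_atlas _ (c.symm y)) hx (mem_chart_source _ _) hw
    simp only [b.mkTot_of_mem _ hmem]
    rw [b.trans_trans hc (chart_mem_atlas _ _) hc hx (mem_chart_source _ _) hx hw,
      b.trans_self c hx hw, c.right_inv hy]

theorem chart_change_source {c c' : OpenPartialHomeomorph M V} (hc : c ∈ atlas V M)
    (hc' : c' ∈ atlas V M) :
    ((b.chart c hc).symm.trans (b.chart c' hc')).source = (c.symm ≫ₕ c').source ×ˢ b.fib := by
  ext ⟨y, w⟩
  simp only [PartialEquiv.trans_source, PartialEquiv.symm_source, Set.mem_inter_iff,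
    Set.mem_preimage, Set.mem_prod, OpenPartialHomeomorph.trans_source,
    OpenPartialHomeomorph.symm_source]
  have hb : ((b.chart c hc).symm (y, w)).base = c.symm y := b.mkTot_base _ _
  change ((y ∈ c.target ∧ w ∈ b.fib) ∧ ((b.chart c hc).symm (y, w)).base ∈ c'.source) ↔ _
  rw [hb]
  tauto

theorem chart_change_eq {c c' : OpenPartialHomeomorph M V} (hc : c ∈ atlas V M)
    (hc' : c' ∈ atlas V M) {q : V × W} (hq : q ∈ (c.symm ≫ₕ c').source ×ˢ b.fib) :
    ((b.chart c hc).symm.trans (b.chart c' hc')) q =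
      (c' (c.symm q.1), b.trans c c' (c.symm q.1) q.2) := by
  obtain ⟨y, w⟩ := q
  obtain ⟨hy, hw⟩ := hq
  have hy1 : y ∈ c.target := hy.1
  have hy2 : c.symm y ∈ c'.source := hy.2
  have hx := c.map_target hy1
  have hmem := b.trans_mem hc (chart_mem_atlas _ (c.symm y)) hx (mem_chart_source _ _) hw
  change (b.chart c' hc') (b.mkTot _ _) = _
  rw [b.mkTot_of_mem _ hmem]
  change (c' (c.symm y), _) = _
  simp only
  rw [b.trans_trans hc (chart_mem_atlas _ _) hc' hx (mem_chart_source _ _) hy2 hw]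

theorem contDiffOn_chart_change {c c' : OpenPartialHomeomorph M V}
    (hc : c ∈ atlas V M) (hc' : c' ∈ atlas V M) :
    ContDiffOn ℝ ∞ ((b.chart c hc).symm.trans (b.chart c' hc'))
      ((b.chart c hc).symm.trans (b.chart c' hc')).source := by
  rw [chart_change_source]
  have ho : IsOpen (c.symm ≫ₕ c').source := (c.symm ≫ₕ c').open_source
  have h1 : ContDiffOn ℝ ∞ (c' ∘ c.symm) (c.symm ≫ₕ c').source := contDiffOn_change hc hc'
  have h2 : ContDiffOn ℝ ∞ (fderiv ℝ (c' ∘ c.symm)) (c.symm ≫ₕ c').source :=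
    h1.fderiv_of_isOpen ho (by simp)
  have h3 : ContDiffOn ℝ ∞ (fderiv ℝ (fderiv ℝ (c' ∘ c.symm))) (c.symm ≫ₕ c').source :=
    h2.fderiv_of_isOpen ho (by simp)
  have h4 : ContDiffOn ℝ ∞ (fun y => fderiv ℝ (c ∘ c'.symm) ((c' ∘ c.symm) y))
      (c.symm ≫ₕ c').source := by
    refine ((contDiffOn_change hc' hc).fderiv_of_isOpen
      (c'.symm ≫ₕ c).open_source (m := ∞) (by simp)).comp h1 ?_
    intro y hy
    have hy1 : y ∈ c.target := hy.1
    have hy2 : c.symm y ∈ c'.source := hy.2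
    simp [hy2, c'.left_inv hy2, hy1]
  have m1 : Set.MapsTo (Prod.fst : V × W → V) ((c.symm ≫ₕ c').source ×ˢ b.fib)
    (c.symm ≫ₕ c').source := fun q hq => hq.1
  have f1 : ContDiffOn ℝ ∞ (Prod.fst : V × W → V) ((c.symm ≫ₕ c').source ×ˢ b.fib) :=
    contDiffOn_fst
  have f2 : ContDiffOn ℝ ∞ (Prod.snd : V × W → W) ((c.symm ≫ₕ c').source ×ˢ b.fib) :=
    contDiffOn_snd
  have key := (h1.comp f1 m1).prodMk (b.contDiff_act.comp_contDiffOn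
    ((h2.comp f1 m1).prodMk ((h4.comp f1 m1).prodMk ((h3.comp f1 m1).prodMk f2))))
  refine key.congr fun q hq => ?_
  rw [b.chart_change_eq hc hc' hq]
  have hy1 : q.1 ∈ c.target := hq.1.1
  simp [trans, jac, hess, c.right_inv hy1]

/-- The bundle charts form an atlas. -/
def core (b : NatBundle V W) (M : Type*) [TopologicalSpace M] [ChartedSpace V M]
    [IsManifold 𝓘(ℝ, V) ∞ M] : ChartedSpaceCore (V × W) (Tot b M) where
  atlas := {e | ∃ c, ∃ hc : c ∈ atlas V M, e = b.chart c hc}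
  chartAt p := b.chart (chartAt V p.base) (chart_mem_atlas _ _)
  mem_chart_source p := mem_chart_source V p.base
  chart_mem_atlas p := ⟨_, chart_mem_atlas _ _, rfl⟩
  open_source := by
    rintro _ _ ⟨c, hc, rfl⟩ ⟨c', hc', rfl⟩
    rw [chart_change_source]
    exact (c.symm ≫ₕ c').open_source.prod b.isOpen_fib
  continuousOn_toFun := by
    rintro _ _ ⟨c, hc, rfl⟩ ⟨c', hc', rfl⟩
    exact (b.contDiffOn_chart_change hc hc').continuousOn

end NatBundle

instance (b : NatBundle V W) : TopologicalSpace (Tot b M) := (b.core M).toTopologicalSpace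

instance (b : NatBundle V W) : ChartedSpace (V × W) (Tot b M) := (b.core M).toChartedSpace

instance (b : NatBundle V W) : IsManifold 𝓘(ℝ, V × W) ∞ (Tot b M) := by
  refine isManifold_of_contDiffOn _ _ _ ?_
  rintro e e' he he'
  change e ∈ ⋃ (e : PartialEquiv (Tot b M) (V × W)) (he : e ∈ (b.core M).atlas),
    {(b.core M).openPartialHomeomorph e he} at he
  change e' ∈ ⋃ (e : PartialEquiv (Tot b M) (V × W)) (he : e ∈ (b.core M).atlas),
    {(b.core M).openPartialHomeomorph e he} at he'
  simp only [Set.mem_iUnion, Set.mem_singleton_iff] at he he'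
  obtain ⟨_, ⟨c, hc, rfl⟩, rfl⟩ := he
  obtain ⟨_, ⟨c', hc', rfl⟩, rfl⟩ := he'
  simp only [modelWithCornersSelf_coe, modelWithCornersSelf_coe_symm, Function.id_comp,
    Function.comp_id, Set.preimage_id, Set.range_id, Set.inter_univ]
  exact b.contDiffOn_chart_change hc hc'
end

section Bundles

/-- Bilinear forms. -/
abbrev Bil (V : Type) [NormedAddCommGroup V] [NormedSpace ℝ V] : Type := V →L[ℝ] V →L[ℝ] ℝ

/-- Symmetric bilinear forms. -/
def symSub (V : Type) [NormedAddCommGroup V] [NormedSpace ℝ V] : Submodule ℝ (Bil V) where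
  carrier := {g | ∀ v w, g v w = g w v}
  add_mem' := by
    intro a b ha hb v w
    simp [ha v w, hb v w]
  zero_mem' := by simp
  smul_mem' := by
    intro r a ha v w
    simp [ha v w]

/-- The space of symmetric bilinear forms, as a type of its own. -/
def SymBil (V : Type) [NormedAddCommGroup V] [NormedSpace ℝ V] : Type := symSub V

instance : NormedAddCommGroup (SymBil V) := Submodule.normedAddCommGroup (symSub V)

instance : NormedSpace ℝ (SymBil V) := Submodule.normedSpace (symSub V)

instance [FiniteDimensional ℝ V] : FiniteDimensional ℝ (SymBil V) :=
  inferInstanceAs (FiniteDimensional ℝ (symSub V))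

/-- The inclusion of symmetric bilinear forms in all bilinear forms. -/
def SymBil.toBil : SymBil V →L[ℝ] Bil V := (symSub V).subtypeL

instance : CoeOut (SymBil V) (Bil V) := ⟨fun g => SymBil.toBil g⟩

theorem SymBil.symm (g : SymBil V) (v w : V) : (g : Bil V) v w = (g : Bil V) w v := g.2 v w

theorem SymBil.ext' {g h : SymBil V} (H : ∀ v w, (g : Bil V) v w = (h : Bil V) v w) : g = h :=
  Subtype.ext (ContinuousLinearMap.ext fun v => ContinuousLinearMap.ext (H v))

/-- Symmetric part; used below to record that a bilinear form which is visibly symmetric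
lies in `symSub V`. -/
def symPart (V : Type) [NormedAddCommGroup V] [NormedSpace ℝ V] : Bil V →L[ℝ] SymBil V :=
  ((1 / 2 : ℝ) • (ContinuousLinearMap.id ℝ (Bil V) +
    (ContinuousLinearMap.flipₗᵢ ℝ V V ℝ : Bil V →L[ℝ] Bil V))).codRestrict (symSub V)
    (by intro g v w; simp; ring)

theorem symPart_apply (g : Bil V) (v w : V) :
    (symPart V g : Bil V) v w = (g v w + g w v) / 2 := by
  change ((1 / 2 : ℝ) • (g + g.flip)) v w = _
  simp only [smul_apply, add_apply, ContinuousLinearMap.flip_apply, smul_eq_mul]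
  ring

theorem symPart_of_sym {g : Bil V} (hg : g ∈ symSub V) : (symPart V g : Bil V) = g := by
  ext v w
  rw [symPart_apply, hg w v]; ring

/-- `pullB a g (v, w) = g(a v, a w)`. -/
def pullB (a : Op V) : Bil V →L[ℝ] Bil V :=
  ContinuousLinearMap.compL ℝ V (V →L[ℝ] ℝ) (V →L[ℝ] ℝ)
      ((ContinuousLinearMap.compL ℝ V V ℝ).flip a) ∘L
    (ContinuousLinearMap.compL ℝ V V (V →L[ℝ] ℝ)).flip a

@[simp]
theorem pullB_apply (a : Op V) (g : Bil V) (v w : V) : pullB a g v w = g (a v) (a w) := rfl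

theorem contDiff_pullB : ContDiff ℝ ∞ (pullB : Op V → Bil V →L[ℝ] Bil V) := by
  exact (((ContinuousLinearMap.compL ℝ V (V →L[ℝ] ℝ) (V →L[ℝ] ℝ)).contDiff).comp
    (ContinuousLinearMap.compL ℝ V V ℝ).flip.contDiff).clm_comp
      (ContinuousLinearMap.compL ℝ V V (V →L[ℝ] ℝ)).flip.contDiff

theorem contDiff_postL : ContDiff ℝ ∞ (postL : Op V → Op V →L[ℝ] Op V) :=
  (ContinuousLinearMap.compL ℝ V V V).contDiff

theorem contDiff_preL : ContDiff ℝ ∞ (preL : Op V → Op V →L[ℝ] Op V) :=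
  (ContinuousLinearMap.compL ℝ V V V).flip.contDiff

/-- A nondegenerate symmetric bilinear form, with the inverse `sharp` of `v ↦ form(v, ·)`. -/
structure Signature (V : Type) [NormedAddCommGroup V] [NormedSpace ℝ V] where
  form : Bil V
  sym : ∀ v w, form v w = form w v
  sharp : (V →L[ℝ] ℝ) →L[ℝ] V
  form_sharp : ∀ f, form (sharp f) = f

/-- `g` is isometric to the model form `η`. -/
def HasSignature (η : Signature V) (g : Bil V) : Prop :=
  ∃ e : Op V, IsUnit e ∧ ∀ v w, g (e v) (e w) = η.form v w

set_option maxHeartbeats 800000 in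
theorem isOpen_hasSignature [CompleteSpace V] [FiniteDimensional ℝ V] (η : Signature V) :
    IsOpen {g : SymBil V | HasSignature η (g : Bil V)} := by
  rw [isOpen_iff_mem_nhds]
  rintro g ⟨e, he, hg⟩
  let f : Op V → SymBil V := fun a => symPart V (pullB a (g : Bil V))
  have hf : ContDiff ℝ ∞ f :=
    (symPart V).contDiff.comp (contDiff_pullB.clm_apply contDiff_const)
  have hstrict : HasStrictFDerivAt f (fderiv ℝ f 1) 1 :=
    hf.contDiffAt.hasStrictFDerivAt (by simp)
  have hderiv : ∀ b : Op V, fderiv ℝ f 1 b = (2 : ℝ) • symPart V ((g : Bil V) ∘L b) := by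
    intro b
    have h1 : HasDerivAt (fun t : ℝ => f (1 + t • b)) (fderiv ℝ f 1 b) 0 := by
      have h2 : HasFDerivAt f (fderiv ℝ f 1) (1 + (0 : ℝ) • b) := by
        simpa using hstrict.hasFDerivAt
      have h3 : HasDerivAt (fun t : ℝ => (1 : Op V) + t • b) b 0 := by
        simpa using ((hasDerivAt_id (0 : ℝ)).smul_const b).const_add (1 : Op V)
      have h9 := h2.comp_hasDerivAt (0 : ℝ) h3
      exact h9
    have h4 : ∀ t : ℝ, f (1 + t • b) =
        g + t • ((2 : ℝ) • symPart V ((g : Bil V) ∘L b)) +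
          (t ^ 2) • symPart V (pullB b (g : Bil V)) := by
      intro t
      refine SymBil.ext' fun v w => ?_
      have hs := g.symm
      have e1 : (g : Bil V) v (b w) = (g : Bil V) (b w) v := hs _ _
      have e2 : (g : Bil V) w (b v) = (g : Bil V) (b v) w := hs _ _
      have e3 : (g : Bil V) w v = (g : Bil V) v w := hs _ _
      simp only [f, symPart_apply, pullB_apply, map_add, map_smul,
        add_apply, smul_apply, map_add, map_smul,
        one_apply_eq_self, smul_eq_mul, ContinuousLinearMap.comp_apply, e1, e2, e3]
      ring
    have h5 : HasDerivAt (fun t : ℝ => f (1 + t • b))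
        ((2 : ℝ) • symPart V ((g : Bil V) ∘L b)) 0 := by
      simp only [h4]
      have := (((hasDerivAt_id (0 : ℝ)).smul_const
        ((2 : ℝ) • symPart V ((g : Bil V) ∘L b))).const_add g).fun_add
        ((hasDerivAt_pow 2 (0 : ℝ)).smul_const (symPart V (pullB b (g : Bil V))))
      simpa using this
    have h8 := h1.unique h5
    exact h8
  have hsurj : (fderiv ℝ f 1).range = ⊤ := by
    rw [LinearMap.range_eq_top]
    intro s
    obtain ⟨e', rfl⟩ := he
    let b : Op V := (e' : Op V) ∘L η.sharp ∘L ((1 / 2 : ℝ) •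
      ((ContinuousLinearMap.compL ℝ V V ℝ).flip (e' : Op V) ∘L (s : Bil V)))
    refine ⟨b, ?_⟩
    have hb : ∀ v w, (g : Bil V) (b v) w = (1 / 2) * (s : Bil V) v w := by
      intro v w
      obtain ⟨u, rfl⟩ : ∃ u, w = (e' : Op V) u :=
        ⟨((e'⁻¹ : (Op V)ˣ) : Op V) w, by
          rw [← mul_apply_eq_comp, Units.mul_inv, one_apply_eq_self]⟩
      change (g : Bil V) ((e' : Op V) (η.sharp _)) _ = _
      rw [hg, η.form_sharp]
      rfl
    change fderiv ℝ f 1 b = s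
    rw [hderiv]
    refine SymBil.ext' fun v w => ?_
    have e3 : (s : Bil V) w v = (s : Bil V) v w := s.symm _ _
    simp only [map_smul, smul_apply, symPart_apply,
      ContinuousLinearMap.comp_apply, hb, smul_eq_mul, e3]
    ring
  have hmap := hstrict.map_nhds_eq_of_surj hsurj
  have hf1 : f 1 = g := by
    refine SymBil.ext' fun v w => ?_
    have e3 : (g : Bil V) w v = (g : Bil V) v w := g.symm _ _
    simp only [f, symPart_apply, pullB_apply, one_apply_eq_self, e3]
    ring
  rw [hf1] at hmap
  rw [← hmap, Filter.mem_map]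
  filter_upwards [Units.isOpen.mem_nhds (isUnit_one : IsUnit (1 : Op V))] with a ha
  obtain ⟨a', rfl⟩ := (ha : IsUnit a)
  obtain ⟨e', rfl⟩ := he
  refine ⟨((a'⁻¹ * e' : (Op V)ˣ) : Op V), Units.isUnit _, fun v w => ?_⟩
  have hs : pullB (a' : Op V) (g : Bil V) ∈ symSub V := fun v w => g.symm _ _
  have h0 : ∀ v, (a' : Op V) (((a'⁻¹ * e' : (Op V)ˣ) : Op V) v) = (e' : Op V) v := by
    intro v
    rw [← mul_apply_eq_comp, ← Units.val_mul, mul_inv_cancel_left]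
  simp only [f, symPart_of_sym hs, pullB_apply, h0, hg]


theorem HasSignature.pullB {η : Signature V} {g : Bil V} (hs : g ∈ symSub V)
    (hg : HasSignature η g) {A A' : Op V} (h : A * A' = 1) (h' : A' * A = 1) :
    HasSignature η (symPart V (PalatiniEH.pullB A' g) : Bil V) := by
  obtain ⟨e, he, hge⟩ := hg
  have hs' : PalatiniEH.pullB A' g ∈ symSub V := fun v w => hs _ _
  refine ⟨A * e, IsUnit.mul ⟨⟨A, A', h, h'⟩, rfl⟩ he, fun v w => ?_⟩
  have h0 : ∀ v, A' ((A * e) v) = e v := fun v => by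
    rw [← mul_apply_eq_comp, ← mul_assoc, h', one_mul]
  rw [symPart_of_sym hs', pullB_apply, h0, h0, hge]

/-- `J¹LM`: the fibre coordinates are a frame `e : V → T_x M` and the derivative `e'` of a local
frame field, `e' u` being the derivative in the direction `u`. -/
def frameJet (V : Type) [NormedAddCommGroup V] [NormedSpace ℝ V] [CompleteSpace V] :
    NatBundle V (Op V × (V →L[ℝ] Op V)) where
  fib := {q | IsUnit q.1}
  isOpen_fib := Units.isOpen.preimage continuous_fst
  pt := (1, 0)
  pt_mem := isUnit_one
  act A A' B q := (A * q.1, postL A ∘L q.2 ∘L A' + preL q.1 ∘L B ∘L A')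
  contDiff_act := by
    have hA' : ContDiff ℝ ∞ fun q : Op V × Op V × Op2 V × Op V × (V →L[ℝ] Op V) => q.2.1 :=
      contDiff_fst.comp contDiff_snd
    have hB : ContDiff ℝ ∞ fun q : Op V × Op V × Op2 V × Op V × (V →L[ℝ] Op V) => q.2.2.1 :=
      contDiff_fst.comp (contDiff_snd.comp contDiff_snd)
    have he : ContDiff ℝ ∞ fun q : Op V × Op V × Op2 V × Op V × (V →L[ℝ] Op V) => q.2.2.2.1 :=
      contDiff_fst.comp (contDiff_snd.comp (contDiff_snd.comp contDiff_snd))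
    have hf : ContDiff ℝ ∞ fun q : Op V × Op V × Op2 V × Op V × (V →L[ℝ] Op V) => q.2.2.2.2 :=
      contDiff_snd.comp (contDiff_snd.comp (contDiff_snd.comp contDiff_snd))
    exact (contDiff_fst.clm_comp he).prodMk
      (((contDiff_postL.comp contDiff_fst).clm_comp (hf.clm_comp hA')).add
        ((contDiff_preL.comp he).clm_comp (hB.clm_comp hA')))
  act_mem {A A'} _ _ h h' hw := IsUnit.mul ⟨⟨A, A', h, h'⟩, rfl⟩ hw
  act_one _ := by simp; rfl
  act_comp {A₁ A₁' A₂ A₂'} B₁ B₂ q h1 h1' h2 h2' _ := by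
    have k1 : ∀ x, A₁ (A₁' x) = x := fun x => by rw [← mul_apply_eq_comp, h1, one_apply_eq_self]
    refine Prod.ext (mul_assoc _ _ _).symm ?_
    ext1 u
    ext1 v
    simp [k1]
    abel

/-- `C(LM)`, the bundle of linear connections: the fibre coordinate is the Christoffel symbol `Γ`,
with `∇_u v = D_u v + Γ(u) v`. -/
def connB (V : Type) [NormedAddCommGroup V] [NormedSpace ℝ V] : NatBundle V (Op2 V) where
  fib := Set.univ
  isOpen_fib := isOpen_univ
  pt := 0
  pt_mem := trivial
  act A A' B Γ := postL A ∘L preL A' ∘L Γ ∘L A' - preL A' ∘L B ∘L A'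
  contDiff_act := by
    have hA' : ContDiff ℝ ∞ fun q : Op V × Op V × Op2 V × Op2 V => q.2.1 :=
      contDiff_fst.comp contDiff_snd
    have hB : ContDiff ℝ ∞ fun q : Op V × Op V × Op2 V × Op2 V => q.2.2.1 :=
      contDiff_fst.comp (contDiff_snd.comp contDiff_snd)
    have hΓ : ContDiff ℝ ∞ fun q : Op V × Op V × Op2 V × Op2 V => q.2.2.2 :=
      contDiff_snd.comp (contDiff_snd.comp contDiff_snd)
    have hp := contDiff_preL.comp hA'
    exact ((contDiff_postL.comp contDiff_fst).clm_comp (hp.clm_comp (hΓ.clm_comp hA'))).sub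
      (hp.clm_comp (hB.clm_comp hA'))
  act_mem _ _ _ _ _ := trivial
  act_one _ := by ext; simp
  act_comp {A₁ A₁' A₂ A₂'} B₁ B₂ q h1 h1' h2 h2' _ := by
    have k1 : ∀ x, A₁ (A₁' x) = x := fun x => by rw [← mul_apply_eq_comp, h1, one_apply_eq_self]
    ext1 u
    ext1 v
    simp [k1]
    abel

/-- `Σ`, the bundle of metrics isometric to `η` at every point. -/
def metricB [CompleteSpace V] [FiniteDimensional ℝ V] (η : Signature V) :
    NatBundle V (SymBil V) where
  fib := {g | HasSignature η (g : Bil V)}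
  isOpen_fib := isOpen_hasSignature η
  pt := ⟨η.form, η.sym⟩
  pt_mem := ⟨1, isUnit_one, fun _ _ => rfl⟩
  act _ A' _ g := symPart V (pullB A' (g : Bil V))
  contDiff_act := by
    have h1 : ContDiff ℝ ∞ fun q : Op V × Op V × Op2 V × SymBil V => pullB q.2.1 :=
      contDiff_pullB.comp (contDiff_fst.comp contDiff_snd)
    have h2 : ContDiff ℝ ∞ fun q : Op V × Op V × Op2 V × SymBil V => (q.2.2.2 : Bil V) :=
      SymBil.toBil.contDiff.comp (contDiff_snd.comp (contDiff_snd.comp contDiff_snd))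
    exact (symPart V).contDiff.comp (h1.clm_apply h2)
  act_mem {A A'} _ {g} h h' hg := hg.pullB g.symm h h'
  act_one {g} _ := by
    apply Subtype.ext
    exact symPart_of_sym (g := pullB 1 (g : Bil V)) fun v w => g.symm v w
  act_comp {A₁ A₁' A₂ A₂'} B₁ B₂ q h1 h1' h2 h2' _ := by
    refine SymBil.ext' fun v w => ?_
    have hq : (q : Bil V) ∈ symSub V := q.symm
    simp only [symPart_apply, pullB_apply, mul_apply_eq_comp]
    ring

/-- `u ↦ g (A' (B (A' u) (A' ·))) (A' ·)`. -/
def jetCorr (A' : Op V) (B : Op2 V) (g : Bil V) : V →L[ℝ] Bil V :=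
  pullB A' ∘L ContinuousLinearMap.compL ℝ V V (V →L[ℝ] ℝ) g ∘L
    postL A' ∘L B ∘L A'

theorem jetCorr_apply (A' : Op V) (B : Op2 V) (g : Bil V) (u v w : V) :
    jetCorr A' B g u v w = g (A' (B (A' u) (A' v))) (A' w) := rfl

/-- Transformation of the first derivatives `h` of a metric `g`, see `jetAct_apply`. -/
def jetAct (A' : Op V) (B : Op2 V) (g : SymBil V) (h : V →L[ℝ] SymBil V) :
    V →L[ℝ] SymBil V :=
  symPart V ∘L (pullB A' ∘L SymBil.toBil ∘L h ∘L A' -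
    (jetCorr A' B (g : Bil V) + jetCorr A' B (g : Bil V)))

theorem jetAct_apply (A' : Op V) (B : Op2 V) (g : SymBil V) (h : V →L[ℝ] SymBil V)
    (u v w : V) :
    (jetAct A' B g h u : Bil V) v w = (h (A' u) : Bil V) (A' v) (A' w) -
      (g : Bil V) (A' (B (A' u) (A' v))) (A' w) - (g : Bil V) (A' v) (A' (B (A' u) (A' w))) := by
  have h0 : (jetAct A' B g h u : Bil V) v w =
    (((h (A' u) : Bil V) (A' v) (A' w) - ((g : Bil V) (A' (B (A' u) (A' v))) (A' w) +
        (g : Bil V) (A' (B (A' u) (A' v))) (A' w))) +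
      ((h (A' u) : Bil V) (A' w) (A' v) - ((g : Bil V) (A' (B (A' u) (A' w))) (A' v) +
        (g : Bil V) (A' (B (A' u) (A' w))) (A' v)))) / 2 := symPart_apply _ v w
  have h1 : (h (A' u) : Bil V) (A' w) (A' v) = (h (A' u) : Bil V) (A' v) (A' w) := (h (A' u)).symm _ _
  have h2 : (g : Bil V) (A' (B (A' u) (A' w))) (A' v) = (g : Bil V) (A' v) (A' (B (A' u) (A' w))) :=
    g.symm _ _
  rw [h0, h1, h2]
  ring

theorem contDiff_jetAct : ContDiff ℝ ∞
    fun q : Op V × Op V × Op2 V × SymBil V × (V →L[ℝ] SymBil V) =>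
      (symPart V (pullB q.2.1 (q.2.2.2.1 : Bil V)), jetAct q.2.1 q.2.2.1 q.2.2.2.1 q.2.2.2.2) := by
  have hA' : ContDiff ℝ ∞ fun q : Op V × Op V × Op2 V × SymBil V × (V →L[ℝ] SymBil V) =>
      q.2.1 := contDiff_fst.comp contDiff_snd
  have hB : ContDiff ℝ ∞ fun q : Op V × Op V × Op2 V × SymBil V × (V →L[ℝ] SymBil V) =>
      q.2.2.1 := contDiff_fst.comp (contDiff_snd.comp contDiff_snd)
  have hg : ContDiff ℝ ∞ fun q : Op V × Op V × Op2 V × SymBil V × (V →L[ℝ] SymBil V) =>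
      (q.2.2.2.1 : Bil V) := SymBil.toBil.contDiff.comp
        (contDiff_fst.comp (contDiff_snd.comp (contDiff_snd.comp contDiff_snd)))
  have hh : ContDiff ℝ ∞ fun q : Op V × Op V × Op2 V × SymBil V × (V →L[ℝ] SymBil V) =>
      q.2.2.2.2 := contDiff_snd.comp (contDiff_snd.comp (contDiff_snd.comp contDiff_snd))
  have h1 := contDiff_pullB.comp hA'
  have h3 : ContDiff ℝ ∞ fun q : Op V × Op V × Op2 V × SymBil V × (V →L[ℝ] SymBil V) =>
      jetCorr q.2.1 q.2.2.1 (q.2.2.2.1 : Bil V) :=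
    h1.clm_comp ((((ContinuousLinearMap.compL ℝ V V
        (V →L[ℝ] ℝ)).contDiff.comp hg)).clm_comp
          ((contDiff_postL.comp hA').clm_comp (hB.clm_comp hA')))
  exact ((symPart V).contDiff.comp (h1.clm_apply hg)).prodMk
    (contDiff_const.clm_comp ((h1.clm_comp (contDiff_const.clm_comp (hh.clm_comp hA'))).sub
      (h3.add h3)))

/-- `J¹Σ`: the fibre coordinates are a metric `g` and the derivative `h` of a local metric field,
`h u` being the derivative in the direction `u`. -/
def metricJet [CompleteSpace V] [FiniteDimensional ℝ V] (η : Signature V) :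
    NatBundle V (SymBil V × (V →L[ℝ] SymBil V)) where
  fib := {q | HasSignature η (q.1 : Bil V)}
  isOpen_fib := (isOpen_hasSignature η).preimage continuous_fst
  pt := (⟨η.form, η.sym⟩, 0)
  pt_mem := ⟨1, isUnit_one, fun _ _ => rfl⟩
  act _ A' B q := (symPart V (pullB A' (q.1 : Bil V)), jetAct A' B q.1 q.2)
  contDiff_act := contDiff_jetAct
  act_mem {A A'} _ {q} h h' hg := HasSignature.pullB q.1.symm hg h h'
  act_one {q} _ := by
    refine Prod.ext ?_ ?_
    · apply Subtype.ext
      exact symPart_of_sym (g := pullB 1 (q.1 : Bil V)) fun v w => q.1.symm v w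
    · refine ContinuousLinearMap.ext fun u => ?_
      refine SymBil.ext' fun v w => ?_
      simp only [jetAct_apply, one_apply_eq_self, zero_apply, map_zero, sub_zero]
  act_comp {A₁ A₁' A₂ A₂'} B₁ B₂ q h1 h1' h2 h2' _ := by
    have k1 : ∀ x, A₁ (A₁' x) = x := fun x => by rw [← mul_apply_eq_comp, h1, one_apply_eq_self]
    have k3 : ∀ x, A₂' (A₂ x) = x := fun x => by rw [← mul_apply_eq_comp, h2', one_apply_eq_self]
    refine Prod.ext ?_ ?_
    · refine SymBil.ext' fun v w => ?_
      simp only [symPart_apply, pullB_apply, mul_apply_eq_comp]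
      ring
    · refine ContinuousLinearMap.ext fun u => ?_
      refine SymBil.ext' fun v w => ?_
      have hs : pullB A₁' (q.1 : Bil V) ∈ symSub V := fun v w => q.1.symm _ _
      simp only [jetAct_apply, symPart_of_sym hs, pullB_apply, mul_apply_eq_comp, add_apply,
        ContinuousLinearMap.comp_apply, ContinuousLinearMap.compL_apply,
        ContinuousLinearMap.flip_apply, map_add, k1, k3]
      ring

/-- Fibre product over the base. -/
def NatBundle.prod {W₁ W₂ : Type} [NormedAddCommGroup W₁] [NormedSpace ℝ W₁]
    [NormedAddCommGroup W₂] [NormedSpace ℝ W₂] (b₁ : NatBundle V W₁) (b₂ : NatBundle V W₂) :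
    NatBundle V (W₁ × W₂) where
  fib := b₁.fib ×ˢ b₂.fib
  isOpen_fib := b₁.isOpen_fib.prod b₂.isOpen_fib
  pt := (b₁.pt, b₂.pt)
  pt_mem := ⟨b₁.pt_mem, b₂.pt_mem⟩
  act A A' B w := (b₁.act A A' B w.1, b₂.act A A' B w.2)
  contDiff_act := by
    have h1 := b₁.contDiff_act
    have h2 := b₂.contDiff_act
    exact (h1.comp (g := fun q : Op V × Op V × Op2 V × W₁ => b₁.act q.1 q.2.1 q.2.2.1 q.2.2.2)
      (f := fun q : Op V × Op V × Op2 V × W₁ × W₂ => (q.1, q.2.1, q.2.2.1, q.2.2.2.1))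
      (by fun_prop)).prodMk
      (h2.comp (g := fun q : Op V × Op V × Op2 V × W₂ => b₂.act q.1 q.2.1 q.2.2.1 q.2.2.2)
      (f := fun q : Op V × Op V × Op2 V × W₁ × W₂ => (q.1, q.2.1, q.2.2.1, q.2.2.2.2))
      (by fun_prop))
  act_mem B _ h h' hw := ⟨b₁.act_mem B h h' hw.1, b₂.act_mem B h h' hw.2⟩
  act_one hw := Prod.ext (b₁.act_one hw.1) (b₂.act_one hw.2)
  act_comp B₁ B₂ _ h1 h1' h2 h2' hw :=
    Prod.ext (b₁.act_comp B₁ B₂ h1 h1' h2 h2' hw.1) (b₂.act_comp B₁ B₂ h1 h1' h2 h2' hw.2)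

end Bundles

section Gravity

/-! ### Minkowski form -/

/-- Diagonal entries `(-1, 1, …, 1)` of the Minkowski form (they are their own inverses). -/
def eta {n : ℕ} (i : Fin n) : ℝ := if i.val = 0 then -1 else 1

/-- The canonical basis of `ℝⁿ`. -/
abbrev ε {n : ℕ} (i : Fin n) : Vec n := EuclideanSpace.single i 1

/-- The Minkowski form `η(v, w) = ∑ i, η_ii v^i w^i` of signature `(-, +, …, +)`. -/
def etaBil (n : ℕ) : Bil (Vec n) :=
  ∑ i : Fin n, eta i • (EuclideanSpace.proj i : Vec n →L[ℝ] ℝ).smulRight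
    (EuclideanSpace.proj i : Vec n →L[ℝ] ℝ)

theorem etaBil_apply {n : ℕ} (v w : Vec n) : etaBil n v w = ∑ i, eta i * (v i * w i) := by
  simp [etaBil]

/-- The Minkowski form together with its inverse. -/
def minkowski (n : ℕ) : Signature (Vec n) where
  form := etaBil n
  sym v w := by
    simp only [etaBil_apply]
    exact Finset.sum_congr rfl fun i _ => by ring
  sharp := ∑ i : Fin n, eta i • (ContinuousLinearMap.apply ℝ ℝ (ε i : Vec n)).smulRight (ε i)
  form_sharp f := by
    ext w
    have h1 : ∀ i : Fin n, eta i * eta i = 1 := fun i => by unfold eta; split_ifs <;> norm_num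
    have h2 : w = ∑ i, w i • (ε i : Vec n) := by
      ext j
      simp [Finset.sum_apply, Pi.single_apply]
    rw [etaBil_apply]
    conv_rhs => rw [h2, map_sum]
    refine Finset.sum_congr rfl fun i _ => ?_
    simp [Pi.single_apply]
    linear_combination (f (ε i) * w i) * h1 i

/-! ### The bundles -/

variable (n : ℕ) (M : Type*)

/-- Model space of `J¹LM`. -/
abbrev FrameJetModel : Type := Vec n × (Op (Vec n) × (Vec n →L[ℝ] Op (Vec n)))

/-- Model space of `C(LM) ×_M Σ`. -/
abbrev ConnMetricModel : Type := Vec n × (Op2 (Vec n) × SymBil (Vec n))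

/-- Model space of `J¹Σ`. -/
abbrev MetricJetModel : Type := Vec n × (SymBil (Vec n) × (Vec n →L[ℝ] SymBil (Vec n)))

/-- Model space of `C(LM) ×_M J¹Σ`. -/
abbrev ConnMetricJetModel : Type :=
  Vec n × (Op2 (Vec n) × (SymBil (Vec n) × (Vec n →L[ℝ] SymBil (Vec n))))

/-- The first jet bundle `J¹LM` of the frame bundle of `M`. -/
abbrev FrameJet : Type _ := Tot (frameJet (Vec n)) M

/-- `C(LM) ×_M Σ`, linear connections and Lorentzian metrics. -/
abbrev ConnMetric : Type _ := Tot ((connB (Vec n)).prod (metricB (minkowski n))) M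

/-- The first jet bundle `J¹Σ` of the bundle of Lorentzian metrics of `M`. -/
abbrev MetricJet : Type _ := Tot (metricJet (minkowski n)) M

/-- `C(LM) ×_M J¹Σ`. -/
abbrev ConnMetricJet : Type _ := Tot ((connB (Vec n)).prod (metricJet (minkowski n))) M

variable {n M}

/-- The metric for which the frame `e` is orthonormal: `g(v, w) = η(e⁻¹ v, e⁻¹ w)`. -/
def frameMetric (e : Op (Vec n)) : SymBil (Vec n) :=
  symPart (Vec n) (pullB (Ring.inverse e) (etaBil n))

theorem hasSignature_frameMetric {e : Op (Vec n)} (he : IsUnit e) :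
    HasSignature (minkowski n) (frameMetric e : Bil (Vec n)) :=
  HasSignature.pullB (η := minkowski n) (minkowski n).sym ⟨1, isUnit_one, fun _ _ => rfl⟩
    (Ring.mul_inverse_cancel e he) (Ring.inverse_mul_cancel e he)

/-- The quotient map `J¹LM → C(LM) ×_M Σ` by the pseudo-orthogonal group: the connection
`Γ(u) v = -e'(u) (e⁻¹ v)` for which the jet `(e, e')` is horizontal, and the metric for which `e`
is orthonormal. -/
def pH (p : FrameJet n M) : ConnMetric n M where
  base := p.base
  val := (-(preL (Ring.inverse p.val.1) ∘L p.val.2), frameMetric p.val.1)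
  mem := ⟨trivial, hasSignature_frameMetric p.mem⟩

/-- The projection `p₂ : C(LM) ×_M J¹Σ → J¹Σ`. -/
def p2 (q : ConnMetricJet n M) : MetricJet n M := ⟨q.base, q.val.2, q.mem.2⟩

/-- The projection `Π : C(LM) ×_M J¹Σ → C(LM) ×_M Σ` induced by `J¹Σ → Σ`. -/
def projCM (q : ConnMetricJet n M) : ConnMetric n M := ⟨q.base, (q.val.1, q.val.2.1), q.mem⟩

/-! ### Canonical forms on `J¹LM`, Palatini Lagrangian and exterior differential system -/

/-- A linear functional as an alternating 1-form. -/
abbrev oneForm {E : Type*} [NormedAddCommGroup E] [NormedSpace ℝ E] (f : E →L[ℝ] ℝ) :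
    E [⋀^Fin 1]→L[ℝ] ℝ := ContinuousAlternatingMap.ofSubsingleton ℝ E ℝ 0 f

/-- The canonical `ℝⁿ`-valued form `θ = e⁻¹ dx`. -/
def thetaV (p : FrameJet n M) : FrameJetModel n →L[ℝ] Vec n :=
  Ring.inverse p.val.1 ∘L ContinuousLinearMap.fst ℝ _ _

/-- The canonical `gl(n)`-valued connection form `ω = e⁻¹ (de - e' dx)`. -/
def omegaV (p : FrameJet n M) : FrameJetModel n →L[ℝ] Op (Vec n) :=
  postL (Ring.inverse p.val.1) ∘L
    (ContinuousLinearMap.fst ℝ _ _ ∘L ContinuousLinearMap.snd ℝ _ _ -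
      p.val.2 ∘L ContinuousLinearMap.fst ℝ _ _)

/-- `θ^i`. -/
def thetaF (i : Fin n) : DForm (FrameJetModel n) (FrameJet n M) 1 := fun p =>
  oneForm ((EuclideanSpace.proj i : Vec n →L[ℝ] ℝ) ∘L thetaV p)

/-- `ω^i_j`. -/
def omegaF (i j : Fin n) : DForm (FrameJetModel n) (FrameJet n M) 1 := fun p =>
  oneForm ((EuclideanSpace.proj i : Vec n →L[ℝ] ℝ) ∘L
    ContinuousLinearMap.apply ℝ (Vec n) (ε j : Vec n) ∘L omegaV p)

/-- The Euclidean volume form of `ℝⁿ`. -/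
def detForm (n : ℕ) : Vec n [⋀^Fin n]→L[ℝ] ℝ :=
  { (EuclideanSpace.basisFun (Fin n) ℝ).toBasis.det with
    cont := by
      change Continuous fun v : Fin n → Vec n => (EuclideanSpace.basisFun (Fin n) ℝ).toBasis.det v
      simp only [Module.Basis.det_apply]
      refine Continuous.matrix_det (continuous_matrix fun i j => ?_)
      simp only [Module.Basis.toMatrix_apply, OrthonormalBasis.coe_toBasis_repr_apply,
        EuclideanSpace.basisFun_repr]
      fun_prop }

/-- `θ_kl = (1/(n-2)!) ε_{k l i₃ … iₙ} θ^{i₃} ∧ … ∧ θ^{iₙ}`, the contraction of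
`θ¹ ∧ … ∧ θⁿ` in its first two arguments with the vectors dual to `θ^k`, `θ^l`. -/
def thetaKL {m : ℕ} (k l : Fin (m + 2)) :
    DForm (FrameJetModel (m + 2)) (FrameJet (m + 2) M) m := fun p =>
  (((detForm (m + 2)).curryLeft (ε k)).curryLeft (ε l)).compContinuousLinearMap (thetaV p)

/-- The metricity forms `(π_𝔭 ω)^{ij} = η^{ik} ω^j_k + η^{jk} ω^i_k`. -/
def metricity (i j : Fin n) : DForm (FrameJetModel n) (FrameJet n M) 1 :=
  eta i • omegaF j i + eta j • omegaF i j

variable [TopologicalSpace M] [ChartedSpace (Vec n) M] [IsManifold (𝓡 n) ∞ M]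

/-- Torsion `T^i = dθ^i + ω^i_k ∧ θ^k`. -/
def torsion (i : Fin n) : DForm (FrameJetModel n) (FrameJet n M) 2 :=
  extD (thetaF i) + ∑ k, wedge (omegaF i k) (thetaF k)

/-- Curvature `Ω^i_j = dω^i_j + ω^i_k ∧ ω^k_j`. -/
def curvature (i j : Fin n) : DForm (FrameJetModel n) (FrameJet n M) 2 :=
  extD (omegaF i j) + ∑ k, wedge (omegaF i k) (omegaF k j)

variable (n M) in
/-- The exterior differential system `⟨π_𝔭 ω, T⟩_diff` on `J¹LM`. -/
def palatiniEDS : FormSet (FrameJetModel n) (FrameJet n M) :=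
  diffIdeal ({a | ∃ i j : Fin n, a = ⟨1, metricity i j⟩} ∪ {a | ∃ i : Fin n, a = ⟨2, torsion i⟩})

variable (n M) in
/-- The reduced exterior differential system on `C(LM) ×_M Σ`. -/
def reducedPalatiniEDS : FormSet (ConnMetricModel n) (ConnMetric n M) :=
  reducedEDS pH (palatiniEDS n M)

/-- The Palatini Lagrangian `λ_PG = η^{kp} θ_kl ∧ Ω^l_p` on `J¹LM`. -/
def palatiniLagrangian (m : ℕ) (M : Type*) [TopologicalSpace M] [ChartedSpace (Vec (m + 2)) M]
    [IsManifold (𝓡 (m + 2)) ∞ M] : DForm (FrameJetModel (m + 2)) (FrameJet (m + 2) M) (m + 2) :=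
  ∑ k, ∑ l, eta k • wedge (thetaKL k l) (curvature l k)

/-- `lam` is the reduced Lagrangian on `C(LM) ×_M Σ`: a smooth form whose pullback to the positively
oriented frames is the Palatini Lagrangian. (The atlas of `M` is supposed to be oriented; then the
sign of the determinant does not depend on the chart, and `C(LM) ×_M Σ` is the quotient of the
first jets of positively oriented frames by `SO(1, n-1)`.) -/
def IsReducedLagrangian {m : ℕ} {M : Type*} [TopologicalSpace M] [ChartedSpace (Vec (m + 2)) M]
    [IsManifold (𝓡 (m + 2)) ∞ M]
    (lam : DForm (ConnMetricModel (m + 2)) (ConnMetric (m + 2) M) (m + 2)) : Prop :=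
  IsSmoothForm lam ∧ ∀ p : FrameJet (m + 2) M, 0 < p.val.1.det →
    (pullback pH lam : DForm (FrameJetModel (m + 2)) (FrameJet (m + 2) M) (m + 2)) p =
      palatiniLagrangian m M p

/-! ### The contact structure of `J¹Σ` and the ideal `𝒥` on `C(LM) ×_M J¹Σ` -/

variable (n M) in
/-- The contact structure of `J¹Σ`, generated by the contact 1-forms, i.e. the smooth 1-forms which
are at every point combinations of the components of `dg - h dx`, where `h` are the jet
coordinates. -/
def contactEDS : FormSet (MetricJetModel n) (MetricJet n M) :=
  diffIdeal {a | ∃ α : DForm (MetricJetModel n) (MetricJet n M) 1, a = ⟨1, α⟩ ∧ IsSmoothForm α ∧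
    ∀ p : MetricJet n M, ∃ φ : SymBil (Vec n) →L[ℝ] ℝ, ∀ v : MetricJetModel n,
      α p (fun _ => v) = φ (v.2.1 - p.val.2 v.1)}

variable (n M) in
/-- The ideal `𝒥 = ⟨p₂^* I_con, Π^* I_red⟩_diff` on `C(LM) ×_M J¹Σ`. -/
def idealJ : FormSet (ConnMetricJetModel n) (ConnMetricJet n M) :=
  diffIdeal (pullbackSet p2 (contactEDS n M) ∪ pullbackSet projCM (reducedPalatiniEDS n M))

/-- `N` contains every integral manifold of `𝒥`, i.e. the image of every local section of
`C(LM) ×_M J¹Σ → M` which is integral for `𝒥`. -/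
def ContainsIntegralManifolds (N : Set (ConnMetricJet n M)) : Prop :=
  ∀ (U : Set M) (s : M → ConnMetricJet n M), IsOpen U →
    ContMDiffOn (𝓡 n) 𝓘(ℝ, ConnMetricJetModel n) ∞ s U → (∀ x ∈ U, (s x).base = x) →
    (∀ x ∈ U, IsIntegralAt (n := n) (idealJ n M) s x) → ∀ x ∈ U, s x ∈ N

end Gravity

end PalatiniEH

end

open PalatiniEH

set_option linter.unusedSectionVars false

noncomputable section

namespace PalatiniEH
section Alternating

variable {E E' G : Type*} [NormedAddCommGroup E] [NormedSpace ℝ E] [NormedAddCommGroup E']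
  [NormedSpace ℝ E'] [NormedAddCommGroup G] [NormedSpace ℝ G] {k l : ℕ}

instance [FiniteDimensional ℝ E] : FiniteDimensional ℝ (E [⋀^Fin k]→L[ℝ] ℝ) := by
  let φ : (E [⋀^Fin k]→L[ℝ] ℝ) →ₗ[ℝ] MultilinearMap ℝ (fun _ : Fin k => E) ℝ :=
    { toFun := fun f => f.toMultilinearMap
      map_add' := fun _ _ => rfl
      map_smul' := fun _ _ => rfl }
  refine FiniteDimensional.of_injective φ fun f g h => ?_
  ext v
  exact congrArg (fun F : MultilinearMap ℝ (fun _ : Fin k => E) ℝ => F v) h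

theorem contDiffAt_alternating_iff [FiniteDimensional ℝ E] {f : G → E [⋀^Fin k]→L[ℝ] ℝ} {x : G}
    {r : WithTop ℕ∞} : ContDiffAt ℝ r f x ↔ ∀ v, ContDiffAt ℝ r (fun y => f y v) x := by
  constructor
  · intro h v
    let ev : (E [⋀^Fin k]→L[ℝ] ℝ) →ₗ[ℝ] ℝ :=
      { toFun := fun f => f v
        map_add' := fun _ _ => rfl
        map_smul' := fun _ _ => rfl }
    exact (LinearMap.toContinuousLinearMap ev).contDiff.contDiffAt.comp x h
  · intro h
    let b := Module.finBasis ℝ E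
    let ev : (E [⋀^Fin k]→L[ℝ] ℝ) →ₗ[ℝ] ((Fin k → Fin (Module.finrank ℝ E)) → ℝ) :=
      { toFun := fun f r => f fun i => b (r i)
        map_add' := fun _ _ => rfl
        map_smul' := fun _ _ => rfl }
    have hev : Function.Injective ev := by
      intro f g hfg
      have : f.toMultilinearMap = g.toMultilinearMap :=
        Module.Basis.ext_multilinear (fun _ => b) fun r => congrFun hfg r
      ext v
      exact congrArg (fun F : MultilinearMap ℝ (fun _ : Fin k => E) ℝ => F v) this
    obtain ⟨inv, hinv⟩ := LinearMap.exists_leftInverse_of_injective ev (LinearMap.ker_eq_bot.2 hev)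
    have h1 : ContDiffAt ℝ r (fun y => ev (f y)) x :=
      contDiffAt_pi.2 fun r => h fun i => b (r i)
    have h2 := (LinearMap.toContinuousLinearMap inv).contDiff.contDiffAt.comp x h1
    refine h2.congr_of_eventuallyEq (Filter.Eventually.of_forall fun y => ?_)
    exact (LinearMap.congr_fun hinv (f y)).symm

theorem _root_.ContDiffAt.alternating_apply [FiniteDimensional ℝ E]
    {f : G → E [⋀^Fin k]→L[ℝ] ℝ} {x : G} {r : WithTop ℕ∞} (hf : ContDiffAt ℝ r f x)
    {u : Fin k → G → E} (hu : ∀ i, ContDiffAt ℝ r (u i) x) :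
    ContDiffAt ℝ r (fun y => f y fun i => u i y) x := by
  let b := Module.finBasis ℝ E
  have h : ∀ y, (f y fun i => u i y) = ∑ r : Fin k → Fin (Module.finrank ℝ E),
      (∏ i, b.coord (r i) (u i y)) * f y fun i => b (r i) := by
    intro y
    have h1 : (fun i => u i y) = fun i => ∑ j, b.coord j (u i y) • b j := by
      funext i; exact (b.sum_repr (u i y)).symm
    rw [h1]
    change (f y).toMultilinearMap _ = _
    rw [MultilinearMap.map_sum]
    refine Finset.sum_congr rfl fun r _ => ?_
    rw [MultilinearMap.map_smul_univ]
    rfl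
  simp only [h]
  refine ContDiffAt.sum fun r _ => ContDiffAt.mul (contDiffAt_prod fun i _ => ?_)
    (contDiffAt_alternating_iff.1 hf _)
  exact (LinearMap.toContinuousLinearMap (b.coord (r i))).contDiff.contDiffAt.comp x (hu i)

theorem _root_.ContDiffAt.alternating_comp [FiniteDimensional ℝ E] [FiniteDimensional ℝ E']
    {f : G → E [⋀^Fin k]→L[ℝ] ℝ} {x : G} {r : WithTop ℕ∞} (hf : ContDiffAt ℝ r f x)
    {A : G → E' →L[ℝ] E} (hA : ContDiffAt ℝ r A x) :
    ContDiffAt ℝ r (fun y => (f y).compContinuousLinearMap (A y)) x :=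
  contDiffAt_alternating_iff.2 fun _ =>
    hf.alternating_apply fun _ => hA.clm_apply contDiffAt_const

/-- The wedge product as a signed sum of products, over representatives of shuffles. -/
theorem wedgeAlt_apply (a : E [⋀^Fin k]→L[ℝ] ℝ) (b : E [⋀^Fin l]→L[ℝ] ℝ) (v : Fin (k + l) → E) :
    wedgeAlt a b v = ∑ σ : Equiv.Perm.ModSumCongr (Fin k) (Fin l),
      ((Equiv.Perm.sign (Quotient.out σ) : ℤ) : ℝ) *
        (a (fun i => v (finSumFinEquiv (Quotient.out σ (Sum.inl i)))) *
          b (fun i => v (finSumFinEquiv (Quotient.out σ (Sum.inr i))))) := by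
  change LinearMap.mul' ℝ ℝ ((a.toAlternatingMap.domCoprod b.toAlternatingMap)
    (v ∘ finSumFinEquiv)) = _
  rw [AlternatingMap.domCoprod_apply]
  simp only [sum_apply, map_sum]
  refine Finset.sum_congr rfl fun σ _ => ?_
  conv_lhs => rw [← Quotient.out_eq' σ]
  rw [AlternatingMap.domCoprod.summand_mk'']
  rcases Int.units_eq_one_or (Equiv.Perm.sign (Quotient.out σ)) with hs | hs <;>
  simp [hs]

theorem sum_wedgeAlt_congr {ι : Type*} (s : Finset ι) {a : ι → E [⋀^Fin k]→L[ℝ] ℝ}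
    {b : ι → E [⋀^Fin l]→L[ℝ] ℝ} {a' : ι → E' [⋀^Fin k]→L[ℝ] ℝ} {b' : ι → E' [⋀^Fin l]→L[ℝ] ℝ}
    {v : Fin (k + l) → E} {v' : Fin (k + l) → E'}
    (h : ∀ (f : Fin k → Fin (k + l)) (g : Fin l → Fin (k + l)),
      ∑ i ∈ s, a i (fun j => v (f j)) * b i (fun j => v (g j)) =
        ∑ i ∈ s, a' i (fun j => v' (f j)) * b' i (fun j => v' (g j))) :
    ∑ i ∈ s, wedgeAlt (a i) (b i) v = ∑ i ∈ s, wedgeAlt (a' i) (b' i) v' := by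
  simp only [wedgeAlt_apply]
  rw [Finset.sum_comm, Finset.sum_comm (s := s)]
  refine Finset.sum_congr rfl fun σ _ => ?_
  rw [← Finset.mul_sum, ← Finset.mul_sum, h]

theorem wedgeAlt_compContinuousLinearMap (a : E [⋀^Fin k]→L[ℝ] ℝ) (b : E [⋀^Fin l]→L[ℝ] ℝ)
    (f : E' →L[ℝ] E) : (wedgeAlt a b).compContinuousLinearMap f =
      wedgeAlt (a.compContinuousLinearMap f) (b.compContinuousLinearMap f) := by
  ext v
  simp only [ContinuousAlternatingMap.compContinuousLinearMap_apply, wedgeAlt_apply]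
  rfl

theorem wedgeAlt_zeroForm (a : E [⋀^Fin k]→L[ℝ] ℝ) (c : ℝ) :
    wedgeAlt a (ContinuousAlternatingMap.constOfIsEmpty ℝ E (Fin 0) c) = c • a := by
  ext v
  change LinearMap.mul' ℝ ℝ ((a.toAlternatingMap.domCoprod
    (ContinuousAlternatingMap.constOfIsEmpty ℝ E (Fin 0) c).toAlternatingMap)
    (v ∘ finSumFinEquiv)) = _
  rw [AlternatingMap.domCoprod_apply]
  have hsub : Subsingleton (Equiv.Perm.ModSumCongr (Fin k) (Fin 0)) := by
    refine ⟨fun x y => ?_⟩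
    induction x using Quotient.inductionOn'
    induction y using Quotient.inductionOn'
    rename_i x y
    refine Quotient.sound' ?_
    rw [QuotientGroup.leftRel_apply]
    refine ⟨((Equiv.sumEmpty (Fin k) (Fin 0)).permCongr (x⁻¹ * y), 1), ?_⟩
    ext i
    rcases i with i | i
    · have hz : ∀ z : Fin k ⊕ Fin 0, Sum.inl ((Equiv.sumEmpty (Fin k) (Fin 0)) z) = z := by
        rintro (z | z)
        · rfl
        · exact z.elim0
      simp [Equiv.Perm.sumCongrHom_apply, Equiv.permCongr_apply, hz]
    · exact i.elim0
  simp only [sum_apply, map_sum]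
  refine (Finset.sum_eq_single (Quotient.mk'' (1 : Equiv.Perm (Fin k ⊕ Fin 0)))
    (fun σ _ h => absurd (Subsingleton.elim σ _) h) (fun h => absurd (Finset.mem_univ _) h)).trans ?_
  rw [AlternatingMap.domCoprod.summand_mk'']
  simp [mul_comm, Function.comp_def]
  left
  rfl

theorem wedgeAlt_zero_left (b : E [⋀^Fin l]→L[ℝ] ℝ) :
    wedgeAlt (0 : E [⋀^Fin k]→L[ℝ] ℝ) b = 0 := by
  ext v; simp [wedgeAlt_apply]

theorem wedgeAlt_zero_right (a : E [⋀^Fin k]→L[ℝ] ℝ) :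
    wedgeAlt a (0 : E [⋀^Fin l]→L[ℝ] ℝ) = 0 := by
  ext v; simp [wedgeAlt_apply]

/-- Wedge product of two 1-forms. -/
theorem wedgeAlt_oneForm (f g : E →L[ℝ] ℝ) (v : Fin 2 → E) :
    wedgeAlt (oneForm f) (oneForm g) v = f (v 0) * g (v 1) - f (v 1) * g (v 0) := by
  change LinearMap.mul' ℝ ℝ (((oneForm f).toAlternatingMap.domCoprod (oneForm g).toAlternatingMap)
    (v ∘ finSumFinEquiv)) = _
  rw [AlternatingMap.domCoprod_apply]
  simp only [sum_apply, map_sum]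
  have hbij : Function.Bijective
      (Quotient.mk'' : Equiv.Perm (Fin 1 ⊕ Fin 1) → Equiv.Perm.ModSumCongr (Fin 1) (Fin 1)) := by
    refine ⟨fun x y h => ?_, Quotient.mk''_surjective⟩
    obtain ⟨z, hz⟩ := QuotientGroup.leftRel_apply.1 (Quotient.exact' h)
    have hz1 : z = 1 := Subsingleton.elim _ _
    rw [hz1, map_one] at hz
    exact (inv_mul_eq_one.1 hz.symm)
  have huniv : (Finset.univ : Finset (Equiv.Perm (Fin 1 ⊕ Fin 1))) =
      {1, Equiv.swap (Sum.inl 0) (Sum.inr 0)} := by decide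
  refine (Function.Bijective.sum_comp hbij _).symm.trans ?_
  rw [huniv, Finset.sum_pair (by decide)]
  simp only [AlternatingMap.domCoprod.summand_mk'']
  simp [sub_eq_add_neg]
  rfl

theorem _root_.ContDiffAt.wedgeAlt [FiniteDimensional ℝ E]
    {f : G → E [⋀^Fin k]→L[ℝ] ℝ} {g : G → E [⋀^Fin l]→L[ℝ] ℝ} {x : G} {r : WithTop ℕ∞}
    (hf : ContDiffAt ℝ r f x) (hg : ContDiffAt ℝ r g x) :
    ContDiffAt ℝ r (fun y => wedgeAlt (f y) (g y)) x := by
  refine contDiffAt_alternating_iff.2 fun v => ?_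
  simp only [wedgeAlt_apply]
  exact ContDiffAt.sum fun σ _ => contDiffAt_const.mul
    ((contDiffAt_alternating_iff.1 hf _).mul (contDiffAt_alternating_iff.1 hg _))

end Alternating

section FormCalculus

variable {E' : Type*} [NormedAddCommGroup E'] [NormedSpace ℝ E']
variable {E : Type*} [NormedAddCommGroup E] [NormedSpace ℝ E]
variable {E'' : Type*} [NormedAddCommGroup E''] [NormedSpace ℝ E'']
variable {N : Type*} [TopologicalSpace N] [ChartedSpace E N]
variable {N' : Type*} [TopologicalSpace N'] [ChartedSpace E' N']
variable {N'' : Type*} [TopologicalSpace N''] [ChartedSpace E'' N'']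
variable {k l : ℕ}

variable (E' E) in
/-- The derivative of `f` at `x`, as a map of model spaces. -/
def tmap (f : N' → N) (x : N') : E' →L[ℝ] E := mfderiv 𝓘(ℝ, E') 𝓘(ℝ, E) f x

theorem tmap_comp {f : N' → N} {g : N'' → N'} {x : N''}
    (hf : MDifferentiableAt 𝓘(ℝ, E') 𝓘(ℝ, E) f (g x))
    (hg : MDifferentiableAt 𝓘(ℝ, E'') 𝓘(ℝ, E') g x) :
    tmap E'' E (fun y => f (g y)) x = tmap E' E f (g x) ∘L tmap E'' E' g x :=
  mfderiv_comp x hf hg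

theorem tmap_congr {f g : N' → N} {x : N'} (h : f =ᶠ[𝓝 x] g) : tmap E' E f x = tmap E' E g x :=
  h.mfderiv_eq

theorem tmap_id (x : N) : tmap E E (fun x : N => x) x = ContinuousLinearMap.id ℝ E := mfderiv_id

theorem tmap_eq_fderiv (f : E' → E) (x : E') : tmap E' E f x = fderiv ℝ f x := mfderiv_eq_fderiv

theorem pullback_apply (f : N' → N) (α : DForm E N k) (x : N') :
    (pullback f α : DForm E' N' k) x = (α (f x)).compContinuousLinearMap (tmap E' E f x) := rfl

theorem pullback_comp {f : N' → N} {g : N'' → N'} {x : N''}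
    (hf : MDifferentiableAt 𝓘(ℝ, E') 𝓘(ℝ, E) f (g x))
    (hg : MDifferentiableAt 𝓘(ℝ, E'') 𝓘(ℝ, E') g x) (α : DForm E N k) :
    (pullback (fun y => f (g y)) α : DForm E'' N'' k) x =
      pullback g (pullback f α : DForm E' N' k) x := by
  rw [pullback_apply, pullback_apply, pullback_apply, tmap_comp hf hg]
  rfl

theorem pullback_congr {f g : N' → N} {x : N'} (h : f =ᶠ[𝓝 x] g) (α : DForm E N k) :
    (pullback f α : DForm E' N' k) x = pullback g α x := by
  rw [pullback_apply, pullback_apply, tmap_congr h, h.eq_of_nhds]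

theorem pullback_id (α : DForm E N k) : pullback (fun x : N => x) α = α := by
  funext x
  rw [pullback_apply, tmap_id]
  rfl

theorem pullback_wedge (f : N' → N) (α : DForm E N k) (β : DForm E N l) :
    (pullback f (wedge α β) : DForm E' N' (k + l)) = wedge (pullback f α) (pullback f β) :=
  funext fun _ => wedgeAlt_compContinuousLinearMap _ _ _

variable (E' E) in
/-- `f` is smooth in a neighbourhood of `x`. -/
def MapSmoothAt (f : N' → N) (x : N') : Prop :=
  ∀ᶠ y in 𝓝 x, ContMDiffAt 𝓘(ℝ, E') 𝓘(ℝ, E) ∞ f y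

theorem _root_.ContMDiff.mapSmoothAt {f : N' → N} (hf : ContMDiff 𝓘(ℝ, E') 𝓘(ℝ, E) ∞ f) (x : N') :
    MapSmoothAt E' E f x := Filter.Eventually.of_forall hf

theorem _root_.ContMDiffOn.mapSmoothAt {f : N' → N} {U : Set N'}
    (hf : ContMDiffOn 𝓘(ℝ, E') 𝓘(ℝ, E) ∞ f U) (hU : IsOpen U) {x : N'} (hx : x ∈ U) :
    MapSmoothAt E' E f x := by
  filter_upwards [hU.mem_nhds hx] with y hy using hf.contMDiffAt (hU.mem_nhds hy)

namespace MapSmoothAt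

theorem contMDiffAt {f : N' → N} {x : N'} (hf : MapSmoothAt E' E f x) :
    ContMDiffAt 𝓘(ℝ, E') 𝓘(ℝ, E) ∞ f x := hf.self_of_nhds

theorem eventually {f : N' → N} {x : N'} (hf : MapSmoothAt E' E f x) :
    ∀ᶠ y in 𝓝 x, MapSmoothAt E' E f y := eventually_eventually_nhds.2 hf

theorem mdifferentiableAt {f : N' → N} {x : N'} (hf : MapSmoothAt E' E f x) :
    MDifferentiableAt 𝓘(ℝ, E') 𝓘(ℝ, E) f x := hf.contMDiffAt.mdifferentiableAt (by simp)

theorem comp {f : N' → N} {g : N'' → N'} {x : N''}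
    (hf : MapSmoothAt E' E f (g x)) (hg : MapSmoothAt E'' E' g x) :
    MapSmoothAt E'' E (fun y => f (g y)) x := by
  filter_upwards [hg, hg.contMDiffAt.continuousAt.eventually hf] with y h1 h2 using h2.comp y h1

theorem congr {f g : N' → N} {x : N'} (hf : MapSmoothAt E' E f x) (h : g =ᶠ[𝓝 x] f) :
    MapSmoothAt E' E g x := by
  filter_upwards [hf, h.eventually_nhds] with y h1 h2 using h1.congr_of_eventuallyEq h2

end MapSmoothAt

theorem mapSmoothAt_id (x : N) : MapSmoothAt E E (fun x : N => x) x := ContMDiff.mapSmoothAt contMDiff_id x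

/-- `α` is smooth in a neighbourhood of `x`. -/
def FormSmoothAt (α : DForm E N k) (x : N) : Prop :=
  ∀ᶠ y in 𝓝 x, ContDiffAt ℝ ∞ (inChart (chartAt E y) α) (chartAt E y y)

theorem FormSmoothAt.eventually {α : DForm E N k} {x : N} (h : FormSmoothAt α x) :
    ∀ᶠ y in 𝓝 x, FormSmoothAt α y := eventually_eventually_nhds.2 h

theorem eventually_chart_symm {c : OpenPartialHomeomorph N E} {x : N} (hx : x ∈ c.source)
    {p : N → Prop} (h : ∀ᶠ y in 𝓝 x, p y) : ∀ᶠ y in 𝓝 (c x), y ∈ c.target ∧ p (c.symm y) := by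
  have h1 : Filter.Tendsto c.symm (𝓝 (c x)) (𝓝 x) := by
    have := c.continuousAt_symm (c.map_source hx)
    rwa [ContinuousAt, c.left_inv hx] at this
  exact (Filter.eventually_of_mem (c.open_target.mem_nhds (c.map_source hx)) fun _ h => h).and
    (h1.eventually h)

theorem FormSmoothAt.congr {α β : DForm E N k} {x : N} (h : FormSmoothAt α x) (hαβ : β =ᶠ[𝓝 x] α) :
    FormSmoothAt β x := by
  filter_upwards [h, hαβ.eventually_nhds] with y h1 h2
  refine h1.congr_of_eventuallyEq ?_
  filter_upwards [eventually_chart_symm (mem_chart_source E y) h2] with z hz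
  simp only [inChart, hz.2]

variable [IsManifold 𝓘(ℝ, E) ∞ N] [IsManifold 𝓘(ℝ, E') ∞ N'] [IsManifold 𝓘(ℝ, E'') ∞ N'']

theorem mapSmoothAt_chart {c : OpenPartialHomeomorph N E} (hc : c ∈ atlas E N) {x : N}
    (hx : x ∈ c.source) : MapSmoothAt E E c x := by
  filter_upwards [c.open_source.mem_nhds hx] with y hy using
    contMDiffAt_of_mem_maximalAtlas (IsManifold.subset_maximalAtlas hc) hy

theorem mapSmoothAt_chart_symm {c : OpenPartialHomeomorph N E} (hc : c ∈ atlas E N) {y : E}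
    (hy : y ∈ c.target) : MapSmoothAt E E c.symm y := by
  filter_upwards [c.open_target.mem_nhds hy] with y hy using
    contMDiffAt_symm_of_mem_maximalAtlas (IsManifold.subset_maximalAtlas hc) hy

theorem tmap_symm_tmap {c : OpenPartialHomeomorph N E} (hc : c ∈ atlas E N) {x : N}
    (hx : x ∈ c.source) (v : E) : tmap E E c.symm (c x) (tmap E E c x v) = v := by
  have h1 := tmap_comp (f := c.symm) (g := c) (x := x)
    (mapSmoothAt_chart_symm hc (c.map_source hx)).mdifferentiableAt
    (mapSmoothAt_chart hc hx).mdifferentiableAt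
  have h2 : (fun y => c.symm (c y)) =ᶠ[𝓝 x] fun y => y := by
    filter_upwards [c.open_source.mem_nhds hx] with y hy using c.left_inv hy
  rw [tmap_congr h2, tmap_id] at h1
  exact (congrArg (fun A : E →L[ℝ] E => A v) h1).symm

theorem tmap_tmap_symm {c : OpenPartialHomeomorph N E} (hc : c ∈ atlas E N) {y : E}
    (hy : y ∈ c.target) (v : E) : tmap E E c (c.symm y) (tmap E E c.symm y v) = v := by
  have h1 := tmap_comp (f := c) (g := c.symm) (x := y)
    (mapSmoothAt_chart hc (c.map_target hy)).mdifferentiableAt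
    (mapSmoothAt_chart_symm hc hy).mdifferentiableAt
  have h2 : (fun z => c (c.symm z)) =ᶠ[𝓝 y] fun z => z := by
    filter_upwards [c.open_target.mem_nhds hy] with z hz using c.right_inv hz
  rw [tmap_congr h2, tmap_id] at h1
  exact (congrArg (fun A : E →L[ℝ] E => A v) h1).symm

theorem inChart_pullback_eventuallyEq {f : N' → N} {x : N'} (hf : MapSmoothAt E' E f x)
    {c : OpenPartialHomeomorph N E} (hc : c ∈ atlas E N) (hx : f x ∈ c.source)
    {c' : OpenPartialHomeomorph N' E'} (hc' : c' ∈ atlas E' N') (hx' : x ∈ c'.source)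
    (α : DForm E N k) :
    inChart c' (pullback f α) =ᶠ[𝓝 (c' x)] fun y =>
      (inChart c α (c (f (c'.symm y)))).compContinuousLinearMap
        (fderiv ℝ (fun z => c (f (c'.symm z))) y) := by
  have h1 : ∀ᶠ y in 𝓝 x, f y ∈ c.source :=
    hf.contMDiffAt.continuousAt.eventually (c.open_source.mem_nhds hx)
  filter_upwards [eventually_chart_symm hx' (hf.eventually.and h1.eventually_nhds)] with y hy
  obtain ⟨hy0, hy1, hy2⟩ := hy
  have hs := mapSmoothAt_chart_symm hc' hy0
  have hF : MapSmoothAt E' E (fun z => c (f (c'.symm z))) y :=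
    MapSmoothAt.comp (g := fun z => f (c'.symm z)) (mapSmoothAt_chart hc hy2.self_of_nhds)
      (hy1.comp hs)
  have e1 : (fun z => f (c'.symm z)) =ᶠ[𝓝 y] fun z => c.symm (c (f (c'.symm z))) := by
    filter_upwards [hs.contMDiffAt.continuousAt.eventually hy2] with z hz using (c.left_inv hz).symm
  rw [← tmap_eq_fderiv]
  change pullback c'.symm (pullback f α) y = pullback (fun z => c (f (c'.symm z)))
    (pullback c.symm α : DForm E E k) y
  rw [← pullback_comp hy1.mdifferentiableAt hs.mdifferentiableAt, pullback_congr e1,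
    pullback_comp (f := c.symm) (g := fun z => c (f (c'.symm z)))
      (mapSmoothAt_chart_symm hc (c.map_source hy2.self_of_nhds)).mdifferentiableAt
      hF.mdifferentiableAt]

theorem contDiffAt_chart_comp {f : N' → N} {x : N'} (hf : MapSmoothAt E' E f x)
    {c : OpenPartialHomeomorph N E} (hc : c ∈ atlas E N) (hx : f x ∈ c.source)
    {c' : OpenPartialHomeomorph N' E'} (hc' : c' ∈ atlas E' N') (hx' : x ∈ c'.source) :
    ContDiffAt ℝ ∞ (fun z => c (f (c'.symm z))) (c' x) := by
  rw [← contMDiffAt_iff_contDiffAt]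
  have h : MapSmoothAt E' E (fun z => c (f (c'.symm z))) (c' x) := by
    refine MapSmoothAt.comp (g := fun z => f (c'.symm z)) (f := c) (mapSmoothAt_chart hc ?_)
      (MapSmoothAt.comp ?_ (mapSmoothAt_chart_symm hc' (c'.map_source hx')))
    · rwa [c'.left_inv hx']
    · rwa [c'.left_inv hx']
  exact h.contMDiffAt

theorem contDiffAt_inChart_pullback [FiniteDimensional ℝ E] [FiniteDimensional ℝ E']
    {f : N' → N} {x : N'} (hf : MapSmoothAt E' E f x)
    {c : OpenPartialHomeomorph N E} (hc : c ∈ atlas E N) (hx : f x ∈ c.source)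
    {c' : OpenPartialHomeomorph N' E'} (hc' : c' ∈ atlas E' N') (hx' : x ∈ c'.source)
    {α : DForm E N k} (h : ContDiffAt ℝ ∞ (inChart c α) (c (f x))) :
    ContDiffAt ℝ ∞ (inChart c' (pullback f α)) (c' x) := by
  have hF := contDiffAt_chart_comp hf hc hx hc' hx'
  refine ContDiffAt.congr_of_eventuallyEq ?_ (inChart_pullback_eventuallyEq hf hc hx hc' hx' α)
  refine ContDiffAt.alternating_comp (ContDiffAt.comp (g := inChart c α) (c' x) ?_ hF)
    (hF.fderiv_right (m := ∞) (by simp))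
  rwa [c'.left_inv hx']

theorem FormSmoothAt.contDiffAt [FiniteDimensional ℝ E] {α : DForm E N k} {x : N}
    (h : FormSmoothAt α x) {c : OpenPartialHomeomorph N E} (hc : c ∈ atlas E N)
    (hx : x ∈ c.source) : ContDiffAt ℝ ∞ (inChart c α) (c x) := by
  have := contDiffAt_inChart_pullback (mapSmoothAt_id (E := E) x) (chart_mem_atlas E x)
    (mem_chart_source E x) hc hx h.self_of_nhds
  rwa [pullback_id] at this

theorem formSmoothAt_of_chart [FiniteDimensional ℝ E] {α : DForm E N k} {x : N}
    {c : OpenPartialHomeomorph N E} (hc : c ∈ atlas E N) (hx : x ∈ c.source)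
    (h : ∀ᶠ y in 𝓝 (c x), ContDiffAt ℝ ∞ (inChart c α) y) : FormSmoothAt α x := by
  filter_upwards [c.open_source.mem_nhds hx, (c.continuousAt hx).eventually h] with y hy h1
  have := contDiffAt_inChart_pullback (mapSmoothAt_id (E := E) y) hc hy (chart_mem_atlas E y)
    (mem_chart_source E y) h1
  rwa [pullback_id] at this

theorem isSmoothForm_iff [FiniteDimensional ℝ E] {α : DForm E N k} :
    IsSmoothForm α ↔ ∀ x, FormSmoothAt α x := by
  constructor
  · intro h x
    refine formSmoothAt_of_chart (chart_mem_atlas E x) (mem_chart_source E x) ?_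
    filter_upwards [(chartAt E x).open_target.mem_nhds (mem_chart_target E x)] with y hy
    exact (h _ (chart_mem_atlas E x)).contDiffAt ((chartAt E x).open_target.mem_nhds hy)
  · intro h c hc y hy
    have := (h (c.symm y)).contDiffAt hc (c.map_target hy)
    rw [c.right_inv hy] at this
    exact this.contDiffWithinAt

namespace FormSmoothAt

variable [FiniteDimensional ℝ E] [FiniteDimensional ℝ E']

theorem pullback {f : N' → N} {x : N'} {α : DForm E N k} (hα : FormSmoothAt α (f x))
    (hf : MapSmoothAt E' E f x) : FormSmoothAt (pullback f α : DForm E' N' k) x := by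
  filter_upwards [hf.eventually, hf.contMDiffAt.continuousAt.eventually hα] with y h1 h2
  exact contDiffAt_inChart_pullback h1 (chart_mem_atlas E _) (mem_chart_source E _)
    (chart_mem_atlas E' y) (mem_chart_source E' y) h2

theorem wedge {x : N} {α : DForm E N k} {β : DForm E N l} (hα : FormSmoothAt α x)
    (hβ : FormSmoothAt β x) : FormSmoothAt (wedge α β) x := by
  filter_upwards [hα, hβ] with y h1 h2
  refine (h1.wedgeAlt h2).congr_of_eventuallyEq (Filter.Eventually.of_forall fun z => ?_)
  exact wedgeAlt_compContinuousLinearMap _ _ _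

theorem add {x : N} {α β : DForm E N k} (hα : FormSmoothAt α x)
    (hβ : FormSmoothAt β x) : FormSmoothAt (α + β) x := by
  filter_upwards [hα, hβ] with y h1 h2 using h1.add h2

theorem zero (x : N) : FormSmoothAt (0 : DForm E N k) x :=
  Filter.Eventually.of_forall fun _ => contDiffAt_const (c := 0)

theorem smul {x : N} {α : DForm E N k} {f : N → ℝ} (hf : MapSmoothAt E ℝ f x)
    (hα : FormSmoothAt α x) : FormSmoothAt (fun y => f y • α y) x := by
  filter_upwards [hα, hf] with y h1 h2
  have h3 : ContDiffAt ℝ ∞ (fun z => f ((chartAt E y).symm z)) (chartAt E y y) := by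
    rw [← contMDiffAt_iff_contDiffAt]
    refine ContMDiffAt.comp (g := f) _ ?_
      (mapSmoothAt_chart_symm (chart_mem_atlas E y) (mem_chart_target E y)).contMDiffAt
    rwa [(chartAt E y).left_inv (mem_chart_source E y)]
  exact h3.smul h1

theorem sum {ι : Type*} {s : Finset ι} {x : N} {α : ι → DForm E N k}
    (h : ∀ i ∈ s, FormSmoothAt (α i) x) : FormSmoothAt (∑ i ∈ s, α i) x := by
  classical
  induction s using Finset.induction_on with
  | empty => exact zero x
  | insert i s hi ih =>
    rw [Finset.sum_insert hi]
    exact (h i (Finset.mem_insert_self _ _)).add (ih fun j hj => h j (Finset.mem_insert_of_mem hj))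

end FormSmoothAt

/-! ### Exterior derivative -/

theorem extD_apply (α : DForm E N k) (x : N) :
    extD α x = (extDeriv (inChart (chartAt E x) α) (chartAt E x x)).compContinuousLinearMap
      (tmap E E (chartAt E x) x) := rfl

theorem extD_pullback {f : N' → N} {x : N'} (hf : MapSmoothAt E' E f x)
    {α : DForm E N k} (hα : FormSmoothAt α (f x)) :
    extD (pullback f α : DForm E' N' k) x = pullback f (extD α) x := by
  set c := chartAt E (f x)
  set c' := chartAt E' x
  have hc : c ∈ atlas E N := chart_mem_atlas E _
  have hx : f x ∈ c.source := mem_chart_source E _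
  have hc' : c' ∈ atlas E' N' := chart_mem_atlas E' _
  have hx' : x ∈ c'.source := mem_chart_source E' _
  have hF := contDiffAt_chart_comp hf hc hx hc' hx'
  have hd : DifferentiableAt ℝ (inChart c α) (c (f (c'.symm (c' x)))) := by
    rw [c'.left_inv hx']
    exact hα.self_of_nhds.differentiableAt (by simp)
  have e1 : (fun y => c (f y)) =ᶠ[𝓝 x] fun y => c (f (c'.symm (c' y))) := by
    filter_upwards [c'.open_source.mem_nhds hx'] with y hy
    rw [c'.left_inv hy]
  have e2 : fderiv ℝ (fun z => c (f (c'.symm z))) (c' x) ∘L tmap E' E' c' x =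
      tmap E E c (f x) ∘L tmap E' E f x := by
    rw [← tmap_eq_fderiv, ← tmap_comp (mapSmoothAt_chart hc hx).mdifferentiableAt
      hf.mdifferentiableAt, tmap_congr e1, tmap_comp (f := fun z => c (f (c'.symm z))) ?_
      (mapSmoothAt_chart hc' hx').mdifferentiableAt]
    exact (hF.differentiableAt (by simp)).mdifferentiableAt
  rw [extD_apply, (inChart_pullback_eventuallyEq hf hc hx hc' hx' α).extDeriv_eq,
    extDeriv_pullback (f := fun z => c (f (c'.symm z))) hd hF
      (by rw [minSmoothness_of_isRCLikeNormedField]; norm_cast)]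
  rw [pullback_apply, extD_apply]
  ext v
  have e3 : ∀ w, fderiv ℝ (fun z => c (f (c'.symm z))) (c' x) (tmap E' E' c' x w) =
      tmap E E c (f x) (tmap E' E f x w) := fun w => congrArg (fun A : E' →L[ℝ] E => A w) e2
  simp only [ContinuousAlternatingMap.compContinuousLinearMap_apply, Function.comp_def,
    c'.left_inv hx']
  exact congrArg _ (funext fun i => e3 (v i))

theorem extD_eq_extDeriv (α : DForm E E k) (x : E) : extD α x = extDeriv α x := by
  have h : inChart (chartAt E x) α = α := by
    funext y
    change (pullback (fun z : E => z) α : DForm E E k) y = α y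
    rw [pullback_id]
  rw [extD_apply, h]
  change (extDeriv α x).compContinuousLinearMap (tmap E E (fun z : E => z) x) = _
  rw [tmap_id]
  rfl

theorem inChart_extD {α : DForm E N k} {c : OpenPartialHomeomorph N E} (hc : c ∈ atlas E N)
    {y : E} (hy : y ∈ c.target) (hα : FormSmoothAt α (c.symm y)) :
    inChart c (extD α) y = extDeriv (inChart c α) y := by
  rw [← extD_eq_extDeriv]
  exact (extD_pullback (mapSmoothAt_chart_symm hc hy) hα).symm

theorem FormSmoothAt.extD [FiniteDimensional ℝ E] {α : DForm E N k} {x : N}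
    (h : FormSmoothAt α x) : FormSmoothAt (extD α) x := by
  refine formSmoothAt_of_chart (chart_mem_atlas E x) (mem_chart_source E x) ?_
  filter_upwards [eventually_chart_symm (mem_chart_source E x) h.eventually.eventually_nhds]
    with y hy
  set c := chartAt E x
  have h1 : inChart c (PalatiniEH.extD α) =ᶠ[𝓝 y] extDeriv (inChart c α) := by
    have hs := (mapSmoothAt_chart_symm (chart_mem_atlas E x) hy.1).contMDiffAt.continuousAt
    filter_upwards [c.open_target.mem_nhds hy.1, hs.eventually hy.2] with z hz1 hz2
    exact inChart_extD (chart_mem_atlas E x) hz1 hz2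
  have h2 : ContDiffAt ℝ ∞ (inChart c α) y := by
    have := hy.2.self_of_nhds.contDiffAt (chart_mem_atlas E x) (c.map_target hy.1)
    rwa [c.right_inv hy.1] at this
  refine ContDiffAt.congr_of_eventuallyEq ?_ h1
  exact (ContinuousAlternatingMap.alternatizeUncurryFinCLM ℝ E ℝ).contDiff.contDiffAt.comp y
    (h2.fderiv_right (m := ∞) (by simp))

theorem extD_congr {α β : DForm E N k} {x : N} (h : α =ᶠ[𝓝 x] β) : extD α x = extD β x := by
  rw [extD_apply, extD_apply, Filter.EventuallyEq.extDeriv_eq]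
  filter_upwards [eventually_chart_symm (mem_chart_source E x) h] with y hy
  simp only [inChart, hy.2]

theorem extD_zero : extD (0 : DForm E N k) = 0 := by
  funext x
  have h : inChart (chartAt E x) (0 : DForm E N k) = fun _ => 0 := rfl
  rw [extD_apply, h]
  ext v
  simp [extDeriv, ContinuousAlternatingMap.alternatizeUncurryFin_apply]

end FormCalculus

section Ideals

variable {E' : Type*} [NormedAddCommGroup E'] [NormedSpace ℝ E']
variable {E : Type*} [NormedAddCommGroup E] [NormedSpace ℝ E]
variable {E'' : Type*} [NormedAddCommGroup E''] [NormedSpace ℝ E'']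
variable {N : Type*} [TopologicalSpace N] [ChartedSpace E N]
variable {N' : Type*} [TopologicalSpace N'] [ChartedSpace E' N']
variable {N'' : Type*} [TopologicalSpace N''] [ChartedSpace E'' N'']
variable {k l : ℕ}
variable [IsManifold 𝓘(ℝ, E) ∞ N] [IsManifold 𝓘(ℝ, E') ∞ N'] [IsManifold 𝓘(ℝ, E'') ∞ N'']
variable [FiniteDimensional ℝ E] [FiniteDimensional ℝ E'] [FiniteDimensional ℝ E'']

/-- A function as a form of degree zero. -/
def zeroForm (f : N → ℝ) : DForm E N 0 := fun x =>
  ContinuousAlternatingMap.constOfIsEmpty ℝ E (Fin 0) (f x)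

theorem wedge_zeroForm (α : DForm E N k) (f : N → ℝ) :
    wedge α (zeroForm f) = fun x => f x • α x := funext fun _ => wedgeAlt_zeroForm _ _

theorem formSmoothAt_zeroForm {f : N → ℝ} {x : N} (hf : MapSmoothAt E ℝ f x) :
    FormSmoothAt (zeroForm f : DForm E N 0) x := by
  have h1 : FormSmoothAt (fun _ => ContinuousAlternatingMap.constOfIsEmpty ℝ E (Fin 0) 1 :
      DForm E N 0) x := Filter.Eventually.of_forall fun y => by
    refine (contDiffAt_const (c := ContinuousAlternatingMap.constOfIsEmpty ℝ E (Fin 0)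
      (1 : ℝ))).congr_of_eventuallyEq (Filter.Eventually.of_forall fun z => ?_)
    ext v
    rfl
  refine (h1.smul hf).congr (Filter.Eventually.of_forall fun y => ?_)
  ext v
  simp [zeroForm]

theorem diffIdeal_smooth {S : FormSet E N} (hS : ∀ a ∈ S, IsSmoothForm a.2)
    {a : Σ k : ℕ, DForm E N k} (ha : diffIdeal S a) : IsSmoothForm a.2 := by
  induction ha with
  | of a ha => exact hS a ha
  | zero k => exact isSmoothForm_iff.2 fun x => FormSmoothAt.zero x
  | add α β _ _ h1 h2 =>
    rw [isSmoothForm_iff] at *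
    exact fun x => (h1 x).add (h2 x)
  | wedge_left γ hγ α _ h =>
    rw [isSmoothForm_iff] at *
    exact fun x => (hγ x).wedge (h x)
  | wedge_right γ hγ α _ h =>
    rw [isSmoothForm_iff] at *
    exact fun x => (h x).wedge (hγ x)
  | extD α _ h =>
    rw [isSmoothForm_iff] at *
    exact fun x => (h x).extD
  | glue β U hU hx α _ hβ h =>
    rw [isSmoothForm_iff]
    intro x
    refine (isSmoothForm_iff.1 (h x) x).congr ?_
    filter_upwards [(hU x).mem_nhds (hx x)] with y hy using (hβ x y hy).symm

/-! ### Extension of local forms -/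

theorem exists_bump [T2Space N] {x : N} {U : Set N} (hU : U ∈ 𝓝 x) :
    ∃ χ : N → ℝ, ContMDiff 𝓘(ℝ, E) 𝓘(ℝ, ℝ) ∞ χ ∧ (∀ᶠ y in 𝓝 x, χ y = 1) ∧ tsupport χ ⊆ U := by
  obtain ⟨f, -, hf⟩ := (SmoothBumpFunction.nhds_basis_tsupport (I := 𝓘(ℝ, E)) x).mem_iff.1 hU
  exact ⟨f, f.contMDiff, f.eventuallyEq_one, hf⟩

theorem isSmoothForm_smul_of_tsupport {χ : N → ℝ} (hχ : ContMDiff 𝓘(ℝ, E) 𝓘(ℝ, ℝ) ∞ χ)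
    {α : DForm E N k} (h : ∀ x ∈ tsupport χ, FormSmoothAt α x) :
    IsSmoothForm (fun x => χ x • α x) := by
  refine isSmoothForm_iff.2 fun x => ?_
  by_cases hx : x ∈ tsupport χ
  · exact (h x hx).smul (hχ.mapSmoothAt x)
  · refine (FormSmoothAt.zero x).congr ?_
    filter_upwards [(isClosed_tsupport χ).isOpen_compl.mem_nhds hx] with y hy
    rw [image_eq_zero_of_notMem_tsupport hy, zero_smul]
    rfl

/-- A form which is smooth near `x` coincides near `x` with a global smooth form, which is a multiple
of it. -/
theorem FormSmoothAt.exists_extension [T2Space N] {α : DForm E N k} {x : N} (h : FormSmoothAt α x)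
    {U : Set N} (hU : U ∈ 𝓝 x) :
    ∃ χ : N → ℝ, ContMDiff 𝓘(ℝ, E) 𝓘(ℝ, ℝ) ∞ χ ∧ (∀ᶠ y in 𝓝 x, χ y = 1) ∧ tsupport χ ⊆ U ∧
      IsSmoothForm (fun y => χ y • α y) := by
  obtain ⟨χ, h1, h2, h3⟩ := exists_bump (E := E) (Filter.inter_mem hU h.eventually)
  exact ⟨χ, h1, h2, fun y hy => (h3 hy).1,
    isSmoothForm_smul_of_tsupport h1 fun y hy => (h3 hy).2⟩

/-- `α` coincides near `x` with an element of `I`. -/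
def LocallyIn (I : FormSet E N) (α : DForm E N k) (x : N) : Prop :=
  ∃ β : DForm E N k, (⟨k, β⟩ : Σ k : ℕ, DForm E N k) ∈ I ∧ ∀ᶠ y in 𝓝 x, β y = α y

theorem mem_diffIdeal_of_locallyIn {S : FormSet E N} {α : DForm E N k}
    (h : ∀ x, LocallyIn (diffIdeal S) α x) : (⟨k, α⟩ : Σ k : ℕ, DForm E N k) ∈ diffIdeal S := by
  choose β hβ hβα using h
  choose U hU using fun x => eventually_nhds_iff.1 (hβα x)
  exact diffIdeal.glue α U (fun x => (hU x).2.1) (fun x => (hU x).2.2) β hβ fun x => (hU x).1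

namespace LocallyIn

variable {S : FormSet E N} {x : N} {α β : DForm E N k}

theorem of_mem {I : FormSet E N} (h : (⟨k, α⟩ : Σ k : ℕ, DForm E N k) ∈ I) : LocallyIn I α x :=
  ⟨α, h, Filter.Eventually.of_forall fun _ => rfl⟩

theorem congr {I : FormSet E N} (h : LocallyIn I α x) (hαβ : β =ᶠ[𝓝 x] α) : LocallyIn I β x := by
  obtain ⟨γ, h1, h2⟩ := h
  refine ⟨γ, h1, ?_⟩
  filter_upwards [h2, hαβ] with y h3 h4 using h3.trans h4.symm

theorem zero : LocallyIn (diffIdeal S) (0 : DForm E N k) x := of_mem (diffIdeal.zero k)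

theorem add (hα : LocallyIn (diffIdeal S) α x) (hβ : LocallyIn (diffIdeal S) β x) :
    LocallyIn (diffIdeal S) (α + β) x := by
  obtain ⟨α', h1, h2⟩ := hα
  obtain ⟨β', h3, h4⟩ := hβ
  refine ⟨α' + β', diffIdeal.add _ _ h1 h3, ?_⟩
  filter_upwards [h2, h4] with y h5 h6
  simp [h5, h6]

theorem sum {ι : Type*} {s : Finset ι} {α : ι → DForm E N k}
    (h : ∀ i ∈ s, LocallyIn (diffIdeal S) (α i) x) : LocallyIn (diffIdeal S) (∑ i ∈ s, α i) x := by
  classical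
  induction s using Finset.induction_on with
  | empty => exact zero
  | insert i s hi ih =>
    rw [Finset.sum_insert hi]
    exact (h i (Finset.mem_insert_self _ _)).add (ih fun j hj => h j (Finset.mem_insert_of_mem hj))

theorem wedge_left [T2Space N] (hα : LocallyIn (diffIdeal S) α x) {γ : DForm E N l}
    (hγ : FormSmoothAt γ x) : LocallyIn (diffIdeal S) (wedge γ α) x := by
  obtain ⟨α', h1, h2⟩ := hα
  obtain ⟨χ, -, h3, -, h4⟩ := hγ.exists_extension Filter.univ_mem
  refine ⟨_, diffIdeal.wedge_left _ h4 _ h1, ?_⟩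
  filter_upwards [h2, h3] with y h5 h6
  simp [wedge, h5, h6]

theorem wedge_right [T2Space N] (hα : LocallyIn (diffIdeal S) α x) {γ : DForm E N l}
    (hγ : FormSmoothAt γ x) : LocallyIn (diffIdeal S) (wedge α γ) x := by
  obtain ⟨α', h1, h2⟩ := hα
  obtain ⟨χ, -, h3, -, h4⟩ := hγ.exists_extension Filter.univ_mem
  refine ⟨_, diffIdeal.wedge_right _ h4 _ h1, ?_⟩
  filter_upwards [h2, h3] with y h5 h6
  simp [wedge, h5, h6]

theorem smul [T2Space N] (hα : LocallyIn (diffIdeal S) α x) {f : N → ℝ}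
    (hf : MapSmoothAt E ℝ f x) : LocallyIn (diffIdeal S) (fun y => f y • α y) x := by
  have := hα.wedge_right (formSmoothAt_zeroForm hf)
  rwa [wedge_zeroForm] at this

theorem extD (hα : LocallyIn (diffIdeal S) α x) : LocallyIn (diffIdeal S) (extD α) x := by
  obtain ⟨α', h1, h2⟩ := hα
  refine ⟨_, diffIdeal.extD _ h1, ?_⟩
  filter_upwards [h2.eventually_nhds] with y hy using extD_congr hy

end LocallyIn

/-- If the pullbacks of the generators by `f` are, over the open set `U`, locally in a differential
ideal, so are the pullbacks of all elements of the differential ideal. -/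
theorem locallyIn_pullback [T2Space N'] {S : FormSet E N} (hS : ∀ a ∈ S, IsSmoothForm a.2)
    {S' : FormSet E' N'} {f : N' → N} {U : Set N'} (hf : ∀ x ∈ U, MapSmoothAt E' E f x)
    (h : ∀ a ∈ S, ∀ x ∈ U, LocallyIn (diffIdeal S') (pullback f a.2 : DForm E' N' a.1) x)
    {a : Σ k : ℕ, DForm E N k} (ha : diffIdeal S a) :
    ∀ x ∈ U, LocallyIn (diffIdeal S') (pullback f a.2 : DForm E' N' a.1) x := by
  induction ha with
  | of a ha => exact h a ha
  | zero k => exact fun x _ => LocallyIn.zero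
  | add α β _ _ h1 h2 => exact fun x hx => (h1 x hx).add (h2 x hx)
  | wedge_left γ hγ α _ h =>
    intro x hx
    rw [pullback_wedge]
    exact (h x hx).wedge_left ((isSmoothForm_iff.1 hγ _).pullback (hf x hx))
  | wedge_right γ hγ α _ h =>
    intro x hx
    rw [pullback_wedge]
    exact (h x hx).wedge_right ((isSmoothForm_iff.1 hγ _).pullback (hf x hx))
  | extD α hα h =>
    intro x hx
    refine (h x hx).extD.congr ?_
    filter_upwards [(hf x hx).eventually] with y hy
    exact (extD_pullback hy (isSmoothForm_iff.1 (diffIdeal_smooth hS hα) _)).symm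
  | glue β V hV hxV α _ hβ h =>
    intro x hx
    refine (h (f x) x hx).congr ?_
    have := (hf x hx).contMDiffAt.continuousAt.eventually ((hV (f x)).mem_nhds (hxV (f x)))
    filter_upwards [this] with y hy
    rw [pullback_apply, pullback_apply, hβ (f x) (f y) hy]

theorem mem_diffIdeal_pullback [T2Space N'] {S : FormSet E N} (hS : ∀ a ∈ S, IsSmoothForm a.2)
    {S' : FormSet E' N'} {f : N' → N} (hf : ContMDiff 𝓘(ℝ, E') 𝓘(ℝ, E) ∞ f)
    (h : ∀ a ∈ S, ∀ x, LocallyIn (diffIdeal S') (pullback f a.2 : DForm E' N' a.1) x)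
    {a : Σ k : ℕ, DForm E N k} (ha : a ∈ diffIdeal S) :
    (⟨a.1, pullback f a.2⟩ : Σ k : ℕ, DForm E' N' k) ∈ diffIdeal S' :=
  mem_diffIdeal_of_locallyIn fun x => locallyIn_pullback (U := Set.univ) hS
    (fun x _ => hf.mapSmoothAt x) (fun a ha x _ => h a ha x) ha x trivial

theorem diffIdeal_empty {a : Σ k : ℕ, DForm E N k} (ha : diffIdeal (∅ : FormSet E N) a) :
    a.2 = 0 := by
  induction ha with
  | of a ha => exact ha.elim
  | zero k => rfl
  | add α β _ _ h1 h2 =>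
    change α = 0 at h1
    change β = 0 at h2
    simp [h1, h2]
  | wedge_left γ hγ α _ h =>
    change α = 0 at h
    exact funext fun x => by simp [h, wedge, wedgeAlt_zero_right]
  | wedge_right γ hγ α _ h =>
    change α = 0 at h
    exact funext fun x => by simp [h, wedge, wedgeAlt_zero_left]
  | extD α _ h =>
    change α = 0 at h
    simp [h, extD_zero]
  | glue β V hV hxV α _ hβ h =>
    funext x
    have h1 : α x = 0 := h x
    change β x = 0
    rw [← hβ x x (hxV x), h1]
    rfl

/-- If the generators pull back to zero along `f` over the open set `U`, so does the whole
differential ideal. -/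
theorem pullback_diffIdeal_eq_zero [T2Space N'] {S : FormSet E N} (hS : ∀ a ∈ S, IsSmoothForm a.2)
    {f : N' → N} {U : Set N'} (hU : IsOpen U) (hf : ∀ x ∈ U, MapSmoothAt E' E f x)
    (h : ∀ a ∈ S, ∀ x ∈ U, (pullback f a.2 : DForm E' N' a.1) x = 0)
    {a : Σ k : ℕ, DForm E N k} (ha : a ∈ diffIdeal S) {x : N'} (hx : x ∈ U) :
    (pullback f a.2 : DForm E' N' a.1) x = 0 := by
  obtain ⟨β, h1, h2⟩ := locallyIn_pullback (S' := ∅) hS hf (fun a ha x hx =>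
    LocallyIn.zero.congr (by
      filter_upwards [hU.mem_nhds hx] with y hy using h a ha y hy)) ha x hx
  rw [← h2.self_of_nhds, show β = 0 from diffIdeal_empty h1]
  rfl

/-! ### Vector fields -/

theorem trivializationAt_snd {x y : N} (hy : y ∈ (chartAt E x).source) (v : E) :
    (trivializationAt E (TangentSpace 𝓘(ℝ, E)) x (⟨y, v⟩ : TangentBundle 𝓘(ℝ, E) N)).2 =
      tmap E E (chartAt E x) y v := by
  have h := TangentBundle.continuousLinearMapAt_trivializationAt (I := 𝓘(ℝ, E)) hy
  have hb : y ∈ (trivializationAt E (TangentSpace 𝓘(ℝ, E)) x).baseSet := by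
    rwa [TangentBundle.trivializationAt_baseSet]
  have h2 : (trivializationAt E (TangentSpace 𝓘(ℝ, E)) x).continuousLinearMapAt ℝ y v =
      (trivializationAt E (TangentSpace 𝓘(ℝ, E)) x (⟨y, v⟩ : TangentBundle 𝓘(ℝ, E) N)).2 := by
    rw [Bundle.Trivialization.continuousLinearMapAt_apply,
      Bundle.Trivialization.coe_linearMapAt_of_mem _ hb]
  rw [← h2, h]
  rfl

theorem contMDiffAt_tangent_iff {g : N' → N} {v : N' → E} {x : N'} :
    ContMDiffAt 𝓘(ℝ, E') 𝓘(ℝ, E).tangent ∞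
        (fun y => (⟨g y, v y⟩ : TangentBundle 𝓘(ℝ, E) N)) x ↔
      ContMDiffAt 𝓘(ℝ, E') 𝓘(ℝ, E) ∞ g x ∧
        ContMDiffAt 𝓘(ℝ, E') 𝓘(ℝ, E) ∞ (fun y => tmap E E (chartAt E (g x)) (g y) (v y)) x := by
  have h0 := Bundle.contMDiffAt_totalSpace (IM := 𝓘(ℝ, E')) (IB := 𝓘(ℝ, E)) (n := ∞)
    (E := (TangentSpace 𝓘(ℝ, E) : N → Type _)) (F := E)
    (f := fun y => (⟨g y, v y⟩ : TangentBundle 𝓘(ℝ, E) N)) (x₀ := x)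
  refine Iff.trans h0 (and_congr_right fun hg => ?_)
  have hg' : ContMDiffAt 𝓘(ℝ, E') 𝓘(ℝ, E) ∞ g x := hg
  have h : (fun y => (trivializationAt E (TangentSpace 𝓘(ℝ, E)) (g x)
      (⟨g y, v y⟩ : TangentBundle 𝓘(ℝ, E) N)).2) =ᶠ[𝓝 x]
      fun y => tmap E E (chartAt E (g x)) (g y) (v y) := by
    filter_upwards [hg'.continuousAt.eventually
      ((chartAt E (g x)).open_source.mem_nhds (mem_chart_source E (g x)))] with y hy
    exact trivializationAt_snd hy _
  exact ⟨fun h1 => h1.congr_of_eventuallyEq h.symm, fun h1 => h1.congr_of_eventuallyEq h⟩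

/-- The value of a vector field, as an element of the model space. -/
def vecAt (X : VField E N) (x : N) : E := X x

theorem IsSmoothVField.contMDiffAt_tmap {X : VField E N} (hX : IsSmoothVField X) (x : N) :
    ContMDiffAt 𝓘(ℝ, E) 𝓘(ℝ, E) ∞ (fun y => tmap E E (chartAt E x) y (vecAt X y)) x :=
  (contMDiffAt_tangent_iff (g := fun y : N => y) (v := vecAt X) (x := x)).1 (hX x) |>.2

theorem contract_apply (X : VField E N) (α : DForm E N (k + 1)) (x : N) (v : Fin k → E) :
    contract X α x v = α x (Fin.cons (vecAt X x) v) :=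
  ContinuousAlternatingMap.curryLeft_apply_apply (α x) (vecAt X x) v

theorem FormSmoothAt.contract {X : VField E N} (hX : IsSmoothVField X) {α : DForm E N (k + 1)}
    {x : N} (hα : FormSmoothAt α x) : FormSmoothAt (contract X α) x := by
  filter_upwards [hα] with y hy
  set c := chartAt E y
  have hc : c ∈ atlas E N := chart_mem_atlas E y
  have hyc : y ∈ c.source := mem_chart_source E y
  have h1 : ContMDiffAt 𝓘(ℝ, E) 𝓘(ℝ, E) ∞ (fun z => tmap E E c z (vecAt X z)) y :=
    hX.contMDiffAt_tmap y
  have h2 : ContDiffAt ℝ ∞ (fun z => tmap E E c (c.symm z) (vecAt X (c.symm z))) (c y) := by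
    rw [← contMDiffAt_iff_contDiffAt]
    refine ContMDiffAt.comp (g := fun z => tmap E E c z (vecAt X z)) _ ?_
      (mapSmoothAt_chart_symm hc (c.map_source hyc)).contMDiffAt
    rwa [c.left_inv hyc]
  refine contDiffAt_alternating_iff.2 fun v => ?_
  have h3 := hy.alternating_apply (u := Fin.cons (fun z => tmap E E c (c.symm z) (vecAt X (c.symm z)))
    fun i _ => v i) (Fin.cases h2 fun i => contDiffAt_const)
  refine h3.congr_of_eventuallyEq ?_
  filter_upwards [c.open_target.mem_nhds (c.map_source hyc)] with z hz
  change PalatiniEH.contract X α (c.symm z) (fun i => tmap E E c.symm z (v i)) =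
    α (c.symm z) fun i => tmap E E c.symm z _
  rw [contract_apply]
  congr 1
  funext i
  refine Fin.cases ?_ (fun i => ?_) i
  · have := tmap_symm_tmap hc (c.map_target hz) (vecAt X (c.symm z))
    rw [c.right_inv hz] at this
    exact this.symm
  · rfl

/-- Naturality of the Lie derivative along `f`: it depends only on the vector field along `f`. -/
theorem pullback_lieD {f : N'' → N'} (hf : ContMDiff 𝓘(ℝ, E'') 𝓘(ℝ, E') ∞ f)
    {ρ : N' → N} (hρ : ContMDiff 𝓘(ℝ, E') 𝓘(ℝ, E) ∞ ρ) {Y : VField E' N'} (hY : IsSmoothVField Y)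
    {X : VField E N} (hX : IsSmoothVField X)
    (hXY : ∀ x, vecAt X (ρ (f x)) = tmap E' E ρ (f x) (vecAt Y (f x))) {α : DForm E N k}
    (hα : IsSmoothForm α) :
    (pullback (fun x => ρ (f x)) (lieD X α) : DForm E'' N'' k) =
      pullback f (lieD Y (pullback ρ α : DForm E' N' k)) := by
  have hα' := isSmoothForm_iff.1 hα
  have hfs := fun x => hf.mapSmoothAt x
  have hρs := fun x => hρ.mapSmoothAt x
  have hρα : ∀ x, FormSmoothAt (pullback ρ α : DForm E' N' k) x :=
    fun x => (hα' _).pullback (hρs x)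
  have key : ∀ {j : ℕ} (β : DForm E N (j + 1)),
      (pullback (fun x => ρ (f x)) (contract X β) : DForm E'' N'' j) =
        pullback f (contract Y (pullback ρ β : DForm E' N' (j + 1))) := by
    intro j β
    funext x
    ext v
    rw [pullback_apply, pullback_apply]
    simp only [ContinuousAlternatingMap.compContinuousLinearMap_apply, contract_apply,
      pullback_apply, Function.comp_def]
    congr 1
    funext i
    refine Fin.cases ?_ (fun i => ?_) i
    · exact hXY x
    · simp only [Fin.cons_succ]
      rw [tmap_comp (hρs _).mdifferentiableAt (hfs x).mdifferentiableAt]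
      rfl
  have key2 : (pullback (fun x => ρ (f x)) (contract X (extD α)) : DForm E'' N'' k) =
      pullback f (contract Y (extD (pullback ρ α : DForm E' N' k))) := by
    rw [key]
    congr 2
    exact funext fun x => (extD_pullback (hρs x) (hα' _)).symm
  cases k with
  | zero => exact key2
  | succ k =>
    change pullback _ (contract X (extD α)) + pullback _ (extD (contract X α)) =
      pullback f (contract Y (extD _)) + pullback f (extD (contract Y _))
    rw [key2]
    congr 1
    funext x
    rw [← extD_pullback (MapSmoothAt.comp (hρs _) (hfs x)) ((hα' _).contract hX), key,
      extD_pullback (hfs x) ((hρα _).contract hY)]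

end Ideals

section Transfer

variable {n : ℕ} {M : Type*} [TopologicalSpace M] [ChartedSpace (Vec n) M] [T2Space M]
  [SigmaCompactSpace M] [IsManifold (𝓡 n) ∞ M]
variable {E₁ : Type*} [NormedAddCommGroup E₁] [NormedSpace ℝ E₁] [FiniteDimensional ℝ E₁]
variable {E₂ : Type*} [NormedAddCommGroup E₂] [NormedSpace ℝ E₂] [FiniteDimensional ℝ E₂]
variable {Λ₁ : Type*} [TopologicalSpace Λ₁] [ChartedSpace E₁ Λ₁] [IsManifold 𝓘(ℝ, E₁) ∞ Λ₁]
variable {Λ₂ : Type*} [TopologicalSpace Λ₂] [ChartedSpace E₂ Λ₂] [IsManifold 𝓘(ℝ, E₂) ∞ Λ₂]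

theorem contMDiff_tmap {N E' : Type*} [NormedAddCommGroup E'] [NormedSpace ℝ E']
    [TopologicalSpace N] [ChartedSpace E' N] {ρ : Λ₁ → Λ₂}
    (hρ : ContMDiff 𝓘(ℝ, E₁) 𝓘(ℝ, E₂) ∞ ρ) {g : N → Λ₁} {v : N → E₁}
    (h : ContMDiff 𝓘(ℝ, E') 𝓘(ℝ, E₁).tangent ∞
      fun x => (⟨g x, v x⟩ : TangentBundle 𝓘(ℝ, E₁) Λ₁)) :
    ContMDiff 𝓘(ℝ, E') 𝓘(ℝ, E₂).tangent ∞
      fun x => (⟨ρ (g x), tmap E₁ E₂ ρ (g x) (v x)⟩ : TangentBundle 𝓘(ℝ, E₂) Λ₂) :=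
  (hρ.contMDiff_tangentMap (m := ∞) (by simp)).comp h

/-- The vector field induced on a retract. -/
def retractField (ρ : Λ₁ → Λ₂) (r : Λ₂ → Λ₁) (X : VField E₂ Λ₂) : VField E₁ Λ₁ :=
  fun p => (tmap E₂ E₁ r (ρ p) (vecAt X (ρ p)) : E₁)

theorem isSmoothVField_retractField {ρ : Λ₁ → Λ₂} {r : Λ₂ → Λ₁}
    (hρ : ContMDiff 𝓘(ℝ, E₁) 𝓘(ℝ, E₂) ∞ ρ) (hr : ContMDiff 𝓘(ℝ, E₂) 𝓘(ℝ, E₁) ∞ r)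
    (hrρ : ∀ p, r (ρ p) = p) {X : VField E₂ Λ₂} (hX : IsSmoothVField X) :
    IsSmoothVField (retractField ρ r X : VField E₁ Λ₁) := by
  have h := contMDiff_tmap hr (g := ρ) (v := fun p => vecAt X (ρ p)) (hX.comp hρ)
  have e : ∀ (q p : Λ₁) (w : E₁), q = p → (⟨q, w⟩ : TangentBundle 𝓘(ℝ, E₁) Λ₁) = ⟨p, w⟩ := by
    rintro q p w rfl; rfl
  refine h.congr fun p => ?_
  exact (e _ _ _ (hrρ p)).symm

/-- Correspondence of extremals under a map `ρ` with a retraction `r`, if the exterior differential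
systems correspond to each other, and integral sections and admissible variations upstairs are in the
image of `ρ`. -/
theorem bijOn_extremals {π₁ : Λ₁ → M} {π₂ : Λ₂ → M} {ρ : Λ₁ → Λ₂} {r : Λ₂ → Λ₁}
    (hρ : ContMDiff 𝓘(ℝ, E₁) 𝓘(ℝ, E₂) ∞ ρ) (hr : ContMDiff 𝓘(ℝ, E₂) 𝓘(ℝ, E₁) ∞ r)
    (hπ₂ : ContMDiff 𝓘(ℝ, E₂) (𝓡 n) ∞ π₂)
    (hrρ : ∀ p, r (ρ p) = p) (hπρ : ∀ p, π₂ (ρ p) = π₁ p) (hπr : ∀ q, π₁ (r q) = π₂ q)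
    {lam : DForm E₂ Λ₂ n} (hlam : IsSmoothForm lam) {I₁ : FormSet E₁ Λ₁} {I₂ : FormSet E₂ Λ₂}
    (hI₂ : ∀ a ∈ I₂, IsSmoothForm a.2)
    (hρI : ∀ a ∈ I₂, (⟨a.1, pullback ρ a.2⟩ : Σ k : ℕ, DForm E₁ Λ₁ k) ∈ I₁)
    (hrI : ∀ a ∈ I₁, (⟨a.1, pullback r a.2⟩ : Σ k : ℕ, DForm E₂ Λ₂ k) ∈ I₂)
    (hInt : ∀ s : M → Λ₂, ContMDiff (𝓡 n) 𝓘(ℝ, E₂) ∞ s → (∀ x, π₂ (s x) = x) →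
      (∀ x, IsIntegralAt (n := n) I₂ s x) → ∀ x, ρ (r (s x)) = s x)
    (hadm : ∀ s : M → Λ₂, ContMDiff (𝓡 n) 𝓘(ℝ, E₂) ∞ s → (∀ x, π₂ (s x) = x) →
      (∀ x, IsIntegralAt (n := n) I₂ s x) → ∀ X : VField E₂ Λ₂, IsSmoothVField X →
      (∀ x, tmap E₂ (Vec n) π₂ (s x) (vecAt X (s x)) = 0) →
      (∀ a ∈ I₂, (pullback s (lieD X a.2) : DForm (Vec n) M a.1) = 0) →
      ∀ x, tmap E₁ E₂ ρ (r (s x)) (tmap E₂ E₁ r (s x) (vecAt X (s x))) = vecAt X (s x))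
    (hext : ∀ s : M → Λ₂, (∀ x, π₂ (s x) = x) → ∀ ξ : M → E₂, ContMDiff (𝓡 n) 𝓘(ℝ, E₂).tangent ∞
      (fun x => (⟨s x, ξ x⟩ : TangentBundle 𝓘(ℝ, E₂) Λ₂)) →
      (∀ x, tmap E₂ (Vec n) π₂ (s x) (ξ x) = 0) →
      ∃ X : VField E₂ Λ₂, IsSmoothVField X ∧ ∀ x, vecAt X (s x) = ξ x) :
    Set.BijOn (fun (τ : M → Λ₁) (x : M) => ρ (τ x))
      {τ | IsExtremal π₁ (pullback ρ lam : DForm E₁ Λ₁ n) I₁ τ} {s | IsExtremal π₂ lam I₂ s} := by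
  have hρd := fun p => (hρ.mapSmoothAt p).mdifferentiableAt
  have hrd := fun p => (hr.mapSmoothAt p).mdifferentiableAt
  have hπd := fun p => (hπ₂.mapSmoothAt p).mdifferentiableAt
  have hretr : ∀ {k : ℕ} (α : DForm E₁ Λ₁ k),
      (pullback ρ (pullback r α : DForm E₂ Λ₂ k) : DForm E₁ Λ₁ k) = α := by
    intro k α
    funext p
    rw [← pullback_comp (hrd _) (hρd _), pullback_congr (g := fun p => p)
      (Filter.Eventually.of_forall hrρ), pullback_id]
  have hπ₁ : π₁ = fun p => π₂ (ρ p) := funext fun p => (hπρ p).symm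
  have hvert : ∀ p v, tmap E₁ (Vec n) π₁ p v = tmap E₂ (Vec n) π₂ (ρ p) (tmap E₁ E₂ ρ p v) := by
    intro p v
    rw [hπ₁, tmap_comp (hπd _) (hρd _)]
    rfl
  refine ⟨fun τ hτ => ?_, fun τ _ τ' _ h => ?_, fun s hs => ?_⟩
  · have hτd := fun x => (hτ.smooth.mapSmoothAt x).mdifferentiableAt
    have hsm : ContMDiff (𝓡 n) 𝓘(ℝ, E₂) ∞ fun x => ρ (τ x) := hρ.comp hτ.smooth
    have hsec : ∀ x, π₂ (ρ (τ x)) = x := fun x => (hπρ _).trans (hτ.section_ x)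
    have hin : ∀ x, IsIntegralAt (n := n) I₂ (fun x => ρ (τ x)) x := by
      intro x a ha
      rw [pullback_comp (hρd _) (hτd _)]
      exact hτ.integral x _ (hρI a ha)
    refine ⟨hsm, hsec, hin, fun X hX hXv hXc hXa => ?_⟩
    have hY := isSmoothVField_retractField hρ hr hrρ hX
    have hXY : ∀ x, vecAt X (ρ (τ x)) =
        tmap E₁ E₂ ρ (τ x) (vecAt (retractField ρ r X : VField E₁ Λ₁) (τ x)) := by
      intro x
      have := hadm _ hsm hsec hin X hX hXv hXa x
      rw [hrρ] at this
      exact this.symm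
    have hl := fun {k : ℕ} {α : DForm E₂ Λ₂ k} (hα : IsSmoothForm α) =>
      pullback_lieD hτ.smooth hρ hY hX hXY hα
    rw [hl hlam]
    refine hτ.stationary _ hY (fun x => ?_) (hXc.of_isClosed_subset isClosed_closure
      (closure_mono fun x hx hx0 => hx ?_)) fun a ha => ?_
    · exact (hvert _ _).trans ((congrArg _ (hXY x).symm).trans (hXv x))
    · change tmap E₂ E₁ r (ρ (τ x)) (vecAt X (ρ (τ x))) = 0
      rw [show vecAt X (ρ (τ x)) = 0 from hx0, map_zero]
    · have := hl (hI₂ _ (hrI a ha))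
      rw [hretr, hXa _ (hrI a ha)] at this
      exact this.symm
  · funext x
    have := congrArg r (congrFun h x)
    simpa only [hrρ] using this
  · have hsd := fun x => (hs.smooth.mapSmoothAt x).mdifferentiableAt
    have hρs : ∀ x, ρ (r (s x)) = s x := hInt s hs.smooth hs.section_ hs.integral
    have hsm : ContMDiff (𝓡 n) 𝓘(ℝ, E₁) ∞ fun x => r (s x) := hr.comp hs.smooth
    refine ⟨fun x => r (s x), ⟨hsm, fun x => (hπr _).trans (hs.section_ x), fun x a ha => ?_,
      fun Y hY hYv hYc hYa => ?_⟩, funext hρs⟩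
    · rw [pullback_comp (hrd _) (hsd _)]
      exact hs.integral x _ (hrI a ha)
    · have hξ := contMDiff_tmap hρ (g := fun x => r (s x)) (v := fun x => vecAt Y (r (s x)))
        (hY.comp hsm)
      have hξv : ∀ x, tmap E₂ (Vec n) π₂ (ρ (r (s x)))
          (tmap E₁ E₂ ρ (r (s x)) (vecAt Y (r (s x)))) = 0 := by
        intro x
        rw [← hvert]
        exact hYv x
      obtain ⟨X, hX, hXξ⟩ := hext (fun x => ρ (r (s x)))
        (fun x => (congrArg π₂ (hρs x)).trans (hs.section_ x)) _ hξ hξv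
      have hl := fun {k : ℕ} {α : DForm E₂ Λ₂ k} (hα : IsSmoothForm α) =>
        pullback_lieD hsm hρ hY hX hXξ hα
      have hs' : (fun x => ρ (r (s x))) = s := funext hρs
      rw [hs'] at hl
      rw [← hl hlam]
      refine hs.stationary X hX (fun x => ?_) (hYc.of_isClosed_subset isClosed_closure
        (closure_mono fun x hx hx0 => hx ?_)) fun a ha => ?_
      · have := hξv x
        rw [← hXξ, hρs] at this
        exact this
      · have := hXξ x
        rw [hρs, show vecAt Y (r (s x)) = 0 from hx0, map_zero] at this
        exact this
      · rw [hl (hI₂ a ha)]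
        exact hYa _ (hρI a ha)

end Transfer

section
variable {E' : Type*} [NormedAddCommGroup E'] [NormedSpace ℝ E']
variable {E : Type*} [NormedAddCommGroup E] [NormedSpace ℝ E]
variable {N : Type*} [TopologicalSpace N] [ChartedSpace E N]
variable {N' : Type*} [TopologicalSpace N'] [ChartedSpace E' N']
variable [IsManifold 𝓘(ℝ, E) ∞ N] [IsManifold 𝓘(ℝ, E') ∞ N']

theorem tmap_chartAt_self (x : N) : tmap E E (chartAt E x) x = ContinuousLinearMap.id ℝ E :=
  mfderiv_extChartAt_self (I := 𝓘(ℝ, E)) (x := x)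

theorem tmap_chartAt_symm_self (x : N) :
    tmap E E (chartAt E x).symm (chartAt E x x) = ContinuousLinearMap.id ℝ E := by
  ext v
  have := tmap_symm_tmap (chart_mem_atlas E x) (mem_chart_source E x) v
  rwa [tmap_chartAt_self] at this

/-- Derivatives are computed in the preferred charts. -/
theorem tmap_eq_fderiv_chart {f : N' → N} {x : N'} (hf : MapSmoothAt E' E f x) :
    tmap E' E f x = fderiv ℝ (fun y => chartAt E (f x) (f ((chartAt E' x).symm y)))
      (chartAt E' x x) := by
  set c := chartAt E (f x)
  set c' := chartAt E' x
  have hx' : x ∈ c'.source := mem_chart_source E' x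
  have hx : f x ∈ c.source := mem_chart_source E _
  have h1 : MapSmoothAt E' E' c'.symm (c' x) :=
    mapSmoothAt_chart_symm (chart_mem_atlas E' x) (c'.map_source hx')
  have h2 : MapSmoothAt E' E f (c'.symm (c' x)) := by rwa [c'.left_inv hx']
  have h3 : MapSmoothAt E E c (f (c'.symm (c' x))) := by
    rw [c'.left_inv hx']; exact mapSmoothAt_chart (chart_mem_atlas E _) hx
  rw [← tmap_eq_fderiv, tmap_comp (f := c) (g := fun y => f (c'.symm y)) h3.mdifferentiableAt
    (h2.comp h1).mdifferentiableAt, tmap_comp (f := f) h2.mdifferentiableAt h1.mdifferentiableAt,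
    tmap_chartAt_symm_self, c'.left_inv hx', tmap_chartAt_self]
  rfl

theorem mapSmoothAt_of_contDiffOn {f : E' → E} {U : Set E'} (hU : IsOpen U)
    (hf : ContDiffOn ℝ ∞ f U) {x : E'} (hx : x ∈ U) : MapSmoothAt E' E f x :=
  (contMDiffOn_iff_contDiffOn.2 hf).mapSmoothAt hU hx
end

section Charts

variable {V : Type} [NormedAddCommGroup V] [NormedSpace ℝ V]
variable {W : Type} [NormedAddCommGroup W] [NormedSpace ℝ W]
variable {W₁ : Type} [NormedAddCommGroup W₁] [NormedSpace ℝ W₁]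
variable {W₂ : Type} [NormedAddCommGroup W₂] [NormedSpace ℝ W₂]
variable {M : Type*} [TopologicalSpace M] [ChartedSpace V M] [IsManifold 𝓘(ℝ, V) ∞ M]

theorem hess_symm {c c' : OpenPartialHomeomorph M V} (hc : c ∈ atlas V M)
    (hc' : c' ∈ atlas V M) {x : M} (hx : x ∈ c.source) (hx' : x ∈ c'.source) (u v : V) :
    hess c c' x u v = hess c c' x v u := by
  have h := (contDiffAt_change hc hc' hx hx').isSymmSndFDerivAt
    (by rw [minSmoothness_of_isRCLikeNormedField]; norm_cast)
  exact h u v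

namespace NatBundle

variable (b : NatBundle V W)

/-- The bundle chart induced by the chart `c` of the base. -/
def bchart (c : OpenPartialHomeomorph M V) (hc : c ∈ atlas V M) :
    OpenPartialHomeomorph (Tot b M) (V × W) :=
  (b.core M).openPartialHomeomorph (b.chart c hc) ⟨c, hc, rfl⟩

variable {c c' : OpenPartialHomeomorph M V} (hc : c ∈ atlas V M) (hc' : c' ∈ atlas V M)

theorem bchart_mem_atlas : b.bchart c hc ∈ atlas (V × W) (Tot b M) := by
  change _ ∈ ⋃ (e : PartialEquiv (Tot b M) (V × W)) (he : e ∈ (b.core M).atlas),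
    {(b.core M).openPartialHomeomorph e he}
  simp only [Set.mem_iUnion, Set.mem_singleton_iff]
  exact ⟨_, ⟨c, hc, rfl⟩, rfl⟩

theorem chartAt_eq (p : Tot b M) :
    chartAt (V × W) p = b.bchart (chartAt V p.base) (chart_mem_atlas V _) := rfl

theorem bchart_apply (p : Tot b M) :
    b.bchart c hc p = (c p.base, b.trans (chartAt V p.base) c p.base p.val) := rfl

theorem mem_bchart_source {p : Tot b M} : p ∈ (b.bchart c hc).source ↔ p.base ∈ c.source := Iff.rfl

theorem bchart_symm_base (q : V × W) : ((b.bchart c hc).symm q).base = c.symm q.1 :=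
  b.mkTot_base _ _

theorem bchart_bchart_symm {q : V × W} (hq : q ∈ (b.bchart c hc).target)
    (hq' : c.symm q.1 ∈ c'.source) :
    b.bchart c' hc' ((b.bchart c hc).symm q) =
      (c' (c.symm q.1), b.trans c c' (c.symm q.1) q.2) :=
  b.chart_change_eq hc hc' ⟨⟨hq.1, hq'⟩, hq.2⟩

theorem chartAt_self (p : Tot b M) : chartAt (V × W) p p = (chartAt V p.base p.base, p.val) := by
  rw [chartAt_eq, bchart_apply, b.trans_self _ (mem_chart_source V p.base) p.mem]

theorem bchart_snd_mem {p : Tot b M} (hp : p.base ∈ c.source) : (b.bchart c hc p).2 ∈ b.fib :=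
  ((b.bchart c hc).map_source (b.mem_bchart_source hc |>.2 hp)).2

theorem mapSmoothAt_base (p : Tot b M) : MapSmoothAt (V × W) V (Tot.base : Tot b M → M) p := by
  set c := chartAt V p.base
  have hc : c ∈ atlas V M := chart_mem_atlas V _
  have hp : p.base ∈ c.source := mem_chart_source V _
  have h1 := mapSmoothAt_chart (b.bchart_mem_atlas hc) (x := p) hp
  have h2 : MapSmoothAt (V × W) V (Prod.fst : V × W → V) (b.bchart c hc p) :=
    mapSmoothAt_of_contDiffOn isOpen_univ contDiffOn_fst trivial
  have h3 : MapSmoothAt V V c.symm (b.bchart c hc p).1 :=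
    mapSmoothAt_chart_symm hc (c.map_source hp)
  have h4 := MapSmoothAt.comp (f := c.symm) (g := fun q => (b.bchart c hc q).1) h3
    (MapSmoothAt.comp h2 h1)
  refine h4.congr ?_
  filter_upwards [(b.bchart c hc).open_source.mem_nhds hp] with q hq using (c.left_inv hq).symm

theorem contMDiff_base : ContMDiff 𝓘(ℝ, V × W) 𝓘(ℝ, V) ∞ (Tot.base : Tot b M → M) :=
  fun p => (b.mapSmoothAt_base p).contMDiffAt

theorem tmap_base (p : Tot b M) : tmap (V × W) V (Tot.base : Tot b M → M) p =
    ContinuousLinearMap.fst ℝ V W := by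
  rw [tmap_eq_fderiv_chart (b.mapSmoothAt_base p)]
  have : (fun y => chartAt V p.base ((chartAt (V × W) p).symm y).base) =ᶠ[𝓝 (chartAt (V × W) p p)]
      Prod.fst := by
    filter_upwards [(chartAt (V × W) p).open_target.mem_nhds (mem_chart_target _ p)] with y hy
    rw [chartAt_eq, bchart_symm_base]
    exact (chartAt V p.base).right_inv hy.1
  rw [this.fderiv_eq, fderiv_fst]

theorem isOpen_baseSource (U : Set M) (hU : IsOpen U) : IsOpen {p : Tot b M | p.base ∈ U} :=
  hU.preimage b.contMDiff_base.continuous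

instance [T2Space M] : T2Space (Tot b M) := by
  refine ⟨fun p q hpq => ?_⟩
  by_cases h : p.base = q.base
  · set c := chartAt V p.base
    have hc : c ∈ atlas V M := chart_mem_atlas V _
    have hp : p ∈ (b.bchart c hc).source := mem_chart_source V p.base
    have hq : q ∈ (b.bchart c hc).source := by
      rw [mem_bchart_source, ← h]; exact mem_chart_source V p.base
    have hne : b.bchart c hc p ≠ b.bchart c hc q :=
      fun h' => hpq ((b.bchart c hc).injOn hp hq h')
    obtain ⟨u, v, hu, hv, hpu, hqv, huv⟩ := t2_separation hne
    refine ⟨_, _, (b.bchart c hc).isOpen_inter_preimage hu, (b.bchart c hc).isOpen_inter_preimage hv,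
      ⟨hp, hpu⟩, ⟨hq, hqv⟩, ?_⟩
    exact (huv.preimage (b.bchart c hc)).mono Set.inter_subset_right Set.inter_subset_right
  · obtain ⟨u, v, hu, hv, hpu, hqv, huv⟩ := t2_separation h
    exact ⟨_, _, b.isOpen_baseSource u hu, b.isOpen_baseSource v hv, hpu, hqv,
      huv.preimage Tot.base⟩

/-- The derivative of the bundle chart of `c`, in terms of the change of coordinates. -/
theorem hasFDerivAt_change {p : Tot b M} (hp : p.base ∈ c.source) :
    HasFDerivAt (fun q : V × W => (c ((chartAt V p.base).symm q.1),
        b.trans (chartAt V p.base) c ((chartAt V p.base).symm q.1) q.2))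
      (tmap (V × W) (V × W) (b.bchart c hc) p) (chartAt V p.base p.base, p.val) := by
  have h := mapSmoothAt_chart (b.bchart_mem_atlas hc) (x := p) hp
  have h1 := contDiffAt_chart_comp (mapSmoothAt_id (E := V × W) p) (b.bchart_mem_atlas hc) hp
    (chart_mem_atlas (V × W) p) (mem_chart_source _ p)
  have h2 := (h1.differentiableAt (by simp)).hasFDerivAt
  have h3 : fderiv ℝ (fun z => b.bchart c hc ((chartAt (V × W) p).symm z)) (chartAt (V × W) p p) =
      tmap (V × W) (V × W) (b.bchart c hc) p := (tmap_eq_fderiv_chart h).symm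
  rw [h3, chartAt_self] at h2
  refine h2.congr_of_eventuallyEq ?_
  have h4 : ∀ᶠ y in 𝓝 (chartAt (V × W) p p), y ∈ (chartAt (V × W) p).target ∧
      ((chartAt (V × W) p).symm y).base ∈ c.source :=
    eventually_chart_symm (mem_chart_source _ p)
      ((b.isOpen_baseSource _ c.open_source).mem_nhds hp)
  rw [chartAt_self] at h4
  filter_upwards [h4] with y hy
  refine (b.bchart_bchart_symm (chart_mem_atlas V p.base) hc hy.1 ?_).symm
  have := hy.2
  rwa [chartAt_eq, bchart_symm_base] at this

theorem tmap_bchart_fst {p : Tot b M} (hp : p.base ∈ c.source) (v : V × W) :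
    (tmap (V × W) (V × W) (b.bchart c hc) p v).1 = jac (chartAt V p.base) c p.base v.1 := by
  have h1 := (hasFDerivAt_fst (𝕜 := ℝ) (E := V) (F := W)).comp _ (b.hasFDerivAt_change hc hp)
  have h2 : HasFDerivAt (c ∘ (chartAt V p.base).symm) (jac (chartAt V p.base) c p.base)
      (chartAt V p.base p.base) :=
    ((contDiffAt_change (chart_mem_atlas V _) hc (mem_chart_source V _) hp).differentiableAt
      (by simp)).hasFDerivAt
  have h3 := HasFDerivAt.comp (𝕜 := ℝ) (chartAt V p.base p.base, p.val) (g := c ∘ (chartAt V p.base).symm)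
    (f := (Prod.fst : V × W → V)) h2 hasFDerivAt_fst
  have := h1.unique h3
  exact congrArg (fun A : V × W →L[ℝ] V => A v) this

/-- A component of the derivative of a bundle chart along the fibre. -/
theorem tmap_bchart_snd {p : Tot b M} (hp : p.base ∈ c.source) (ℓ : W →L[ℝ] W₁)
    {G : V × W → W₁} {G' : V × W →L[ℝ] W₁}
    (hG : ∀ q, ℓ (b.trans (chartAt V p.base) c ((chartAt V p.base).symm q.1) q.2) = G q)
    (hG' : HasFDerivAt G G' (chartAt V p.base p.base, p.val)) (v : V × W) :
    ℓ (tmap (V × W) (V × W) (b.bchart c hc) p v).2 = G' v := by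
  have h1 := (ℓ ∘L ContinuousLinearMap.snd ℝ V W).hasFDerivAt.comp _ (b.hasFDerivAt_change hc hp)
  have h2 : ((ℓ ∘L ContinuousLinearMap.snd ℝ V W) ∘ fun q : V × W =>
      (c ((chartAt V p.base).symm q.1),
        b.trans (chartAt V p.base) c ((chartAt V p.base).symm q.1) q.2)) = G := funext hG
  rw [h2] at h1
  exact congrArg (fun A : V × W →L[ℝ] W₁ => A v) (h1.unique hG')

theorem contDiff_trans (c c' : OpenPartialHomeomorph M V) (x : M) :
    ContDiff ℝ ∞ (b.trans c c' x) :=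
  b.contDiff_act.comp (contDiff_const.prodMk (contDiff_const.prodMk
    (contDiff_const.prodMk contDiff_id)))

theorem tmap_bchart_vertical {p : Tot b M} (hp : p.base ∈ c.source) (w : W) :
    tmap (V × W) (V × W) (b.bchart c hc) p (0, w) =
      (0, fderiv ℝ (b.trans (chartAt V p.base) c p.base) p.val w) := by
  refine Prod.ext ?_ ?_
  · rw [tmap_bchart_fst b hc hp]; simp
  · have h0 := (b.hasFDerivAt_change hc hp).snd
    have h1 : HasFDerivAt (fun w : W => ((chartAt V p.base p.base, w) : V × W))
      (ContinuousLinearMap.inr ℝ V W) p.val := hasFDerivAt_prodMk_right _ _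
    have h2 := HasFDerivAt.comp (𝕜 := ℝ) p.val h0 h1
    have h3 : HasFDerivAt (b.trans (chartAt V p.base) c p.base)
        (fderiv ℝ (b.trans (chartAt V p.base) c p.base) p.val) p.val :=
      ((b.contDiff_trans _ _ _).differentiable (by simp) _).hasFDerivAt
    have h4 := h2.unique (h3.congr_of_eventuallyEq (Filter.Eventually.of_forall fun w => by
      simp [(chartAt V p.base).left_inv (mem_chart_source V p.base)]))
    exact congrArg (fun A : W →L[ℝ] W => A w) h4

/-- The action is affine in the fibre coordinate. -/
def IsAffine (b : NatBundle V W) : Prop :=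
  ∀ A A' B, ∃ (ℓ : W →L[ℝ] W) (w₀ : W), ∀ w, b.act A A' B w = ℓ w + w₀

theorem IsAffine.fderiv_trans {b : NatBundle V W} (hb : b.IsAffine)
    (c c' : OpenPartialHomeomorph M V) (x : M) (w w' : W) :
    fderiv ℝ (b.trans c c' x) w = fderiv ℝ (b.trans c c' x) w' := by
  obtain ⟨ℓ, w₀, h⟩ := hb (jac c c' x) (jac c' c x) (hess c c' x)
  have : b.trans c c' x = fun w => ℓ w + w₀ := funext h
  have h2 : ∀ w, fderiv ℝ (fun w => ℓ w + w₀) w = ℓ := fun w =>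
    (ℓ.hasFDerivAt.add_const w₀).fderiv
  rw [this, h2, h2]

/-- Vertical vector fields along sections of bundles with affine action extend to the total space,
constantly along the fibres. -/
theorem IsAffine.exists_extension {b : NatBundle V W} (hb : b.IsAffine)
    [FiniteDimensional ℝ V] [FiniteDimensional ℝ W] {s : M → Tot b M} (hs : ∀ x, (s x).base = x)
    {ξ : M → V × W} (hξ : ContMDiff 𝓘(ℝ, V) 𝓘(ℝ, V × W).tangent ∞
      (fun x => (⟨s x, ξ x⟩ : TangentBundle 𝓘(ℝ, V × W) (Tot b M))))
    (hvert : ∀ x, tmap (V × W) V (Tot.base : Tot b M → M) (s x) (ξ x) = 0) :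
    ∃ X : VField (V × W) (Tot b M), IsSmoothVField X ∧ ∀ x, vecAt X (s x) = ξ x := by
  have hv : ∀ x, ξ x = (0, (ξ x).2) := fun x => by
    have := hvert x
    rw [tmap_base] at this
    exact Prod.ext this rfl
  let X : VField (V × W) (Tot b M) := fun p => ξ p.base
  refine ⟨X, fun p => ?_, fun x => congrArg ξ (hs x)⟩
  refine (contMDiffAt_tangent_iff (g := fun q : Tot b M => q) (v := vecAt X)).2
    ⟨contMDiffAt_id, ?_⟩
  set c := chartAt V p.base
  have hc : c ∈ atlas V M := chart_mem_atlas V _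
  have h1 := (contMDiffAt_tangent_iff (g := s) (v := ξ) (x := p.base)).1 (hξ p.base)
  have h2 : ContMDiffAt 𝓘(ℝ, V × W) 𝓘(ℝ, V × W) ∞
      (fun q : Tot b M => tmap (V × W) (V × W) (chartAt (V × W) (s p.base)) (s q.base) (ξ q.base)) p :=
    ContMDiffAt.comp (g := fun x => tmap (V × W) (V × W) (chartAt (V × W) (s p.base)) (s x) (ξ x))
      p h1.2 b.contMDiff_base.contMDiffAt
  refine h2.congr_of_eventuallyEq ?_
  filter_upwards [(b.isOpen_baseSource _ c.open_source).mem_nhds (mem_chart_source V p.base)]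
    with q hq
  have e1 : chartAt (V × W) (s p.base) = b.bchart c hc := by
    rw [chartAt_eq]; simp only [hs]; rfl
  have hq' : (s q.base).base ∈ c.source := by rw [hs]; exact hq
  rw [e1]
  change tmap (V × W) (V × W) (b.bchart c hc) q (ξ q.base) = _
  rw [hv, tmap_bchart_vertical b hc hq, tmap_bchart_vertical b hc hq', hs,
    hb.fderiv_trans _ _ _ q.val (s q.base).val]

end NatBundle

/-! ### Natural maps -/

/-- A smooth map of fibres which commutes with changes of coordinates. -/
structure NatMap (b₁ : NatBundle V W₁) (b₂ : NatBundle V W₂) where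
  toFun : W₁ → W₂
  mapsTo : ∀ {w}, w ∈ b₁.fib → toFun w ∈ b₂.fib
  contDiffOn : ContDiffOn ℝ ∞ toFun b₁.fib
  map_act : ∀ {A A' : Op V} {B : Op2 V} {w : W₁}, A * A' = 1 → A' * A = 1 →
    (∀ u v, B u v = B v u) → w ∈ b₁.fib → toFun (b₁.act A A' B w) = b₂.act A A' B (toFun w)

namespace NatMap

variable {b₁ : NatBundle V W₁} {b₂ : NatBundle V W₂} (φ : NatMap b₁ b₂)

/-- The map of total spaces. -/
def tot (p : Tot b₁ M) : Tot b₂ M := ⟨p.base, φ.toFun p.val, φ.mapsTo p.mem⟩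

theorem bchart_tot {c : OpenPartialHomeomorph M V} (hc : c ∈ atlas V M) {p : Tot b₁ M}
    (hp : p.base ∈ c.source) :
    b₂.bchart c hc (φ.tot p) = ((b₁.bchart c hc p).1, φ.toFun (b₁.bchart c hc p).2) := by
  refine Prod.ext rfl ?_
  exact (φ.map_act (jac_mul_jac hc (chart_mem_atlas V _) hp (mem_chart_source V _))
    (jac_mul_jac (chart_mem_atlas V _) hc (mem_chart_source V _) hp)
    (hess_symm (chart_mem_atlas V _) hc (mem_chart_source V _) hp) p.mem).symm

theorem mapSmoothAt_tot (p : Tot b₁ M) : MapSmoothAt (V × W₁) (V × W₂) (φ.tot (M := M)) p := by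
  set c := chartAt V p.base
  have hc : c ∈ atlas V M := chart_mem_atlas V _
  have hp : p.base ∈ c.source := mem_chart_source V _
  have h1 := mapSmoothAt_chart (b₁.bchart_mem_atlas hc) (x := p) hp
  have h2 : MapSmoothAt (V × W₁) (V × W₂) (fun q : V × W₁ => (q.1, φ.toFun q.2))
      (b₁.bchart c hc p) :=
    mapSmoothAt_of_contDiffOn (isOpen_univ.prod b₁.isOpen_fib)
      (contDiff_fst.contDiffOn.prodMk (φ.contDiffOn.comp contDiffOn_snd fun q hq => hq.2))
      (x := b₁.bchart c hc p) (Set.mem_prod.2 ⟨trivial, b₁.bchart_snd_mem hc hp⟩)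
  have h3 : MapSmoothAt (V × W₂) (V × W₂) (b₂.bchart c hc).symm
      ((b₁.bchart c hc p).1, φ.toFun (b₁.bchart c hc p).2) :=
    mapSmoothAt_chart_symm (b₂.bchart_mem_atlas hc)
      ⟨c.map_source hp, φ.mapsTo (b₁.bchart_snd_mem hc hp)⟩
  have h4 := MapSmoothAt.comp (f := (b₂.bchart c hc).symm)
    (g := fun q => ((b₁.bchart c hc q).1, φ.toFun (b₁.bchart c hc q).2)) h3 (MapSmoothAt.comp h2 h1)
  refine h4.congr ?_
  filter_upwards [(b₁.bchart c hc).open_source.mem_nhds hp] with q hq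
  rw [← φ.bchart_tot hc hq]
  exact ((b₂.bchart c hc).left_inv (x := φ.tot q) hq).symm

theorem contMDiff_tot : ContMDiff 𝓘(ℝ, V × W₁) 𝓘(ℝ, V × W₂) ∞ (φ.tot (M := M)) :=
  fun p => (φ.mapSmoothAt_tot p).contMDiffAt

theorem tmap_tot (p : Tot b₁ M) (v : V × W₁) :
    tmap (V × W₁) (V × W₂) (φ.tot (M := M)) p v = (v.1, fderiv ℝ φ.toFun p.val v.2) := by
  rw [tmap_eq_fderiv_chart (φ.mapSmoothAt_tot p)]
  have h1 : (fun y => chartAt (V × W₂) (φ.tot p) (φ.tot ((chartAt (V × W₁) p).symm y)))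
      =ᶠ[𝓝 (chartAt (V × W₁) p p)] fun q => (q.1, φ.toFun q.2) := by
    filter_upwards [(chartAt (V × W₁) p).open_target.mem_nhds (mem_chart_target _ p)] with y hy
    have hy2 := (chartAt (V × W₁) p).map_target hy
    refine (φ.bchart_tot (chart_mem_atlas V p.base) hy2).trans ?_
    have := (chartAt (V × W₁) p).right_inv hy
    rw [NatBundle.chartAt_eq] at this
    rw [NatBundle.chartAt_eq, this]
  rw [h1.fderiv_eq, NatBundle.chartAt_self]
  have h2 : HasFDerivAt φ.toFun (fderiv ℝ φ.toFun p.val) p.val :=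
    ((φ.contDiffOn.contDiffAt (b₁.isOpen_fib.mem_nhds p.mem)).differentiableAt
      (by simp)).hasFDerivAt
  have h3 := (hasFDerivAt_fst (𝕜 := ℝ) (E := V) (F := W₁)
    (p := (chartAt V p.base p.base, p.val))).prodMk (HasFDerivAt.comp (𝕜 := ℝ)
      (chartAt V p.base p.base, p.val) h2 hasFDerivAt_snd)
  have h4 : fderiv ℝ (fun q : V × W₁ => (q.1, φ.toFun q.2)) (chartAt V p.base p.base, p.val) = _ :=
    h3.fderiv
  rw [h4]
  rfl

end NatMap

end Charts

section LeviCivita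

variable {V : Type} [NormedAddCommGroup V] [NormedSpace ℝ V]

section Nondegenerate

variable {η : Signature V} {g : Bil V}

/-- The inverse of `v ↦ g(v, ·)`. -/
theorem HasSignature.exists_sharp (hg : HasSignature η g) :
    ∃ S : (V →L[ℝ] ℝ) →L[ℝ] V, ∀ f, g (S f) = f := by
  obtain ⟨e, he, h⟩ := hg
  obtain ⟨e, rfl⟩ := he
  refine ⟨(e : Op V) ∘L η.sharp ∘L (ContinuousLinearMap.compL ℝ V V ℝ).flip (e : Op V), fun f => ?_⟩
  ext w
  obtain ⟨u, rfl⟩ : ∃ u, w = (e : Op V) u :=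
    ⟨((e⁻¹ : (Op V)ˣ) : Op V) w, by rw [← mul_apply_eq_comp, Units.mul_inv, one_apply_eq_self]⟩
  change g ((e : Op V) (η.sharp _)) _ = _
  rw [h, η.form_sharp]
  rfl

theorem HasSignature.injective [FiniteDimensional ℝ V] (hg : HasSignature η g) (hs : g ∈ symSub V) :
    Function.Injective g := by
  obtain ⟨S, hS⟩ := hg.exists_sharp
  refine (injective_iff_map_eq_zero g).2 fun v hv => ?_
  by_contra hne
  obtain ⟨f, -, hf⟩ := exists_dual_vector ℝ v (norm_ne_zero_iff.2 hne)
  have h1 : f v = 0 := by rw [← hS f, hs, hv]; rfl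
  rw [h1] at hf
  exact hne (norm_eq_zero.1 (by exact_mod_cast hf.symm))

/-- A metric as an isomorphism onto the dual space. -/
def HasSignature.equiv [FiniteDimensional ℝ V] (hg : HasSignature η g) (hs : g ∈ symSub V) :
    V ≃L[ℝ] (V →L[ℝ] ℝ) :=
  ContinuousLinearEquiv.equivOfInverse g hg.exists_sharp.choose
    (fun v => hg.injective hs (hg.exists_sharp.choose_spec (g v))) hg.exists_sharp.choose_spec

theorem HasSignature.coe_equiv [FiniteDimensional ℝ V] (hg : HasSignature η g) (hs : g ∈ symSub V) :
    (hg.equiv hs : V →L[ℝ] (V →L[ℝ] ℝ)) = g := rfl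

end Nondegenerate

/-- The Koszul expression `(h(u)(v, w) + h(v)(u, w) - h(w)(u, v)) / 2`. -/
def koszul (V : Type) [NormedAddCommGroup V] [NormedSpace ℝ V] :
    (V →L[ℝ] SymBil V) →L[ℝ] (V →L[ℝ] V →L[ℝ] V →L[ℝ] ℝ) :=
  let F : (V →L[ℝ] V →L[ℝ] V →L[ℝ] ℝ) →L[ℝ] (V →L[ℝ] V →L[ℝ] V →L[ℝ] ℝ) :=
    (ContinuousLinearMap.flipₗᵢ ℝ V V (V →L[ℝ] ℝ)).toContinuousLinearEquiv
  let P : Bil V →L[ℝ] Bil V := (ContinuousLinearMap.flipₗᵢ ℝ V V ℝ).toContinuousLinearEquiv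
  ((1 / 2 : ℝ) • (ContinuousLinearMap.id ℝ _ + F - ContinuousLinearMap.compL ℝ V _ _ P ∘L F)) ∘L
    ContinuousLinearMap.compL ℝ V (SymBil V) (Bil V) SymBil.toBil

theorem koszul_apply (h : V →L[ℝ] SymBil V) (u v w : V) :
    koszul V h u v w =
      ((h u : Bil V) v w + (h v : Bil V) u w - (h w : Bil V) u v) / 2 := by
  change (1 / 2 : ℝ) • ((h u : Bil V) v w + (h v : Bil V) u w - (h w : Bil V) u v) = _
  rw [smul_eq_mul]; ring

/-- The Christoffel symbols of the Levi-Civita connection of a metric `g` with first derivatives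
`h`. -/
def leviCivita (g : SymBil V) (h : V →L[ℝ] SymBil V) : Op2 V :=
  ContinuousLinearMap.compL ℝ V (V →L[ℝ] ℝ) V (ContinuousLinearMap.inverse (g : Bil V)) ∘L koszul V h

/-- The derivatives of a metric which is parallel with respect to the connection `Γ`. -/
def parallelJet (Γ : Op2 V) (g : SymBil V) : V →L[ℝ] SymBil V :=
  (2 : ℝ) • (symPart V ∘L ContinuousLinearMap.compL ℝ V V (V →L[ℝ] ℝ) (g : Bil V) ∘L Γ)

theorem parallelJet_apply (Γ : Op2 V) (g : SymBil V) (u v w : V) :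
    (parallelJet Γ g u : Bil V) v w = (g : Bil V) (Γ u v) w + (g : Bil V) v (Γ u w) := by
  have h1 : (parallelJet Γ g u : Bil V) v w =
    2 * (((g : Bil V) (Γ u v) w + (g : Bil V) (Γ u w) v) / 2) := by
    exact congrArg (2 * ·) (symPart_apply ((g : Bil V) ∘L Γ u) v w)
  rw [h1, g.symm (Γ u w) v]
  ring

theorem leviCivita_apply [FiniteDimensional ℝ V] {η : Signature V} {g : SymBil V}
    (hg : HasSignature η (g : Bil V)) (h : V →L[ℝ] SymBil V) (u v : V) :
    (g : Bil V) (leviCivita g h u v) = koszul V h u v := by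
  change (g : Bil V) (ContinuousLinearMap.inverse (g : Bil V) (koszul V h u v)) = _
  rw [← hg.coe_equiv g.symm, ContinuousLinearMap.inverse_equiv]
  exact (hg.equiv g.symm).apply_symm_apply _

theorem leviCivita_symm [FiniteDimensional ℝ V] {η : Signature V} {g : SymBil V}
    (hg : HasSignature η (g : Bil V)) (h : V →L[ℝ] SymBil V) (u v : V) :
    leviCivita g h u v = leviCivita g h v u := by
  refine hg.injective g.symm ?_
  rw [leviCivita_apply hg, leviCivita_apply hg]
  ext w
  rw [koszul_apply, koszul_apply, (h w).symm u v]
  ring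

theorem parallelJet_leviCivita [FiniteDimensional ℝ V] {η : Signature V} {g : SymBil V}
    (hg : HasSignature η (g : Bil V)) (h : V →L[ℝ] SymBil V) :
    parallelJet (leviCivita g h) g = h := by
  refine ContinuousLinearMap.ext fun u => SymBil.ext' fun v w => ?_
  rw [parallelJet_apply, g.symm v, leviCivita_apply hg, leviCivita_apply hg, koszul_apply,
    koszul_apply, (h u).symm w v, (h v).symm u w, (h w).symm u v]
  ring

theorem leviCivita_parallelJet [FiniteDimensional ℝ V] {η : Signature V} {g : SymBil V}
    (hg : HasSignature η (g : Bil V)) {Γ : Op2 V} (hΓ : ∀ u v, Γ u v = Γ v u) :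
    leviCivita g (parallelJet Γ g) = Γ := by
  refine ContinuousLinearMap.ext fun u => ContinuousLinearMap.ext fun v => hg.injective g.symm ?_
  rw [leviCivita_apply hg]
  ext w
  rw [koszul_apply, parallelJet_apply, parallelJet_apply, parallelJet_apply, hΓ v u, hΓ w u, hΓ w v,
    g.symm v (Γ u w)]
  ring

theorem contDiffOn_leviCivita [CompleteSpace V] [FiniteDimensional ℝ V] (η : Signature V) :
    ContDiffOn ℝ ∞ (fun q : SymBil V × (V →L[ℝ] SymBil V) => leviCivita q.1 q.2)
      {q | HasSignature η (q.1 : Bil V)} := by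
  intro q hq
  refine ContDiffAt.contDiffWithinAt ?_
  have h1 : ContDiffAt ℝ ∞ (ContinuousLinearMap.inverse : Bil V → _) (q.1 : Bil V) := by
    have hq' : HasSignature η (q.1 : Bil V) := hq
    have := contDiffAt_map_inverse (𝕜 := ℝ) (n := ∞) (hq'.equiv q.1.symm)
    exact this
  have h2 : ContDiffAt ℝ ∞ (fun q : SymBil V × (V →L[ℝ] SymBil V) => (q.1 : Bil V)) q :=
    SymBil.toBil.contDiff.contDiffAt.comp q contDiffAt_fst
  have h3 : ContDiffAt ℝ ∞ (fun q : SymBil V × (V →L[ℝ] SymBil V) => koszul V q.2) q :=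
    (koszul V).contDiff.contDiffAt.comp q contDiffAt_snd
  exact ((ContinuousLinearMap.compL ℝ V (V →L[ℝ] ℝ) V).contDiff.contDiffAt.comp q
    (ContDiffAt.comp (g := ContinuousLinearMap.inverse) q h1 h2)).clm_comp h3

theorem contDiff_parallelJet :
    ContDiff ℝ ∞ (fun q : Op2 V × SymBil V => parallelJet q.1 q.2) := by
  have h2 : ContDiff ℝ ∞ (fun q : Op2 V × SymBil V => (q.2 : Bil V)) :=
    SymBil.toBil.contDiff.comp contDiff_snd
  exact (contDiff_const (c := (2 : ℝ))).smul ((contDiff_const (c := symPart V)).clm_comp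
    (((ContinuousLinearMap.compL ℝ V V (V →L[ℝ] ℝ)).contDiff.comp h2).clm_comp contDiff_fst))

/-! ### The natural maps between the bundles -/

variable [CompleteSpace V] [FiniteDimensional ℝ V] (η : Signature V)

/-- `C(LM) ×_M J¹Σ → J¹Σ`. -/
def p2Nat : NatMap ((connB V).prod (metricJet η)) (metricJet η) where
  toFun w := w.2
  mapsTo hw := hw.2
  contDiffOn := contDiffOn_snd
  map_act _ _ _ _ := rfl

/-- `C(LM) ×_M J¹Σ → C(LM) ×_M Σ`. -/
def projNat : NatMap ((connB V).prod (metricJet η)) ((connB V).prod (metricB η)) where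
  toFun w := (w.1, w.2.1)
  mapsTo hw := hw
  contDiffOn := (contDiff_fst.prodMk (contDiff_fst.comp contDiff_snd)).contDiffOn
  map_act _ _ _ _ := rfl

/-- `C(LM) ×_M Σ → J¹Σ`, the jet for which the metric is parallel at the point. -/
def retNat : NatMap ((connB V).prod (metricB η)) (metricJet η) where
  toFun w := (w.2, parallelJet w.1 w.2)
  mapsTo hw := hw.2
  contDiffOn := (contDiff_snd.prodMk contDiff_parallelJet).contDiffOn
  map_act {A A' B w} hA hA' _ _ := by
    have k1 : ∀ x, A' (A x) = x := fun x => by rw [← mul_apply_eq_comp, hA', one_apply_eq_self]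
    refine Prod.ext rfl ?_
    refine ContinuousLinearMap.ext fun u => SymBil.ext' fun v z => ?_
    change (parallelJet (postL A ∘L preL A' ∘L w.1 ∘L A' - preL A' ∘L B ∘L A')
      (symPart V (pullB A' (w.2 : Bil V))) u : Bil V) v z =
      (jetAct A' B w.2 (parallelJet w.1 w.2) u : Bil V) v z
    have hs : pullB A' (w.2 : Bil V) ∈ symSub V := fun v w => SymBil.symm _ _ _
    rw [jetAct_apply, parallelJet_apply, parallelJet_apply, symPart_of_sym hs]
    simp [k1]
    ring

/-- `J¹Σ → C(LM) ×_M J¹Σ`, given by the Levi-Civita connection. -/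
def sigNat : NatMap (metricJet η) ((connB V).prod (metricJet η)) where
  toFun w := (leviCivita w.1 w.2, w)
  mapsTo hw := ⟨trivial, hw⟩
  contDiffOn := (contDiffOn_leviCivita η).prodMk contDiffOn_id
  map_act {A A' B w} hA hA' hB hw := by
    refine Prod.ext ?_ rfl
    have hg : HasSignature η (symPart V (pullB A' (w.1 : Bil V)) : Bil V) :=
      HasSignature.pullB w.1.symm hw hA hA'
    have h1 := (retNat η).map_act (w := (leviCivita w.1 w.2, w.1)) hA hA' hB ⟨trivial, hw⟩
    have h2 := congrArg Prod.snd h1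
    change parallelJet (postL A ∘L preL A' ∘L leviCivita w.1 w.2 ∘L A' - preL A' ∘L B ∘L A')
      (symPart V (pullB A' (w.1 : Bil V))) =
      jetAct A' B w.1 (parallelJet (leviCivita w.1 w.2) w.1) at h2
    rw [parallelJet_leviCivita hw] at h2
    change leviCivita (symPart V (pullB A' (w.1 : Bil V))) (jetAct A' B w.1 w.2) =
      postL A ∘L preL A' ∘L leviCivita w.1 w.2 ∘L A' - preL A' ∘L B ∘L A'
    rw [← h2, leviCivita_parallelJet hg]
    intro u v
    change A (leviCivita w.1 w.2 (A' u) (A' v)) - B (A' u) (A' v) =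
      A (leviCivita w.1 w.2 (A' v) (A' u)) - B (A' v) (A' u)
    rw [leviCivita_symm hw, hB]

/-- `J¹Σ → C(LM) ×_M Σ`, given by the Levi-Civita connection. -/
def rhoNat : NatMap (metricJet η) ((connB V).prod (metricB η)) where
  toFun w := (leviCivita w.1 w.2, w.1)
  mapsTo hw := ⟨trivial, hw⟩
  contDiffOn := (contDiffOn_leviCivita η).prodMk contDiffOn_fst
  map_act hA hA' hB hw := by
    have h := congrArg Prod.fst ((sigNat η).map_act hA hA' hB hw)
    exact Prod.ext h rfl

theorem isAffine_connMetric : ((connB V).prod (metricB η)).IsAffine := by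
  intro A A' B
  refine ⟨((ContinuousLinearMap.compL ℝ V (Op V) (Op V) (postL A ∘L preL A') ∘L
    (ContinuousLinearMap.compL ℝ V V (Op V)).flip A')).prodMap
      (symPart V ∘L pullB A' ∘L SymBil.toBil), (-(preL A' ∘L B ∘L A'), 0), fun w => ?_⟩
  refine Prod.ext ?_ ?_
  · exact sub_eq_add_neg _ _
  · exact (add_zero _).symm

theorem isAffine_metricJet : (metricJet η).IsAffine := by
  intro A A' B
  let ℓ : SymBil V × (V →L[ℝ] SymBil V) →ₗ[ℝ] SymBil V × (V →L[ℝ] SymBil V) :=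
    { toFun := fun q => (metricJet η).act A A' B q
      map_add' := fun q q' => by
        refine Prod.ext ?_ (ContinuousLinearMap.ext fun u => SymBil.ext' fun v w => ?_)
        · change symPart V (pullB A' (SymBil.toBil (q.1 + q'.1))) = symPart V (pullB A' (q.1 : Bil V)) +
            symPart V (pullB A' (q'.1 : Bil V))
          rw [map_add, map_add, map_add]
        · change (jetAct A' B (q.1 + q'.1) (q.2 + q'.2) u : Bil V) v w =
            SymBil.toBil (jetAct A' B q.1 q.2 u + jetAct A' B q'.1 q'.2 u) v w
          rw [map_add]
          simp only [add_apply, jetAct_apply, map_add]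
          ring
      map_smul' := fun r q => by
        refine Prod.ext ?_ (ContinuousLinearMap.ext fun u => SymBil.ext' fun v w => ?_)
        · change symPart V (pullB A' (SymBil.toBil (r • q.1))) =
            r • symPart V (pullB A' (q.1 : Bil V))
          rw [map_smul, map_smul, map_smul]
        · change (jetAct A' B (r • q.1) (r • q.2) u : Bil V) v w =
            SymBil.toBil (r • jetAct A' B q.1 q.2 u) v w
          rw [map_smul]
          simp only [smul_apply, jetAct_apply, map_smul, smul_eq_mul]
          ring }
  exact ⟨LinearMap.toContinuousLinearMap ℓ, 0, fun w => (add_zero _).symm⟩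

end LeviCivita

theorem extDeriv_oneForm {E : Type*} [NormedAddCommGroup E] [NormedSpace ℝ E]
    {a : E → E →L[ℝ] ℝ} {x : E} (ha : DifferentiableAt ℝ a x) {b : E → E →L[ℝ] ℝ}
    (hb : ∀ v, HasFDerivAt (fun y => a y v) (b v) x) (v : Fin 2 → E) :
    extDeriv (fun y => oneForm (a y)) x v = b (v 1) (v 0) - b (v 0) (v 1) := by
  have h0 : DifferentiableAt ℝ (fun y => oneForm (a y)) x :=
    (ContinuousAlternatingMap.ofSubsingletonLIE (𝕜 := ℝ) (E := E) (F := ℝ) (0 : Fin 1)).differentiableAt.comp x ha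
  refine (extDeriv_apply h0 v).trans ((Fin.sum_univ_two _).trans ?_)
  have h1 : ∀ w : Fin 1 → E, fderiv ℝ (fun y => oneForm (a y) w) x = b (w 0) := fun w => (hb (w 0)).fderiv
  rw [h1, h1]
  simp [Fin.removeNth]
  ring

section Frames

variable {n : ℕ}

theorem hasFDerivAt_inverse {e : Op (Vec n)} (he : IsUnit e) :
    ∃ L : Op (Vec n) →L[ℝ] Op (Vec n), HasFDerivAt Ring.inverse L e ∧
      ∀ d v, L d v = - Ring.inverse e (d (Ring.inverse e v)) := by
  obtain ⟨u, rfl⟩ := he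
  refine ⟨_, hasFDerivAt_ringInverse u, fun d v => ?_⟩
  simp [ContinuousLinearMap.mulLeftRight_apply]

theorem inverse_apply {e : Op (Vec n)} (he : IsUnit e) (v : Vec n) : Ring.inverse e (e v) = v := by
  rw [← mul_apply_eq_comp, Ring.inverse_mul_cancel e he, one_apply_eq_self]

theorem apply_inverse {e : Op (Vec n)} (he : IsUnit e) (v : Vec n) : e (Ring.inverse e v) = v := by
  rw [← mul_apply_eq_comp, Ring.mul_inverse_cancel e he, one_apply_eq_self]

theorem inverse_eq_of_mul {A A' : Op (Vec n)} (h : A * A' = 1) (h' : A' * A = 1) :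
    Ring.inverse A = A' := by
  rw [← mul_one (Ring.inverse A), ← h, ← mul_assoc, Ring.inverse_mul_cancel A ⟨⟨A, A', h, h'⟩, rfl⟩,
    one_mul]

theorem inverse_mul {A A' e : Op (Vec n)} (h : A * A' = 1) (h' : A' * A = 1) (he : IsUnit e) :
    Ring.inverse (A * e) = Ring.inverse e * A' := by
  refine inverse_eq_of_mul ?_ ?_
  · rw [mul_assoc, ← mul_assoc e, Ring.mul_inverse_cancel e he, one_mul, h]
  · rw [mul_assoc, ← mul_assoc A', h', one_mul, Ring.inverse_mul_cancel e he]

theorem contDiffOn_inverse : ContDiffOn ℝ ∞ (Ring.inverse : Op (Vec n) → Op (Vec n)) {e | IsUnit e} := by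
  rintro e ⟨u, rfl⟩
  exact (contDiffAt_ringInverse ℝ u).contDiffWithinAt

theorem frameMetric_apply (e : Op (Vec n)) (v w : Vec n) :
    (frameMetric e : Bil (Vec n)) v w = etaBil n (Ring.inverse e v) (Ring.inverse e w) := by
  have hs : pullB (Ring.inverse e) (etaBil n) ∈ symSub (Vec n) := fun v w => (minkowski n).sym _ _
  rw [frameMetric, symPart_of_sym hs]
  rfl

theorem contDiffOn_frameMetric : ContDiffOn ℝ ∞ (frameMetric : Op (Vec n) → _) {e | IsUnit e} :=
  (symPart (Vec n)).contDiff.comp_contDiffOn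
    ((contDiff_pullB.comp_contDiffOn contDiffOn_inverse).clm_apply contDiffOn_const)

theorem fderiv_frameMetric {e : Op (Vec n)} (he : IsUnit e) (d : Op (Vec n)) (v w : Vec n) :
    (fderiv ℝ frameMetric e d : Bil (Vec n)) v w =
      - etaBil n (Ring.inverse e (d (Ring.inverse e v))) (Ring.inverse e w)
      - etaBil n (Ring.inverse e v) (Ring.inverse e (d (Ring.inverse e w))) := by
  have hd : HasFDerivAt frameMetric (fderiv ℝ frameMetric e) e :=
    ((contDiffOn_frameMetric.contDiffAt (Units.isOpen.mem_nhds he)).differentiableAt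
      (by simp)).hasFDerivAt
  let ev : SymBil (Vec n) →L[ℝ] ℝ := ContinuousLinearMap.apply ℝ ℝ w ∘L
    ContinuousLinearMap.apply ℝ (Vec n →L[ℝ] ℝ) v ∘L SymBil.toBil
  have h1 := ev.hasFDerivAt.comp e hd
  obtain ⟨L, hL, hL'⟩ := hasFDerivAt_inverse he
  have h2 : ∀ x : Vec n, HasFDerivAt (fun e : Op (Vec n) => Ring.inverse e x)
      (ContinuousLinearMap.apply ℝ (Vec n) x ∘L L) e := fun x =>
    (ContinuousLinearMap.apply ℝ (Vec n) x).hasFDerivAt.comp e hL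
  have h3 := (((etaBil n).hasFDerivAt.comp e (h2 v))).clm_apply (h2 w)
  have h4 : (ev ∘ frameMetric) = fun e : Op (Vec n) =>
      etaBil n (Ring.inverse e v) (Ring.inverse e w) := funext fun e => frameMetric_apply e v w
  rw [h4] at h1
  have h5 := congrArg (fun A : Op (Vec n) →L[ℝ] ℝ => A d) (h1.unique h3)
  refine h5.trans ?_
  simp [hL']
  ring

theorem frameMetric_mul {A A' e : Op (Vec n)} (h : A * A' = 1) (h' : A' * A = 1) (he : IsUnit e) :
    frameMetric (A * e) = symPart (Vec n) (pullB A' (frameMetric e : Bil (Vec n))) := by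
  refine SymBil.ext' fun v w => ?_
  have hs : pullB A' (frameMetric e : Bil (Vec n)) ∈ symSub (Vec n) :=
    fun v w => (frameMetric e).symm (A' v) (A' w)
  rw [symPart_of_sym hs, frameMetric_apply, inverse_mul h h' he, pullB_apply, frameMetric_apply,
    mul_apply_eq_comp, mul_apply_eq_comp]

/-- The connection for which the first jet `(e, e')` of a frame is horizontal. -/
def frameConn (q : Op (Vec n) × (Vec n →L[ℝ] Op (Vec n))) : Op2 (Vec n) :=
  -(preL (Ring.inverse q.1) ∘L q.2)

theorem frameConn_apply (q : Op (Vec n) × (Vec n →L[ℝ] Op (Vec n))) (u v : Vec n) :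
    frameConn q u v = -(q.2 u (Ring.inverse q.1 v)) := rfl

theorem contDiffOn_frameConn : ContDiffOn ℝ ∞ (frameConn (n := n)) {q | IsUnit q.1} := by
  have h1 : ContDiffOn ℝ ∞ (fun q : Op (Vec n) × (Vec n →L[ℝ] Op (Vec n)) => Ring.inverse q.1)
    {q | IsUnit q.1} := contDiffOn_inverse.comp contDiffOn_fst fun q hq => hq
  exact ((contDiff_preL.comp_contDiffOn h1).clm_comp contDiffOn_snd).neg

theorem frameConn_act {A A' : Op (Vec n)} (h : A * A' = 1) (h' : A' * A = 1) (B : Op2 (Vec n))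
    {q : Op (Vec n) × (Vec n →L[ℝ] Op (Vec n))} (hq : IsUnit q.1) :
    frameConn (A * q.1, postL A ∘L q.2 ∘L A' + preL q.1 ∘L B ∘L A') =
      postL A ∘L preL A' ∘L frameConn q ∘L A' - preL A' ∘L B ∘L A' := by
  ext1 u; ext1 v
  rw [frameConn_apply, inverse_mul h h' hq]
  change -(A (q.2 (A' u) (Ring.inverse q.1 (A' v))) +
    B (A' u) (q.1 (Ring.inverse q.1 (A' v)))) =
    A (-(q.2 (A' u) (Ring.inverse q.1 (A' v)))) - B (A' u) (A' v)
  rw [apply_inverse hq, map_neg, neg_add, sub_eq_add_neg]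

/-- The bundle map underlying `pH`. -/
def pHNat (n : ℕ) : NatMap (frameJet (Vec n)) ((connB (Vec n)).prod (metricB (minkowski n))) where
  toFun q := (frameConn q, frameMetric q.1)
  mapsTo hq := ⟨trivial, hasSignature_frameMetric hq⟩
  contDiffOn := contDiffOn_frameConn.prodMk
    (contDiffOn_frameMetric.comp contDiffOn_fst fun _ hq => hq)
  map_act hA hA' _ hq := Prod.ext (frameConn_act hA hA' _ hq) (frameMetric_mul hA hA' hq)

variable {M : Type*} [TopologicalSpace M] [ChartedSpace (Vec n) M] [IsManifold (𝓡 n) ∞ M]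

theorem pHNat_tot : ((pHNat n).tot : FrameJet n M → ConnMetric n M) = pH := rfl

theorem fderiv_pHNat_fst {q : Op (Vec n) × (Vec n →L[ℝ] Op (Vec n))} (hq : IsUnit q.1)
    (d : Op (Vec n) × (Vec n →L[ℝ] Op (Vec n))) (u v : Vec n) :
    (fderiv ℝ (pHNat n).toFun q d).1 u v = -d.2 u (Ring.inverse q.1 v) +
      q.2 u (Ring.inverse q.1 (d.1 (Ring.inverse q.1 v))) := by
  have hd : HasFDerivAt (pHNat n).toFun (fderiv ℝ (pHNat n).toFun q) q :=
    (((pHNat n).contDiffOn.contDiffAt ((frameJet (Vec n)).isOpen_fib.mem_nhds hq)).differentiableAt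
      (by simp)).hasFDerivAt
  let ev : Op2 (Vec n) →L[ℝ] Vec n := ContinuousLinearMap.apply ℝ (Vec n) v ∘L
    ContinuousLinearMap.apply ℝ (Op (Vec n)) u
  have h1 := ev.hasFDerivAt.comp q hd.fst
  obtain ⟨L, hL, hL'⟩ := hasFDerivAt_inverse hq
  have h2 : HasFDerivAt (fun q : Op (Vec n) × (Vec n →L[ℝ] Op (Vec n)) => Ring.inverse q.1 v)
      (ContinuousLinearMap.apply ℝ (Vec n) v ∘L L ∘L ContinuousLinearMap.fst ℝ _ _) q :=
    (ContinuousLinearMap.apply ℝ (Vec n) v).hasFDerivAt.comp q (hL.comp q hasFDerivAt_fst)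
  have h3 : HasFDerivAt (fun q : Op (Vec n) × (Vec n →L[ℝ] Op (Vec n)) => q.2 u)
      (ContinuousLinearMap.apply ℝ (Op (Vec n)) u ∘L ContinuousLinearMap.snd ℝ _ _) q :=
    (ContinuousLinearMap.apply ℝ (Op (Vec n)) u).hasFDerivAt.comp q hasFDerivAt_snd
  have h4 := (h3.clm_apply h2).neg
  have h5 := congrArg (fun A : Op (Vec n) × (Vec n →L[ℝ] Op (Vec n)) →L[ℝ] Vec n => A d)
    (h1.unique h4)
  refine h5.trans ?_
  simp [hL']

theorem fderiv_pHNat_snd {q : Op (Vec n) × (Vec n →L[ℝ] Op (Vec n))} (hq : IsUnit q.1)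
    (d : Op (Vec n) × (Vec n →L[ℝ] Op (Vec n))) :
    (fderiv ℝ (pHNat n).toFun q d).2 = fderiv ℝ frameMetric q.1 d.1 := by
  have hd : HasFDerivAt (pHNat n).toFun (fderiv ℝ (pHNat n).toFun q) q :=
    (((pHNat n).contDiffOn.contDiffAt ((frameJet (Vec n)).isOpen_fib.mem_nhds hq)).differentiableAt
      (by simp)).hasFDerivAt
  have hd' : HasFDerivAt frameMetric (fderiv ℝ frameMetric q.1) q.1 :=
    ((contDiffOn_frameMetric.contDiffAt (Units.isOpen.mem_nhds hq)).differentiableAt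
      (by simp)).hasFDerivAt
  exact congrArg (fun A : Op (Vec n) × (Vec n →L[ℝ] Op (Vec n)) →L[ℝ] SymBil (Vec n) => A d)
    (hd.snd.unique (hd'.comp q hasFDerivAt_fst))

/-- The metricity forms measure the deviation of `dg` from the parallel one. -/
theorem metricity_bil (p : FrameJet n M) (v : FrameJetModel n) (a b : Vec n) :
    ((fderiv ℝ (pHNat n).toFun p.val v.2).2 - parallelJet (pH p).val.1 (pH p).val.2 v.1 :
      SymBil (Vec n)).toBil a b =
      -(etaBil n (omegaV p v (Ring.inverse p.val.1 a)) (Ring.inverse p.val.1 b) +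
        etaBil n (Ring.inverse p.val.1 a) (omegaV p v (Ring.inverse p.val.1 b))) := by
  rw [map_sub]
  change (_ : Bil (Vec n)) a b - (_ : Bil (Vec n)) a b = _
  rw [fderiv_pHNat_snd p.mem, fderiv_frameMetric p.mem, parallelJet_apply]
  change _ - ((frameMetric p.val.1 : Bil (Vec n)) (-(p.val.2 v.1 (Ring.inverse p.val.1 a))) b +
    (frameMetric p.val.1 : Bil (Vec n)) a (-(p.val.2 v.1 (Ring.inverse p.val.1 b)))) = _
  rw [frameMetric_apply, frameMetric_apply]
  change _ = -(etaBil n (Ring.inverse p.val.1 ((v.2.1 - p.val.2 v.1) (Ring.inverse p.val.1 a))) _ +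
    etaBil n _ (Ring.inverse p.val.1 ((v.2.1 - p.val.2 v.1) (Ring.inverse p.val.1 b))))
  simp only [sub_apply, map_sub, map_neg, neg_apply]
  ring

end Frames

section FrameForms

variable {n : ℕ}

/-- The form `θ` in coordinates. -/
def thetaM (y : FrameJetModel n) : FrameJetModel n →L[ℝ] Vec n :=
  Ring.inverse y.2.1 ∘L ContinuousLinearMap.fst ℝ _ _

/-- The form `ω` in coordinates. -/
def omegaM (y : FrameJetModel n) : FrameJetModel n →L[ℝ] Op (Vec n) :=
  postL (Ring.inverse y.2.1) ∘L
    (ContinuousLinearMap.fst ℝ _ _ ∘L ContinuousLinearMap.snd ℝ _ _ -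
      y.2.2 ∘L ContinuousLinearMap.fst ℝ _ _)

theorem thetaM_apply (y v : FrameJetModel n) : thetaM y v = Ring.inverse y.2.1 v.1 := rfl

theorem omegaM_apply (y v : FrameJetModel n) (a : Vec n) :
    omegaM y v a = Ring.inverse y.2.1 (v.2.1 a - y.2.2 v.1 a) := rfl

theorem contDiffOn_inverse_model :
    ContDiffOn ℝ ∞ (fun y : FrameJetModel n => Ring.inverse y.2.1) {y | IsUnit y.2.1} :=
  contDiffOn_inverse.comp (contDiff_fst.comp contDiff_snd).contDiffOn fun _ hy => hy

theorem contDiffOn_thetaM : ContDiffOn ℝ ∞ (thetaM (n := n)) {y | IsUnit y.2.1} :=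
  contDiffOn_inverse_model.clm_comp contDiffOn_const

theorem contDiffOn_omegaM : ContDiffOn ℝ ∞ (omegaM (n := n)) {y | IsUnit y.2.1} :=
  (contDiff_postL.comp_contDiffOn contDiffOn_inverse_model).clm_comp
    (contDiffOn_const.sub ((contDiff_snd.comp contDiff_snd).contDiffOn.clm_comp contDiffOn_const))

theorem isOpen_isUnit_model : IsOpen {y : FrameJetModel n | IsUnit y.2.1} :=
  Units.isOpen.preimage (continuous_fst.comp continuous_snd)

theorem hasFDerivAt_thetaM {y : FrameJetModel n} (hy : IsUnit y.2.1) (v : FrameJetModel n) :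
    ∃ b : FrameJetModel n →L[ℝ] Vec n, HasFDerivAt (fun y => thetaM y v) b y ∧
      ∀ u, b u = -Ring.inverse y.2.1 (u.2.1 (thetaM y v)) := by
  obtain ⟨L, hL, hL'⟩ := hasFDerivAt_inverse hy
  have h1 : HasFDerivAt (fun y : FrameJetModel n => y.2.1)
      (ContinuousLinearMap.fst ℝ _ _ ∘L ContinuousLinearMap.snd ℝ _ _) y :=
    hasFDerivAt_fst.comp y hasFDerivAt_snd
  have h2 := (ContinuousLinearMap.apply ℝ (Vec n) v.1).hasFDerivAt.comp y
    (HasFDerivAt.comp (g := Ring.inverse) y hL h1)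
  refine ⟨_, h2, fun u => ?_⟩
  exact hL' _ _

theorem hasFDerivAt_omegaM {y : FrameJetModel n} (hy : IsUnit y.2.1) (v : FrameJetModel n)
    (a : Vec n) :
    ∃ b : FrameJetModel n →L[ℝ] Vec n, HasFDerivAt (fun y => omegaM y v a) b y ∧
      ∀ u, b u = -Ring.inverse y.2.1 (u.2.1 (omegaM y v a)) -
        Ring.inverse y.2.1 (u.2.2 v.1 a) := by
  obtain ⟨L, hL, hL'⟩ := hasFDerivAt_inverse hy
  have h1 : HasFDerivAt (fun y : FrameJetModel n => y.2.1)
      (ContinuousLinearMap.fst ℝ _ _ ∘L ContinuousLinearMap.snd ℝ _ _) y :=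
    hasFDerivAt_fst.comp y hasFDerivAt_snd
  have h2 : HasFDerivAt (fun y : FrameJetModel n => y.2.2)
      (ContinuousLinearMap.snd ℝ _ _ ∘L ContinuousLinearMap.snd ℝ _ _) y :=
    hasFDerivAt_snd.comp y hasFDerivAt_snd
  have h3 : HasFDerivAt (fun y : FrameJetModel n => v.2.1 a - y.2.2 v.1 a)
      (-(ContinuousLinearMap.apply ℝ (Vec n) a ∘L ContinuousLinearMap.apply ℝ (Op (Vec n)) v.1 ∘L
        ContinuousLinearMap.snd ℝ _ _ ∘L ContinuousLinearMap.snd ℝ _ _)) y :=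
    HasFDerivAt.const_sub ((ContinuousLinearMap.apply ℝ (Vec n) a ∘L
      ContinuousLinearMap.apply ℝ (Op (Vec n)) v.1).hasFDerivAt.comp y h2) _
  have h4 := (HasFDerivAt.comp (g := Ring.inverse) y hL h1).clm_apply h3
  refine ⟨_, h4, fun u => ?_⟩
  have : L u.2.1 (v.2.1 a - y.2.2 v.1 a) = -Ring.inverse y.2.1 (u.2.1 (omegaM y v a)) := hL' _ _
  change Ring.inverse y.2.1 (-(u.2.2 v.1 a)) + L u.2.1 (v.2.1 a - y.2.2 v.1 a) = _
  rw [this, map_neg]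
  abel

variable {M : Type*} [TopologicalSpace M] [ChartedSpace (Vec n) M] [IsManifold (𝓡 n) ∞ M]
variable {c : OpenPartialHomeomorph M (Vec n)} (hc : c ∈ atlas (Vec n) M)

theorem bchart_frame_fst (p : FrameJet n M) :
    ((frameJet (Vec n)).bchart c hc p).2.1 = jac (chartAt (Vec n) p.base) c p.base * p.val.1 := rfl

theorem bchart_frame_snd (p : FrameJet n M) (u a : Vec n) :
    ((frameJet (Vec n)).bchart c hc p).2.2 u a =
      jac (chartAt (Vec n) p.base) c p.base (p.val.2 (jac c (chartAt (Vec n) p.base) p.base u) a) +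
      hess (chartAt (Vec n) p.base) c p.base (jac c (chartAt (Vec n) p.base) p.base u)
        (p.val.1 a) := rfl

theorem jac_apply_jac {p : M} {c c' : OpenPartialHomeomorph M (Vec n)} (hc : c ∈ atlas (Vec n) M)
    (hc' : c' ∈ atlas (Vec n) M) (hp : p ∈ c.source) (hp' : p ∈ c'.source) (u : Vec n) :
    jac c' c p (jac c c' p u) = u := by
  rw [← mul_apply_eq_comp, jac_mul_jac hc hc' hp hp', one_apply_eq_self]

theorem hasFDerivAt_jac (hc : c ∈ atlas (Vec n) M) {p : M} (hp : p ∈ c.source) :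
    HasFDerivAt (fun y => jac (chartAt (Vec n) p) c ((chartAt (Vec n) p).symm y))
      (hess (chartAt (Vec n) p) c p) (chartAt (Vec n) p p) := by
  set k := chartAt (Vec n) p
  have h0 : p ∈ k.source := mem_chart_source _ p
  have h1 : ContDiffAt ℝ ∞ (c ∘ k.symm) (k p) := contDiffAt_change (chart_mem_atlas _ _) hc h0 hp
  have h2 : HasFDerivAt (fderiv ℝ (c ∘ k.symm)) (hess k c p) (k p) :=
    ((h1.fderiv_right (m := 1) (by norm_cast)).differentiableAt (by simp)).hasFDerivAt
  refine h2.congr_of_eventuallyEq ?_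
  filter_upwards [k.open_target.mem_nhds (k.map_source h0)] with y hy
  rw [jac, k.right_inv hy]

theorem tmap_bchart_frame {p : FrameJet n M} (hp : p.base ∈ c.source) (v : FrameJetModel n)
    (a : Vec n) :
    (tmap (FrameJetModel n) (FrameJetModel n) ((frameJet (Vec n)).bchart c hc) p v).2.1 a =
      hess (chartAt (Vec n) p.base) c p.base v.1 (p.val.1 a) +
        jac (chartAt (Vec n) p.base) c p.base (v.2.1 a) := by
  set k := chartAt (Vec n) p.base
  have h1 : HasFDerivAt (fun q : FrameJetModel n => jac k c (k.symm q.1))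
      (hess k c p.base ∘L ContinuousLinearMap.fst ℝ _ _) (k p.base, p.val) :=
    HasFDerivAt.comp (g := fun y => jac k c (k.symm y)) (k p.base, p.val) (hasFDerivAt_jac hc hp)
      hasFDerivAt_fst
  have h2 : HasFDerivAt (fun q : FrameJetModel n => q.2.1 a)
      (ContinuousLinearMap.apply ℝ (Vec n) a ∘L ContinuousLinearMap.fst ℝ _ _ ∘L
        ContinuousLinearMap.snd ℝ _ _) (k p.base, p.val) :=
    (ContinuousLinearMap.apply ℝ (Vec n) a ∘L ContinuousLinearMap.fst ℝ _ _ ∘L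
        ContinuousLinearMap.snd ℝ _ _ : FrameJetModel n →L[ℝ] Vec n).hasFDerivAt
  have h3 := (frameJet (Vec n)).tmap_bchart_snd hc hp
    (ContinuousLinearMap.apply ℝ (Vec n) a ∘L ContinuousLinearMap.fst ℝ _ _)
    (G := fun q => jac k c (k.symm q.1) (q.2.1 a)) (fun q => rfl) (h1.clm_apply h2) v
  refine h3.trans ?_
  change jac k c (k.symm (k p.base)) (v.2.1 a) + hess k c p.base v.1 (p.val.1 a) = _
  rw [k.left_inv (mem_chart_source _ p.base), add_comm]

theorem thetaM_bchart {p : FrameJet n M} (hp : p.base ∈ c.source) (v : FrameJetModel n) :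
    thetaM ((frameJet (Vec n)).bchart c hc p)
      (tmap (FrameJetModel n) (FrameJetModel n) ((frameJet (Vec n)).bchart c hc) p v) =
      thetaV p v := by
  set k := chartAt (Vec n) p.base
  have hk : k ∈ atlas (Vec n) M := chart_mem_atlas _ _
  have hpk : p.base ∈ k.source := mem_chart_source _ _
  rw [thetaM_apply, bchart_frame_fst, inverse_mul (jac_mul_jac hc hk hp hpk)
    (jac_mul_jac hk hc hpk hp) p.mem, NatBundle.tmap_bchart_fst _ hc hp, mul_apply_eq_comp,
    jac_apply_jac hk hc hpk hp]
  rfl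

theorem omegaM_bchart {p : FrameJet n M} (hp : p.base ∈ c.source) (v : FrameJetModel n) :
    omegaM ((frameJet (Vec n)).bchart c hc p)
      (tmap (FrameJetModel n) (FrameJetModel n) ((frameJet (Vec n)).bchart c hc) p v) =
      omegaV p v := by
  set k := chartAt (Vec n) p.base
  have hk : k ∈ atlas (Vec n) M := chart_mem_atlas _ _
  have hpk : p.base ∈ k.source := mem_chart_source _ _
  ext1 a
  rw [omegaM_apply, bchart_frame_fst, inverse_mul (jac_mul_jac hc hk hp hpk)
    (jac_mul_jac hk hc hpk hp) p.mem, NatBundle.tmap_bchart_fst _ hc hp, tmap_bchart_frame hc hp,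
    bchart_frame_snd, mul_apply_eq_comp, jac_apply_jac hk hc hpk hp, map_sub, map_add, map_add,
    jac_apply_jac hk hc hpk hp, jac_apply_jac hk hc hpk hp]
  change _ = Ring.inverse p.val.1 (v.2.1 a - p.val.2 v.1 a)
  congr 1
  abel

/-- `θ^i` in coordinates. -/
def thetaMF (i : Fin n) : DForm (FrameJetModel n) (FrameJetModel n) 1 := fun y =>
  oneForm ((EuclideanSpace.proj i : Vec n →L[ℝ] ℝ) ∘L thetaM y)

/-- `ω^i_j` in coordinates. -/
def omegaMF (i j : Fin n) : DForm (FrameJetModel n) (FrameJetModel n) 1 := fun y =>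
  oneForm ((EuclideanSpace.proj i : Vec n →L[ℝ] ℝ) ∘L
    ContinuousLinearMap.apply ℝ (Vec n) (ε j : Vec n) ∘L omegaM y)

theorem thetaF_eq_pullback (i : Fin n) {p : FrameJet n M} (hp : p.base ∈ c.source) :
    thetaF i p = pullback ((frameJet (Vec n)).bchart c hc) (thetaMF i) p := by
  ext v
  exact congrArg (fun x : Vec n => x i) (thetaM_bchart hc hp (v 0)).symm

theorem omegaF_eq_pullback (i j : Fin n) {p : FrameJet n M} (hp : p.base ∈ c.source) :
    omegaF i j p = pullback ((frameJet (Vec n)).bchart c hc) (omegaMF i j) p := by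
  ext v
  exact congrArg (fun x : Op (Vec n) => x (ε j) i) (omegaM_bchart hc hp (v 0)).symm

theorem formSmoothAt_of_contDiffOn {E : Type*} [NormedAddCommGroup E] [NormedSpace ℝ E]
    [FiniteDimensional ℝ E] {k : ℕ} {α : DForm E E k} {U : Set E} (hU : IsOpen U)
    (h : ContDiffOn ℝ ∞ α U) {x : E} (hx : x ∈ U) : FormSmoothAt α x := by
  refine formSmoothAt_of_chart (c := OpenPartialHomeomorph.refl E) (by simp) (by simp) ?_
  filter_upwards [hU.mem_nhds hx] with y hy
  have : inChart (OpenPartialHomeomorph.refl E) α = α := by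
    funext z
    change (α z).compContinuousLinearMap (tmap E E (fun x : E => x) z) = _
    rw [tmap_id]; rfl
  rw [this]
  exact h.contDiffAt (hU.mem_nhds hy)

theorem contDiff_oneForm {E : Type*} [NormedAddCommGroup E] [NormedSpace ℝ E] :
    ContDiff ℝ ∞ (oneForm : (E →L[ℝ] ℝ) → _) :=
  (ContinuousAlternatingMap.ofSubsingletonLIE (𝕜 := ℝ) (E := E) (F := ℝ) (0 : Fin 1)).contDiff

theorem contDiffOn_thetaMF (i : Fin n) : ContDiffOn ℝ ∞ (thetaMF (n := n) i) {y | IsUnit y.2.1} :=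
  contDiff_oneForm.comp_contDiffOn (contDiffOn_const.clm_comp contDiffOn_thetaM)

theorem contDiffOn_omegaMF (i j : Fin n) :
    ContDiffOn ℝ ∞ (omegaMF (n := n) i j) {y | IsUnit y.2.1} :=
  contDiff_oneForm.comp_contDiffOn
    (contDiffOn_const.clm_comp (contDiffOn_const.clm_comp contDiffOn_omegaM))

theorem isUnit_bchart {p : FrameJet n M} (hp : p.base ∈ c.source) :
    IsUnit ((frameJet (Vec n)).bchart c hc p).2.1 := (frameJet (Vec n)).bchart_snd_mem hc hp

theorem isSmoothForm_thetaF (i : Fin n) :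
    IsSmoothForm (thetaF i : DForm (FrameJetModel n) (FrameJet n M) 1) := by
  refine isSmoothForm_iff.2 fun p => ?_
  have hc := chart_mem_atlas (Vec n) p.base
  have hp := mem_chart_source (Vec n) p.base
  refine FormSmoothAt.congr (FormSmoothAt.pullback (formSmoothAt_of_contDiffOn isOpen_isUnit_model
    (contDiffOn_thetaMF i) (isUnit_bchart hc hp)) (mapSmoothAt_chart
      ((frameJet (Vec n)).bchart_mem_atlas hc) hp)) ?_
  filter_upwards [((frameJet (Vec n)).bchart _ hc).open_source.mem_nhds hp] with q hq
  exact thetaF_eq_pullback hc i hq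

theorem isSmoothForm_omegaF (i j : Fin n) :
    IsSmoothForm (omegaF i j : DForm (FrameJetModel n) (FrameJet n M) 1) := by
  refine isSmoothForm_iff.2 fun p => ?_
  have hc := chart_mem_atlas (Vec n) p.base
  have hp := mem_chart_source (Vec n) p.base
  refine FormSmoothAt.congr (FormSmoothAt.pullback (formSmoothAt_of_contDiffOn isOpen_isUnit_model
    (contDiffOn_omegaMF i j) (isUnit_bchart hc hp)) (mapSmoothAt_chart
      ((frameJet (Vec n)).bchart_mem_atlas hc) hp)) ?_
  filter_upwards [((frameJet (Vec n)).bchart _ hc).open_source.mem_nhds hp] with q hq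
  exact omegaF_eq_pullback hc i j hq

/-- The exterior derivative of a form given by a coordinate expression. -/
theorem extD_of_chartAt {E : Type*} [NormedAddCommGroup E] [NormedSpace ℝ E]
    [FiniteDimensional ℝ E] {N : Type*} [TopologicalSpace N] [ChartedSpace E N]
    [IsManifold 𝓘(ℝ, E) ∞ N] {k : ℕ} {α : DForm E N k} {β : DForm E E k} {x : N}
    (h : α =ᶠ[𝓝 x] pullback (chartAt E x) β) (hβ : FormSmoothAt β (chartAt E x x)) :
    extD α x = extDeriv β (chartAt E x x) := by
  rw [extD_congr h, extD_pullback (mapSmoothAt_chart (chart_mem_atlas E x) (mem_chart_source E x))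
    hβ, pullback_apply, extD_eq_extDeriv, tmap_chartAt_self]
  rfl

theorem extD_of_bchart {k : ℕ} {α : DForm (FrameJetModel n) (FrameJet n M) k}
    {β : DForm (FrameJetModel n) (FrameJetModel n) k} (hβ : ContDiffOn ℝ ∞ β {y | IsUnit y.2.1})
    (p : FrameJet n M) (h : ∀ q : FrameJet n M, q.base ∈ (chartAt (Vec n) p.base).source → α q =
      pullback ((frameJet (Vec n)).bchart _ (chart_mem_atlas (Vec n) p.base)) β q) :
    extD α p = extDeriv β (chartAt (Vec n) p.base p.base, p.val) := by
  have hc := chart_mem_atlas (Vec n) p.base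
  have hp := mem_chart_source (Vec n) p.base
  rw [← (frameJet (Vec n)).chartAt_self p]
  refine extD_of_chartAt ?_
    (formSmoothAt_of_contDiffOn isOpen_isUnit_model hβ (isUnit_bchart hc hp))
  filter_upwards [((frameJet (Vec n)).bchart _ hc).open_source.mem_nhds hp] with q hq using h q hq

theorem differentiableAt_thetaM (i : Fin n) {y : FrameJetModel n} (hy : IsUnit y.2.1) :
    DifferentiableAt ℝ (fun y => (EuclideanSpace.proj i : Vec n →L[ℝ] ℝ) ∘L thetaM y) y :=
  ((contDiffOn_const.clm_comp contDiffOn_thetaM).contDiffAt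
    (isOpen_isUnit_model.mem_nhds hy)).differentiableAt (by simp)

theorem extD_thetaF (i : Fin n) (p : FrameJet n M) (v : Fin 2 → FrameJetModel n) :
    extD (thetaF i) p v = (Ring.inverse p.val.1 ((v 1).2.1 (thetaV p (v 0))) -
      Ring.inverse p.val.1 ((v 0).2.1 (thetaV p (v 1)))) i := by
  set y : FrameJetModel n := (chartAt (Vec n) p.base p.base, p.val)
  have hy : IsUnit y.2.1 := p.mem
  rw [extD_of_bchart (contDiffOn_thetaMF i) p fun q hq => thetaF_eq_pullback _ i hq]
  choose b hb hb' using hasFDerivAt_thetaM hy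
  refine (extDeriv_oneForm (differentiableAt_thetaM i hy)
    (fun w => (EuclideanSpace.proj i : Vec n →L[ℝ] ℝ).hasFDerivAt.comp y (hb w)) v).trans ?_
  change (b (v 1) (v 0)) i - (b (v 0) (v 1)) i = _
  rw [hb', hb']
  change (-(Ring.inverse p.val.1 ((v 0).2.1 (thetaV p (v 1))))) i -
    (-(Ring.inverse p.val.1 ((v 1).2.1 (thetaV p (v 0))))) i = _
  simp only [PiLp.neg_apply, PiLp.sub_apply]
  ring

theorem extD_omegaF (i j : Fin n) (p : FrameJet n M) (v : Fin 2 → FrameJetModel n) :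
    extD (omegaF i j) p v = (Ring.inverse p.val.1 ((v 1).2.1 (omegaV p (v 0) (ε j)) +
        (v 1).2.2 (v 0).1 (ε j) - (v 0).2.1 (omegaV p (v 1) (ε j)) -
        (v 0).2.2 (v 1).1 (ε j))) i := by
  set y : FrameJetModel n := (chartAt (Vec n) p.base p.base, p.val)
  have hy : IsUnit y.2.1 := p.mem
  rw [extD_of_bchart (contDiffOn_omegaMF i j) p fun q hq => omegaF_eq_pullback _ i j hq]
  choose b hb hb' using fun w => hasFDerivAt_omegaM hy w (ε j)
  have hd : DifferentiableAt ℝ (fun y => (EuclideanSpace.proj i : Vec n →L[ℝ] ℝ) ∘L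
    ContinuousLinearMap.apply ℝ (Vec n) (ε j : Vec n) ∘L omegaM y) y :=
    ((contDiffOn_const.clm_comp (contDiffOn_const.clm_comp contDiffOn_omegaM)).contDiffAt
      (isOpen_isUnit_model.mem_nhds hy)).differentiableAt (by simp)
  refine (extDeriv_oneForm hd
    (fun w => (EuclideanSpace.proj i : Vec n →L[ℝ] ℝ).hasFDerivAt.comp y (hb w)) v).trans ?_
  change (b (v 1) (v 0)) i - (b (v 0) (v 1)) i = _
  rw [hb', hb']
  change (-(Ring.inverse p.val.1 ((v 0).2.1 (omegaV p (v 1) (ε j)))) -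
      Ring.inverse p.val.1 ((v 0).2.2 (v 1).1 (ε j))) i -
    (-(Ring.inverse p.val.1 ((v 1).2.1 (omegaV p (v 0) (ε j)))) -
      Ring.inverse p.val.1 ((v 1).2.2 (v 0).1 (ε j))) i = _
  simp only [PiLp.neg_apply, PiLp.sub_apply, map_sub, map_add, PiLp.add_apply]
  ring

theorem sum_apply_ε (A : Op (Vec n)) (x : Vec n) (i : Fin n) : ∑ k, A (ε k) i * x k = A x i := by
  have h : x = ∑ k, x k • (ε k : Vec n) := by
    ext j; simp [Finset.sum_apply, Pi.single_apply]
  conv_rhs => rw [h, map_sum]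
  simp [mul_comm]

theorem torsion_apply (i : Fin n) (p : FrameJet n M) (v : Fin 2 → FrameJetModel n) :
    torsion i p v = Ring.inverse p.val.1 ((pH p).val.1 (v 0).1 (v 1).1 -
      (pH p).val.1 (v 1).1 (v 0).1) i := by
  have h1 : torsion i p v = extD (thetaF i) p v +
      ∑ k, wedgeAlt (omegaF i k p) (thetaF k p) v := by
    simp [torsion, wedge, Finset.sum_apply]
  have h2 : ∀ k, wedgeAlt (omegaF i k p) (thetaF k p) v = omegaV p (v 0) (ε k) i * thetaV p (v 1) k -
      omegaV p (v 1) (ε k) i * thetaV p (v 0) k := fun k => wedgeAlt_oneForm _ _ v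
  rw [h1, extD_thetaF]
  simp only [h2, Finset.sum_sub_distrib, sum_apply_ε]
  change _ + (Ring.inverse p.val.1 ((v 0).2.1 _ - p.val.2 (v 0).1 _) i -
    Ring.inverse p.val.1 ((v 1).2.1 _ - p.val.2 (v 1).1 _) i) =
    Ring.inverse p.val.1 (-(p.val.2 (v 0).1 (thetaV p (v 1))) -
      -(p.val.2 (v 1).1 (thetaV p (v 0)))) i
  simp only [map_sub, map_neg, PiLp.neg_apply, PiLp.sub_apply]
  ring

/-- The curvature of a connection with derivatives `δ₀`, `δ₁` in the directions `x₀`, `x₁`. -/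
def curv (Γ : Op2 (Vec n)) (x₀ x₁ : Vec n) (δ₀ δ₁ : Op2 (Vec n)) : Op (Vec n) :=
  δ₀ x₁ - δ₁ x₀ + Γ x₀ * Γ x₁ - Γ x₁ * Γ x₀

theorem curvature_apply (i j : Fin n) (p : FrameJet n M) (v : Fin 2 → FrameJetModel n) :
    curvature i j p v = Ring.inverse p.val.1 (curv (pH p).val.1 (v 0).1 (v 1).1
      (fderiv ℝ (pHNat n).toFun p.val (v 0).2).1 (fderiv ℝ (pHNat n).toFun p.val (v 1).2).1
      (p.val.1 (ε j))) i := by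
  have h1 : curvature i j p v = extD (omegaF i j) p v +
      ∑ k, wedgeAlt (omegaF i k p) (omegaF k j p) v := by
    simp [curvature, wedge, Finset.sum_apply]
  have h2 : ∀ k, wedgeAlt (omegaF i k p) (omegaF k j p) v =
      omegaV p (v 0) (ε k) i * omegaV p (v 1) (ε j) k -
      omegaV p (v 1) (ε k) i * omegaV p (v 0) (ε j) k := fun k => wedgeAlt_oneForm _ _ v
  rw [h1, extD_omegaF]
  simp only [h2, Finset.sum_sub_distrib, sum_apply_ε]
  have e1 : ∀ u a, (pH p).val.1 u a = -(p.val.2 u (Ring.inverse p.val.1 a)) := fun _ _ => rfl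
  have e2 : ∀ u a, omegaV p u a = Ring.inverse p.val.1 (u.2.1 a - p.val.2 u.1 a) := fun _ _ => rfl
  simp only [curv, add_apply, sub_apply, mul_apply_eq_comp, fderiv_pHNat_fst p.mem,
    inverse_apply p.mem, e1, e2]
  simp only [map_sub, map_add, map_neg, PiLp.neg_apply, PiLp.sub_apply, PiLp.add_apply]
  ring

end FrameForms

section Metricity

variable {n : ℕ} {M : Type*} [TopologicalSpace M] [ChartedSpace (Vec n) M] [IsManifold (𝓡 n) ∞ M]

theorem metricity_apply (i j : Fin n) (p : FrameJet n M) (v : FrameJetModel n) :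
    metricity i j p (fun _ => v) =
      eta i * omegaV p v (ε i) j + eta j * omegaV p v (ε j) i := rfl

theorem isSmoothForm_metricity (i j : Fin n) :
    IsSmoothForm (metricity i j : DForm (FrameJetModel n) (FrameJet n M) 1) := by
  refine isSmoothForm_iff.2 fun p => ?_
  have h : ∀ i j : Fin n, FormSmoothAt (omegaF i j : DForm (FrameJetModel n) (FrameJet n M) 1) p :=
    fun i j => isSmoothForm_iff.1 (isSmoothForm_omegaF i j) p
  have h1 : ∀ r : ℝ, MapSmoothAt (FrameJetModel n) ℝ (fun _ : FrameJet n M => r) p := fun r =>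
    ContMDiff.mapSmoothAt contMDiff_const p
  exact ((h j i).smul (h1 (eta i))).add ((h i j).smul (h1 (eta j)))

theorem isSmoothForm_torsion (i : Fin n) :
    IsSmoothForm (torsion i : DForm (FrameJetModel n) (FrameJet n M) 2) := by
  refine isSmoothForm_iff.2 fun p => ?_
  refine (isSmoothForm_iff.1 (isSmoothForm_thetaF i) p).extD.add (FormSmoothAt.sum fun k _ => ?_)
  exact (isSmoothForm_iff.1 (isSmoothForm_omegaF i k) p).wedge
    (isSmoothForm_iff.1 (isSmoothForm_thetaF k) p)

theorem isSmoothForm_curvature (i j : Fin n) :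
    IsSmoothForm (curvature i j : DForm (FrameJetModel n) (FrameJet n M) 2) := by
  refine isSmoothForm_iff.2 fun p => ?_
  refine (isSmoothForm_iff.1 (isSmoothForm_omegaF i j) p).extD.add (FormSmoothAt.sum fun k _ => ?_)
  exact (isSmoothForm_iff.1 (isSmoothForm_omegaF i k) p).wedge
    (isSmoothForm_iff.1 (isSmoothForm_omegaF k j) p)

variable (n M) in
/-- The generators of the exterior differential system `palatiniEDS`. -/
theorem palatiniEDS_generators_smooth :
    ∀ a ∈ ({a | ∃ i j : Fin n, a = ⟨1, metricity i j⟩} ∪ {a | ∃ i : Fin n, a = ⟨2, torsion i⟩} :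
      FormSet (FrameJetModel n) (FrameJet n M)), IsSmoothForm a.2 := by
  rintro _ (⟨i, j, rfl⟩ | ⟨i, rfl⟩)
  · exact isSmoothForm_metricity i j
  · exact isSmoothForm_torsion i

theorem metricity_mem (i j : Fin n) :
    (⟨1, metricity i j⟩ : Σ k : ℕ, DForm (FrameJetModel n) (FrameJet n M) k) ∈ palatiniEDS n M :=
  diffIdeal.of _ (Or.inl ⟨i, j, rfl⟩)

theorem torsion_mem (i : Fin n) :
    (⟨2, torsion i⟩ : Σ k : ℕ, DForm (FrameJetModel n) (FrameJet n M) k) ∈ palatiniEDS n M :=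
  diffIdeal.of _ (Or.inr ⟨i, rfl⟩)

/-- A dual family for the metricity forms. -/
def dualOp (i j : Fin n) : Op (Vec n) :=
  (eta i / 2) • (EuclideanSpace.proj i : Vec n →L[ℝ] ℝ).smulRight (ε j : Vec n)

theorem eta_mul_self (i : Fin n) : eta i * eta i = 1 := by
  unfold eta; split_ifs <;> norm_num

/-- The vertical vector `e b` at the frame `e`. -/
def vertFrame (b : Op (Vec n)) (y : Op (Vec n) × (Vec n →L[ℝ] Op (Vec n))) : FrameJetModel n :=
  (0, (y.1 ∘L b, 0))

theorem omegaM_vertFrame (b : Op (Vec n)) {y : FrameJetModel n} (hy : IsUnit y.2.1) :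
    omegaM y (vertFrame b y.2) = b := by
  ext1 a
  change Ring.inverse y.2.1 (y.2.1 (b a) - y.2.2 0 a) = _
  rw [map_zero, zero_apply, sub_zero, inverse_apply hy]

theorem omegaV_vertFrame (b : Op (Vec n)) (p : FrameJet n M) :
    omegaV p (vertFrame b p.val) = b := by
  ext1 a
  change Ring.inverse p.val.1 (p.val.1 (b a) - p.val.2 0 a) = _
  rw [map_zero, zero_apply, sub_zero, inverse_apply p.mem]

theorem sum_metricity_dualOp (m : Fin n → Fin n → ℝ) (hm : ∀ i j, m i j = m j i) (k l : Fin n) :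
    ∑ i, ∑ j, m i j * (eta k * dualOp i j (ε k) l + eta l * dualOp i j (ε l) k) = m k l := by
  have h : ∀ i j, m i j * (eta k * dualOp i j (ε k) l + eta l * dualOp i j (ε l) k) =
      (if i = k then (if j = l then m i j / 2 else 0) else 0) +
      (if i = l then (if j = k then m i j / 2 else 0) else 0) := by
    intro i j
    have h1 : ∀ k l : Fin n, eta k * dualOp i j (ε k) l =
        if i = k then (if j = l then 1 / 2 else 0) else 0 := by
      intro k l
      simp only [dualOp, smul_apply, ContinuousLinearMap.smulRight_apply, PiLp.smul_apply,
        PiLp.proj_apply, PiLp.single_apply, smul_eq_mul]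
      by_cases h : i = k
      · subst h
        by_cases h' : j = l
        · subst h'
          simp
          linear_combination (1 / 2 : ℝ) * eta_mul_self i
        · simp [h', Ne.symm h']
      · simp [h]
    rw [h1, h1]
    split_ifs <;> ring
  have h2 : ∀ k l : Fin n,
      ∑ i, ∑ j, (if i = k then (if j = l then m i j / 2 else 0) else 0) = m k l / 2 := by
    intro k l
    rw [Finset.sum_eq_single k (fun i _ hi => by simp [hi]) (by simp)]
    simp
  simp only [h, Finset.sum_add_distrib, h2]
  rw [hm l k]; ring

theorem metricity_symm (i j : Fin n) (p : FrameJet n M) (v : FrameJetModel n) :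
    metricity i j p (fun _ => v) = metricity j i p (fun _ => v) := by
  rw [metricity_apply, metricity_apply, add_comm]

theorem oneForm_const_apply {E : Type*} [NormedAddCommGroup E] [NormedSpace ℝ E]
    (α : E [⋀^Fin 1]→L[ℝ] ℝ) (v : Fin 1 → E) : α v = α fun _ => v 0 := by
  congr 1; funext i; rw [Subsingleton.elim i 0]

/-- A 1-form as a linear map. -/
def ofOneForm {E : Type*} [NormedAddCommGroup E] [NormedSpace ℝ E]
    (α : E [⋀^Fin 1]→L[ℝ] ℝ) : E →L[ℝ] ℝ :=
  (ContinuousAlternatingMap.ofSubsingleton ℝ E ℝ (0 : Fin 1)).symm α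

theorem ofOneForm_apply {E : Type*} [NormedAddCommGroup E] [NormedSpace ℝ E]
    (α : E [⋀^Fin 1]→L[ℝ] ℝ) (v : E) : ofOneForm α v = α fun _ => v := rfl

/-- A smooth 1-form which vanishes where the metricity forms do is a combination of them. -/
theorem mem_palatiniEDS_of_metricity [T2Space M] {β : DForm (FrameJetModel n) (FrameJet n M) 1}
    (hβ : IsSmoothForm β) (h : ∀ p v, (∀ i j, metricity i j p (fun _ => v) = 0) →
      β p (fun _ => v) = 0) :
    (⟨1, β⟩ : Σ k : ℕ, DForm (FrameJetModel n) (FrameJet n M) k) ∈ palatiniEDS n M := by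
  have hω : ∀ p u v, omegaV p u = omegaV p v → β p (fun _ => u) = β p (fun _ => v) := by
    intro p u v huv
    have := h p (u - v) fun i j => by
      rw [metricity_apply, map_sub, huv, sub_self]; simp
    rw [← ofOneForm_apply, map_sub, sub_eq_zero] at this
    exact this
  let f : Fin n → Fin n → FrameJet n M → ℝ := fun i j p =>
    β p fun _ => vertFrame (dualOp i j) p.val
  have hf : ∀ i j p, MapSmoothAt (FrameJetModel n) ℝ (f i j) p := by
    intro i j p
    set c := chartAt (Vec n) p.base
    have hc : c ∈ atlas (Vec n) M := chart_mem_atlas _ _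
    have hp : p.base ∈ c.source := mem_chart_source _ _
    set b := (frameJet (Vec n)).bchart c hc
    have hb := (frameJet (Vec n)).bchart_mem_atlas hc
    have h1 : ContDiffOn ℝ ∞ (fun y : FrameJetModel n =>
        inChart b β y fun _ => vertFrame (dualOp i j) y.2) b.target := by
      intro y hy
      refine ContDiffAt.contDiffWithinAt (ContDiffAt.alternating_apply
        ((hβ b hb).contDiffAt (b.open_target.mem_nhds hy)) fun _ => ?_)
      refine ContDiff.contDiffAt ?_
      exact contDiff_const.prodMk ((((contDiff_fst.comp contDiff_snd).clm_comp
        contDiff_const)).prodMk contDiff_const)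
    have h2 := (mapSmoothAt_of_contDiffOn b.open_target h1 (b.map_source hp)).comp
      (mapSmoothAt_chart hb (x := p) hp)
    refine h2.congr ?_
    filter_upwards [b.open_source.mem_nhds hp] with q hq
    have e1 : b.symm (b q) = q := b.left_inv hq
    change _ = β (b.symm (b q)) fun _ =>
      tmap (FrameJetModel n) (FrameJetModel n) b.symm (b q) (vertFrame (dualOp i j) (b q).2)
    rw [e1]
    refine hω q _ _ ?_
    rw [omegaV_vertFrame, ← omegaM_bchart hc hq]
    have := tmap_tmap_symm hb (b.map_source hq) (vertFrame (dualOp i j) (b q).2)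
    rw [e1] at this
    rw [this, omegaM_vertFrame _ (isUnit_bchart hc hq)]
  have key : β = ∑ i, ∑ j, fun p => f i j p • metricity i j p := by
    funext p
    ext v
    rw [oneForm_const_apply (β p), Finset.sum_apply, ContinuousAlternatingMap.sum_apply]
    simp only [Finset.sum_apply, ContinuousAlternatingMap.sum_apply,
      ContinuousAlternatingMap.smul_apply, smul_eq_mul]
    generalize hw : v 0 = w
    have e2 : ∀ i j, metricity i j p v = metricity i j p fun _ => w := fun i j => by
      rw [oneForm_const_apply, hw]
    simp only [e2]
    have h3 := h p (w - ∑ i, ∑ j, metricity i j p (fun _ => w) • vertFrame (dualOp i j) p.val) ?_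
    · rw [← ofOneForm_apply, map_sub, sub_eq_zero, map_sum] at h3
      refine h3.trans ?_
      simp only [map_sum, map_smul, smul_eq_mul, ofOneForm_apply]
      exact Finset.sum_congr rfl fun i _ => Finset.sum_congr rfl fun j _ => mul_comm _ _
    · intro k l
      have e3 := sum_metricity_dualOp (fun i j => metricity i j p (fun _ => w))
        (fun i j => metricity_symm i j p w) k l
      rw [← ofOneForm_apply, map_sub, sub_eq_zero, map_sum]
      refine e3.symm.trans (Finset.sum_congr rfl fun i _ => ?_)
      rw [map_sum]
      refine Finset.sum_congr rfl fun j _ => ?_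
      rw [map_smul, ofOneForm_apply, metricity_apply k l, omegaV_vertFrame, smul_eq_mul]
  refine mem_diffIdeal_of_locallyIn fun p => ?_
  rw [key]
  exact LocallyIn.sum fun i _ => LocallyIn.sum fun j _ =>
    (LocallyIn.of_mem (metricity_mem i j)).smul (hf i j p)

end Metricity

theorem pullback_apply_vec {E' E : Type*} [NormedAddCommGroup E'] [NormedSpace ℝ E']
    [NormedAddCommGroup E] [NormedSpace ℝ E] {N' N : Type*} [TopologicalSpace N']
    [ChartedSpace E' N'] [TopologicalSpace N] [ChartedSpace E N] {k : ℕ} (f : N' → N)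
    (α : DForm E N k) (x : N') (v : Fin k → E') :
    (pullback f α : DForm E' N' k) x v = α (f x) fun i => tmap E' E f x (v i) := rfl

theorem sum_clm_ε {n : ℕ} (F : Vec n →L[ℝ] ℝ) (x : Vec n) : ∑ k, F (ε k) * x k = F x := by
  have h : x = ∑ k, x k • (ε k : Vec n) := by
    ext j; simp [Finset.sum_apply, Pi.single_apply]
  conv_rhs => rw [h, map_sum]
  simp [mul_comm]

section Contact

variable {n : ℕ} {M : Type*} [TopologicalSpace M] [ChartedSpace (Vec n) M] [IsManifold (𝓡 n) ∞ M]

/-- The form `dg - h dx` in coordinates. -/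
def contactM (y : MetricJetModel n) : MetricJetModel n →L[ℝ] SymBil (Vec n) :=
  ContinuousLinearMap.fst ℝ _ _ ∘L ContinuousLinearMap.snd ℝ _ _ -
    y.2.2 ∘L ContinuousLinearMap.fst ℝ _ _

theorem contactM_apply (y v : MetricJetModel n) : contactM y v = v.2.1 - y.2.2 v.1 := rfl

theorem contDiff_contactM : ContDiff ℝ ∞ (contactM (n := n)) :=
  contDiff_const.sub ((contDiff_snd.comp contDiff_snd).clm_comp contDiff_const)

variable {c : OpenPartialHomeomorph M (Vec n)}

theorem hasFDerivAt_jac_inv (hc : c ∈ atlas (Vec n) M) {p : M} (hp : p ∈ c.source) (a : Vec n) :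
    ∃ L : Vec n →L[ℝ] Vec n,
      HasFDerivAt (fun y => jac c (chartAt (Vec n) p) ((chartAt (Vec n) p).symm y) a) L
        (chartAt (Vec n) p p) ∧ ∀ u, L u = -jac c (chartAt (Vec n) p) p
          (hess (chartAt (Vec n) p) c p u (jac c (chartAt (Vec n) p) p a)) := by
  set k := chartAt (Vec n) p
  have hk : k ∈ atlas (Vec n) M := chart_mem_atlas _ _
  have hpk : p ∈ k.source := mem_chart_source _ _
  have hinv : ∀ {q : M}, q ∈ c.source → q ∈ k.source → Ring.inverse (jac k c q) = jac c k q :=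
    fun h h' => inverse_eq_of_mul (jac_mul_jac hc hk h h') (jac_mul_jac hk hc h' h)
  have hu : IsUnit (jac k c p) :=
    ⟨⟨_, _, jac_mul_jac hc hk hp hpk, jac_mul_jac hk hc hpk hp⟩, rfl⟩
  obtain ⟨L, hL, hL'⟩ := hasFDerivAt_inverse hu
  have hL2 : HasFDerivAt Ring.inverse L (jac k c (k.symm (k p))) := by rwa [k.left_inv hpk]
  have h1 := (ContinuousLinearMap.apply ℝ (Vec n) a).hasFDerivAt.comp (k p)
    (HasFDerivAt.comp (g := Ring.inverse) (k p) hL2 (hasFDerivAt_jac hc hp))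
  refine ⟨_, h1.congr_of_eventuallyEq ?_, fun u => ?_⟩
  · filter_upwards [eventually_chart_symm hpk (c.open_source.mem_nhds hp)] with y hy
    change _ = Ring.inverse (jac k c (k.symm y)) a
    rw [hinv hy.2 (k.map_target hy.1)]
  · refine (hL' _ _).trans ?_
    rw [hinv hp hpk]
    rfl

theorem tmap_bchart_metric (hc : c ∈ atlas (Vec n) M) {p : MetricJet n M} (hp : p.base ∈ c.source)
    (v : MetricJetModel n) (a b : Vec n) :
    ((tmap (MetricJetModel n) (MetricJetModel n)
        ((metricJet (minkowski n)).bchart c hc) p v).2.1 : Bil (Vec n)) a b =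
      (v.2.1 : Bil (Vec n)) (jac c (chartAt (Vec n) p.base) p.base a)
        (jac c (chartAt (Vec n) p.base) p.base b) -
      (p.val.1 : Bil (Vec n)) (jac c (chartAt (Vec n) p.base) p.base
          (hess (chartAt (Vec n) p.base) c p.base v.1 (jac c (chartAt (Vec n) p.base) p.base a)))
        (jac c (chartAt (Vec n) p.base) p.base b) -
      (p.val.1 : Bil (Vec n)) (jac c (chartAt (Vec n) p.base) p.base a)
        (jac c (chartAt (Vec n) p.base) p.base
          (hess (chartAt (Vec n) p.base) c p.base v.1
            (jac c (chartAt (Vec n) p.base) p.base b))) := by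
  set k := chartAt (Vec n) p.base
  have hpk : p.base ∈ k.source := mem_chart_source _ _
  have hj : ∀ a : Vec n, ∃ L : MetricJetModel n →L[ℝ] Vec n,
      HasFDerivAt (fun q : MetricJetModel n => jac c k (k.symm q.1) a) L (k p.base, p.val) ∧
      ∀ v, L v = -jac c k p.base (hess k c p.base v.1 (jac c k p.base a)) := by
    intro a
    obtain ⟨L, hL, hL'⟩ := hasFDerivAt_jac_inv hc hp a
    exact ⟨_, HasFDerivAt.comp (g := fun y => jac c k (k.symm y) a) (k p.base, p.val) hL
      hasFDerivAt_fst, fun v => hL' v.1⟩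
  obtain ⟨La, hLa, hLa'⟩ := hj a
  obtain ⟨Lb, hLb, hLb'⟩ := hj b
  have h1 : HasFDerivAt (fun q : MetricJetModel n => (q.2.1 : Bil (Vec n)))
      (SymBil.toBil ∘L ContinuousLinearMap.fst ℝ _ _ ∘L ContinuousLinearMap.snd ℝ _ _)
      (k p.base, p.val) :=
    (SymBil.toBil ∘L ContinuousLinearMap.fst ℝ _ _ ∘L ContinuousLinearMap.snd ℝ _ _ :
      MetricJetModel n →L[ℝ] Bil (Vec n)).hasFDerivAt
  have h2 := (h1.clm_apply hLa).clm_apply hLb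
  let ℓ : SymBil (Vec n) × (Vec n →L[ℝ] SymBil (Vec n)) →L[ℝ] ℝ :=
    ContinuousLinearMap.apply ℝ ℝ b ∘L ContinuousLinearMap.apply ℝ (Vec n →L[ℝ] ℝ) a ∘L
      SymBil.toBil ∘L ContinuousLinearMap.fst ℝ _ _
  have h3 := (metricJet (minkowski n)).tmap_bchart_snd hc hp ℓ
    (G := fun q => (q.2.1 : Bil (Vec n)) (jac c k (k.symm q.1) a) (jac c k (k.symm q.1) b))
    (fun q => ?_) h2 v
  · refine h3.trans ?_
    change (p.val.1 : Bil (Vec n)) (jac c k (k.symm (k p.base)) a) (Lb v) +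
      ((p.val.1 : Bil (Vec n)) (La v) + (v.2.1 : Bil (Vec n)) (jac c k (k.symm (k p.base)) a))
        (jac c k (k.symm (k p.base)) b) = _
    rw [k.left_inv hpk, hLa', hLb', map_neg, map_neg, add_apply, neg_apply]
    ring
  · change (symPart (Vec n) (pullB (jac c k (k.symm q.1)) (q.2.1 : Bil (Vec n))) : Bil (Vec n)) a b = _
    have hs : pullB (jac c k (k.symm q.1)) (q.2.1 : Bil (Vec n)) ∈ symSub (Vec n) :=
      fun v w => q.2.1.symm (jac c k (k.symm q.1) v) (jac c k (k.symm q.1) w)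
    rw [symPart_of_sym hs, pullB_apply]

theorem contactM_bchart (hc : c ∈ atlas (Vec n) M) {p : MetricJet n M} (hp : p.base ∈ c.source)
    (v : MetricJetModel n) :
    contactM ((metricJet (minkowski n)).bchart c hc p) (tmap (MetricJetModel n) (MetricJetModel n)
        ((metricJet (minkowski n)).bchart c hc) p v) =
      symPart (Vec n) (pullB (jac c (chartAt (Vec n) p.base) p.base)
        ((v.2.1 - p.val.2 v.1 : SymBil (Vec n)) : Bil (Vec n))) := by
  set k := chartAt (Vec n) p.base
  have hk : k ∈ atlas (Vec n) M := chart_mem_atlas _ _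
  have hpk : p.base ∈ k.source := mem_chart_source _ _
  refine SymBil.ext' fun a b => ?_
  have hs : pullB (jac c k p.base) ((v.2.1 - p.val.2 v.1 : SymBil (Vec n)) : Bil (Vec n)) ∈
      symSub (Vec n) := fun x y =>
    (v.2.1 - p.val.2 v.1).symm (jac c k p.base x) (jac c k p.base y)
  rw [symPart_of_sym hs, pullB_apply, contactM_apply, map_sub, map_sub]
  change (_ : Bil (Vec n)) a b - (jetAct (jac c k p.base) (hess k c p.base) p.val.1 p.val.2 _ :
    Bil (Vec n)) a b = (v.2.1 : Bil (Vec n)) _ _ - (p.val.2 v.1 : Bil (Vec n)) _ _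
  rw [tmap_bchart_metric hc hp, jetAct_apply, NatBundle.tmap_bchart_fst _ hc hp,
    jac_apply_jac hk hc hpk hp]
  ring

/-- Contact 1-forms. -/
def IsContactForm (α : DForm (MetricJetModel n) (MetricJet n M) 1) : Prop :=
  IsSmoothForm α ∧ ∀ p : MetricJet n M, ∃ φ : SymBil (Vec n) →L[ℝ] ℝ, ∀ v : MetricJetModel n,
    α p (fun _ => v) = φ (v.2.1 - p.val.2 v.1)

theorem IsContactForm.mem {α : DForm (MetricJetModel n) (MetricJet n M) 1} (h : IsContactForm α) :
    (⟨1, α⟩ : Σ k : ℕ, DForm (MetricJetModel n) (MetricJet n M) k) ∈ contactEDS n M :=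
  diffIdeal.of _ ⟨α, rfl, h.1, h.2⟩

theorem contactEDS_generators_smooth :
    ∀ a ∈ {a : Σ k : ℕ, DForm (MetricJetModel n) (MetricJet n M) k |
      ∃ α : DForm (MetricJetModel n) (MetricJet n M) 1, a = ⟨1, α⟩ ∧ IsSmoothForm α ∧
      ∀ p : MetricJet n M, ∃ φ : SymBil (Vec n) →L[ℝ] ℝ, ∀ v : MetricJetModel n,
      α p (fun _ => v) = φ (v.2.1 - p.val.2 v.1)}, IsSmoothForm a.2 := by
  rintro _ ⟨α, rfl, h, -⟩
  exact h

theorem exists_contactForm [T2Space M] (p : MetricJet n M) (φ : SymBil (Vec n) →L[ℝ] ℝ) :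
    ∃ α : DForm (MetricJetModel n) (MetricJet n M) 1, IsContactForm α ∧
      ∀ v, α p (fun _ => v) = φ (v.2.1 - p.val.2 v.1) := by
  set c := chartAt (Vec n) p.base
  have hc : c ∈ atlas (Vec n) M := chart_mem_atlas _ _
  have hp : p.base ∈ c.source := mem_chart_source _ _
  set b := (metricJet (minkowski n)).bchart c hc
  let β : DForm (MetricJetModel n) (MetricJetModel n) 1 := fun y => oneForm (φ ∘L contactM y)
  have hβ : ContDiffOn ℝ ∞ β Set.univ :=
    ((contDiff_oneForm (E := MetricJetModel n)).comp
      ((contDiff_const (c := φ)).clm_comp contDiff_contactM)).contDiffOn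
  have hs : ∀ q ∈ b.source, FormSmoothAt (pullback b β : DForm _ (MetricJet n M) 1) q :=
    fun q hq => (formSmoothAt_of_contDiffOn isOpen_univ hβ trivial).pullback
      (mapSmoothAt_chart ((metricJet (minkowski n)).bchart_mem_atlas hc) hq)
  obtain ⟨χ, hχ, hχ1, hχs⟩ := exists_bump (E := MetricJetModel n) (b.open_source.mem_nhds hp)
  refine ⟨fun q => χ q • (pullback b β : DForm _ (MetricJet n M) 1) q,
    ⟨isSmoothForm_smul_of_tsupport hχ fun q hq => hs q (hχs hq), fun q => ?_⟩, fun v => ?_⟩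
  · by_cases hq : q ∈ b.source
    · refine ⟨χ q • φ ∘L symPart (Vec n) ∘L pullB (jac c (chartAt (Vec n) q.base) q.base) ∘L
        SymBil.toBil, fun v => ?_⟩
      have h1 := contactM_bchart hc hq v
      change χ q * (pullback b β : DForm _ (MetricJet n M) 1) q (fun _ => v) = _
      rw [pullback_apply_vec]
      change χ q * φ (contactM (b q) (tmap (MetricJetModel n) (MetricJetModel n) b q v)) = _
      rw [h1]
      rfl
    · refine ⟨0, fun v => ?_⟩
      have : χ q = 0 := image_eq_zero_of_notMem_tsupport fun h => hq (hχs h)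
      simp [this]
  · have h1 := contactM_bchart hc hp v
    rw [jac_self c hp] at h1
    change χ p * (pullback b β : DForm _ (MetricJet n M) 1) p (fun _ => v) = _
    rw [pullback_apply_vec, hχ1.self_of_nhds, one_mul]
    change φ (contactM (b p) (tmap (MetricJetModel n) (MetricJetModel n) b p v)) = _
    rw [h1]
    refine congrArg φ (SymBil.ext' fun x y => ?_)
    have hs : pullB 1 ((v.2.1 - p.val.2 v.1 : SymBil (Vec n)) : Bil (Vec n)) ∈ symSub (Vec n) :=
      fun x y => (v.2.1 - p.val.2 v.1).symm x y
    rw [symPart_of_sym hs, pullB_apply, one_apply_eq_self, one_apply_eq_self]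

/-- Integral sections of the contact system are holonomic. -/
theorem holonomic_of_isIntegralAt [T2Space M] {s : M → MetricJet n M} {x : M}
    (h : IsIntegralAt (n := n) (contactEDS n M) s x) (u : Vec n) :
    (tmap (Vec n) (MetricJetModel n) s x u).2.1 =
      (s x).val.2 (tmap (Vec n) (MetricJetModel n) s x u).1 := by
  rw [← sub_eq_zero]
  by_contra hne
  obtain ⟨φ, -, hφ⟩ := exists_dual_vector ℝ _ (norm_ne_zero_iff.2 hne)
  obtain ⟨α, hα, hα'⟩ := exists_contactForm (s x) φ
  have h1 : (α (s x)) (fun _ => tmap (Vec n) (MetricJetModel n) s x u) = 0 :=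
    congrArg (fun a : Vec n [⋀^Fin 1]→L[ℝ] ℝ => a fun _ => u) (h _ hα.mem)
  rw [hα', hφ] at h1
  exact hne (norm_eq_zero.1 (by exact_mod_cast h1))

theorem isIntegralAt_of_holonomic [T2Space M] {s : M → MetricJet n M} {U : Set M} (hU : IsOpen U)
    (hs : ∀ x ∈ U, MapSmoothAt (Vec n) (MetricJetModel n) s x)
    (h : ∀ x ∈ U, ∀ u, (tmap (Vec n) (MetricJetModel n) s x u).2.1 =
      (s x).val.2 (tmap (Vec n) (MetricJetModel n) s x u).1) {x : M} (hx : x ∈ U) :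
    IsIntegralAt (n := n) (contactEDS n M) s x := by
  intro a ha
  refine pullback_diffIdeal_eq_zero contactEDS_generators_smooth hU hs ?_ ha hx
  rintro _ ⟨α, rfl, -, hα⟩ y hy
  ext v
  obtain ⟨φ, hφ⟩ := hα (s y)
  change α (s y) (fun i => tmap (Vec n) (MetricJetModel n) s y (v i)) = 0
  rw [oneForm_const_apply, hφ, h y hy, sub_self, map_zero]

end Contact

section TorsionForms

variable {n : ℕ} {M : Type*} [TopologicalSpace M] [ChartedSpace (Vec n) M] [IsManifold (𝓡 n) ∞ M]

/-- The 2-form `φ(Γ(x₀) x₁ - Γ(x₁) x₀)` in coordinates. -/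
def torM (φ : Vec n →L[ℝ] ℝ) : DForm (ConnMetricModel n) (ConnMetricModel n) 2 := fun y =>
  ∑ k : Fin n, wedgeAlt (oneForm ((EuclideanSpace.proj k : Vec n →L[ℝ] ℝ) ∘L
      (ContinuousLinearMap.fst ℝ _ _ : ConnMetricModel n →L[ℝ] Vec n)))
    (oneForm (φ ∘L y.2.1 (ε k) ∘L (ContinuousLinearMap.fst ℝ _ _ : ConnMetricModel n →L[ℝ] Vec n)))

theorem sum_smul_ε (x : Vec n) : ∑ k, x k • (ε k : Vec n) = x := by
  ext j; simp [Finset.sum_apply, Pi.single_apply]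

theorem torM_apply (φ : Vec n →L[ℝ] ℝ) (y : ConnMetricModel n) (v : Fin 2 → ConnMetricModel n) :
    torM φ y v = φ (y.2.1 (v 0).1 (v 1).1 - y.2.1 (v 1).1 (v 0).1) := by
  have h1 : torM φ y v = ∑ k, ((v 0).1 k * φ (y.2.1 (ε k) (v 1).1) -
      (v 1).1 k * φ (y.2.1 (ε k) (v 0).1)) := by
    rw [torM, ContinuousAlternatingMap.sum_apply]
    exact Finset.sum_congr rfl fun k _ => wedgeAlt_oneForm _ _ v
  have h2 : ∀ x z : Vec n, ∑ k, x k * φ (y.2.1 (ε k) z) = φ (y.2.1 x z) := by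
    intro x z
    conv_rhs => rw [← sum_smul_ε x]
    simp [map_sum]
  rw [h1, Finset.sum_sub_distrib, h2, h2, map_sub]

theorem contDiff_torM (φ : Vec n →L[ℝ] ℝ) : ContDiff ℝ ∞ (torM φ) := by
  refine contDiff_iff_contDiffAt.2 fun y => ContDiffAt.sum fun k _ => ?_
  refine ContDiffAt.wedgeAlt contDiffAt_const (contDiff_oneForm.comp ?_).contDiffAt
  exact contDiff_const.clm_comp (((contDiff_fst.comp contDiff_snd).clm_apply
    contDiff_const).clm_comp contDiff_const)

theorem bchart_conn {c : OpenPartialHomeomorph M (Vec n)} (hc : c ∈ atlas (Vec n) M)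
    (q : ConnMetric n M) (u v : Vec n) :
    (((connB (Vec n)).prod (metricB (minkowski n))).bchart c hc q).2.1 u v =
      jac (chartAt (Vec n) q.base) c q.base (q.val.1 (jac c (chartAt (Vec n) q.base) q.base u)
        (jac c (chartAt (Vec n) q.base) q.base v)) -
      hess (chartAt (Vec n) q.base) c q.base (jac c (chartAt (Vec n) q.base) q.base u)
        (jac c (chartAt (Vec n) q.base) q.base v) := rfl

theorem torM_bchart {c : OpenPartialHomeomorph M (Vec n)} (hc : c ∈ atlas (Vec n) M)
    (φ : Vec n →L[ℝ] ℝ) {q : ConnMetric n M} (hq : q.base ∈ c.source)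
    (v : Fin 2 → ConnMetricModel n) :
    (pullback (((connB (Vec n)).prod (metricB (minkowski n))).bchart c hc) (torM φ) :
      DForm (ConnMetricModel n) (ConnMetric n M) 2) q v =
      φ (jac (chartAt (Vec n) q.base) c q.base
        (q.val.1 (v 0).1 (v 1).1 - q.val.1 (v 1).1 (v 0).1)) := by
  have hk := chart_mem_atlas (Vec n) q.base
  have hqk := mem_chart_source (Vec n) q.base
  rw [pullback_apply_vec, torM_apply]
  simp only [NatBundle.tmap_bchart_fst _ hc hq, bchart_conn, jac_apply_jac hk hc hqk hq]
  rw [hess_symm hk hc hqk hq (v 1).1 (v 0).1, map_sub (jac _ _ _)]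
  congr 1
  abel

theorem pullback_pH_torM {c : OpenPartialHomeomorph M (Vec n)} (hc : c ∈ atlas (Vec n) M)
    (φ : Vec n →L[ℝ] ℝ) {p : FrameJet n M} (hp : p.base ∈ c.source) :
    (pullback pH (pullback (((connB (Vec n)).prod (metricB (minkowski n))).bchart c hc) (torM φ) :
      DForm (ConnMetricModel n) (ConnMetric n M) 2) : DForm (FrameJetModel n) (FrameJet n M) 2) p =
    ∑ i, φ (((frameJet (Vec n)).bchart c hc p).2.1 (ε i)) • torsion i p := by
  ext v
  rw [ContinuousAlternatingMap.sum_apply, ← pHNat_tot, pullback_apply_vec,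
    torM_bchart hc φ (q := (pHNat n).tot p) hp, NatMap.tmap_tot, NatMap.tmap_tot]
  simp only [ContinuousAlternatingMap.smul_apply, smul_eq_mul, torsion_apply]
  refine Eq.trans ?_ (sum_clm_ε (φ ∘L ((frameJet (Vec n)).bchart c hc p).2.1) _).symm
  rw [ContinuousLinearMap.comp_apply, bchart_frame_fst, mul_apply_eq_comp, apply_inverse p.mem]
  rfl

/-- The torsion gives elements of the reduced exterior differential system. -/
theorem exists_torsionForm [T2Space M] (q : ConnMetric n M) (φ : Vec n →L[ℝ] ℝ) :
    ∃ γ : DForm (ConnMetricModel n) (ConnMetric n M) 2,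
      (⟨2, γ⟩ : Σ k : ℕ, DForm (ConnMetricModel n) (ConnMetric n M) k) ∈ reducedPalatiniEDS n M ∧
      γ =ᶠ[𝓝 q] pullback (chartAt (ConnMetricModel n) q) (torM φ) := by
  set c := chartAt (Vec n) q.base
  have hc : c ∈ atlas (Vec n) M := chart_mem_atlas _ _
  have hq : q.base ∈ c.source := mem_chart_source _ _
  set b := ((connB (Vec n)).prod (metricB (minkowski n))).bchart c hc with hb
  have hs : ∀ q ∈ b.source, FormSmoothAt (pullback b (torM φ) : DForm _ (ConnMetric n M) 2) q :=
    fun q hq => (formSmoothAt_of_contDiffOn isOpen_univ (contDiff_torM φ).contDiffOn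
      trivial).pullback (mapSmoothAt_chart (NatBundle.bchart_mem_atlas _ hc) hq)
  obtain ⟨χ, hχ, hχ1, hχs⟩ := exists_bump (E := ConnMetricModel n) (b.open_source.mem_nhds hq)
  refine ⟨fun q => χ q • (pullback b (torM φ) : DForm _ (ConnMetric n M) 2) q,
    ⟨isSmoothForm_smul_of_tsupport hχ fun q hq => hs q (hχs hq),
      mem_diffIdeal_of_locallyIn fun p => ?_⟩, ?_⟩
  · have hpH : ContMDiff 𝓘(ℝ, FrameJetModel n) 𝓘(ℝ, ConnMetricModel n) ∞
      (pH : FrameJet n M → ConnMetric n M) := (pHNat n).contMDiff_tot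
    by_cases hp : pH p ∈ tsupport χ
    · have hp' : p.base ∈ c.source := hχs hp
      have h1 : LocallyIn (palatiniEDS n M) (∑ i, fun p : FrameJet n M =>
          (χ (pH p) * φ (((frameJet (Vec n)).bchart c hc p).2.1 (ε i))) • torsion i p) p := by
        refine LocallyIn.sum fun i _ => (LocallyIn.of_mem (torsion_mem i)).smul ?_
        have h2 : MapSmoothAt (FrameJetModel n) ℝ (fun p : FrameJet n M => χ (pH p)) p :=
          (hχ.comp hpH).mapSmoothAt p
        have h3 : MapSmoothAt (FrameJetModel n) ℝ
            (fun y : FrameJetModel n => φ (y.2.1 (ε i))) ((frameJet (Vec n)).bchart c hc p) :=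
          mapSmoothAt_of_contDiffOn isOpen_univ (φ.contDiff.comp
            ((contDiff_fst.comp contDiff_snd).clm_apply contDiff_const)).contDiffOn trivial
        have h4 := h3.comp (mapSmoothAt_chart ((frameJet (Vec n)).bchart_mem_atlas hc) hp')
        filter_upwards [h2, h4] with q h2 h4 using h2.mul h4
      refine h1.congr ?_
      filter_upwards [((frameJet (Vec n)).bchart c hc).open_source.mem_nhds hp'] with p' hp'
      rw [Finset.sum_apply]
      simp only [mul_smul, ← Finset.smul_sum]
      rw [← pullback_pH_torM hc φ hp']
      rfl
    · refine LocallyIn.zero.congr ?_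
      have : ∀ᶠ q in 𝓝 (pH p), χ q = 0 := by
        filter_upwards [(isClosed_tsupport χ).isOpen_compl.mem_nhds hp] with q hq
        exact image_eq_zero_of_notMem_tsupport hq
      filter_upwards [hpH.continuous.continuousAt.eventually this] with p' hp'
      change (χ (pH p') • _ : ConnMetricModel n [⋀^Fin 2]→L[ℝ] ℝ).compContinuousLinearMap _ = 0
      rw [hp', zero_smul]
      rfl
  · filter_upwards [hχ1] with q' hq'
    rw [hq', one_smul]
    rfl

end TorsionForms

section Ideals

variable {n : ℕ} {M : Type*} [TopologicalSpace M] [ChartedSpace (Vec n) M] [IsManifold (𝓡 n) ∞ M]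

theorem etaBil_ε (x : Vec n) (j : Fin n) : etaBil n x (ε j) = eta j * x j := by
  rw [etaBil_apply, Finset.sum_eq_single j (fun i _ hi => by simp [hi]) (by simp)]
  simp

/-- The difference between `dg` and the value for which `g` is parallel. -/
def covDeriv (p : FrameJet n M) (v : FrameJetModel n) : SymBil (Vec n) :=
  (fderiv ℝ (pHNat n).toFun p.val v.2).2 - parallelJet (pH p).val.1 (pH p).val.2 v.1

theorem metricity_eq (i j : Fin n) (p : FrameJet n M) (v : FrameJetModel n) :
    metricity i j p (fun _ => v) = -(eta i * eta j) *
      (covDeriv p v : Bil (Vec n)) (p.val.1 (ε i)) (p.val.1 (ε j)) := by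
  have h := metricity_bil p v (p.val.1 (ε i)) (p.val.1 (ε j))
  have h' : etaBil n (ε i) (omegaV p v (ε j)) = eta i * omegaV p v (ε j) i :=
    ((minkowski n).sym _ _).trans (etaBil_ε _ _)
  rw [inverse_apply p.mem, inverse_apply p.mem, h', etaBil_ε] at h
  rw [covDeriv, h, metricity_apply]
  linear_combination (-eta i * omegaV p v (ε i) j) * eta_mul_self j -
    (eta j * omegaV p v (ε j) i) * eta_mul_self i

theorem covDeriv_eq_zero {p : FrameJet n M} {v : FrameJetModel n}
    (h : ∀ i j, metricity i j p (fun _ => v) = 0) : covDeriv p v = 0 := by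
  have h1 : ∀ i j, (covDeriv p v : Bil (Vec n)) (p.val.1 (ε i)) (p.val.1 (ε j)) = 0 := by
    intro i j
    have h2 := h i j
    rw [metricity_eq] at h2
    have h3 : eta i * eta j ≠ 0 := fun h0 => by
      have h4 : (eta i * eta j) * (eta i * eta j) = 1 := by
        linear_combination eta_mul_self i + (eta i) ^ 2 * eta_mul_self j
      rw [h0] at h4; norm_num at h4
    simpa [h3] using h2
  refine SymBil.ext' fun a b => ?_
  have h2 : ∀ i b, (covDeriv p v : Bil (Vec n)) (p.val.1 (ε i)) (p.val.1 b) = 0 := by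
    intro i b
    have := sum_clm_ε ((covDeriv p v : Bil (Vec n)) (p.val.1 (ε i)) ∘L p.val.1) b
    rw [← ContinuousLinearMap.comp_apply, ← this]
    exact Finset.sum_eq_zero fun k _ => by
      rw [ContinuousLinearMap.comp_apply, h1, zero_mul]
  have h3 : ∀ a b, (covDeriv p v : Bil (Vec n)) (p.val.1 a) (p.val.1 b) = 0 := by
    intro a b
    have := sum_clm_ε ((covDeriv p v : Bil (Vec n)).flip (p.val.1 b) ∘L p.val.1) a
    refine this.symm.trans (Finset.sum_eq_zero fun k _ => ?_)
    rw [ContinuousLinearMap.comp_apply, ContinuousLinearMap.flip_apply, h2, zero_mul]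
  have h4 := h3 (Ring.inverse p.val.1 a) (Ring.inverse p.val.1 b)
  rw [apply_inverse p.mem, apply_inverse p.mem] at h4
  rw [h4, map_zero]
  rfl

theorem fderiv_retNat_fst {w : Op2 (Vec n) × SymBil (Vec n)}
    (hw : w ∈ ((connB (Vec n)).prod (metricB (minkowski n))).fib) (d : Op2 (Vec n) × SymBil (Vec n)) :
    (fderiv ℝ (retNat (minkowski n)).toFun w d).1 = d.2 := by
  have hd : HasFDerivAt (retNat (minkowski n)).toFun (fderiv ℝ (retNat (minkowski n)).toFun w) w :=
    (((retNat (minkowski n)).contDiffOn.contDiffAt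
      (((connB (Vec n)).prod (metricB (minkowski n))).isOpen_fib.mem_nhds hw)).differentiableAt
      (by simp)).hasFDerivAt
  exact congrArg (fun A : Op2 (Vec n) × SymBil (Vec n) →L[ℝ] SymBil (Vec n) => A d)
    (hd.fst.unique hasFDerivAt_snd)

variable (n M) in
/-- `C(LM) ×_M Σ → J¹Σ`. -/
abbrev retMap : ConnMetric n M → MetricJet n M := (retNat (minkowski n)).tot

variable (n M) in
/-- `J¹Σ → C(LM) ×_M Σ`. -/
abbrev rhoMap : MetricJet n M → ConnMetric n M := (rhoNat (minkowski n)).tot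

theorem contMDiff_retMap : ContMDiff 𝓘(ℝ, ConnMetricModel n) 𝓘(ℝ, MetricJetModel n) ∞ (retMap n M) :=
  (retNat (minkowski n)).contMDiff_tot

theorem contMDiff_rhoMap : ContMDiff 𝓘(ℝ, MetricJetModel n) 𝓘(ℝ, ConnMetricModel n) ∞ (rhoMap n M) :=
  (rhoNat (minkowski n)).contMDiff_tot

theorem contMDiff_pH :
    ContMDiff 𝓘(ℝ, FrameJetModel n) 𝓘(ℝ, ConnMetricModel n) ∞ (pH : FrameJet n M → _) :=
  (pHNat n).contMDiff_tot

theorem tmap_pH (p : FrameJet n M) (v : FrameJetModel n) :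
    tmap (FrameJetModel n) (ConnMetricModel n) pH p v =
      (v.1, fderiv ℝ (pHNat n).toFun p.val v.2) := (pHNat n).tmap_tot p v

theorem tmap_retMap (q : ConnMetric n M) (v : ConnMetricModel n) :
    tmap (ConnMetricModel n) (MetricJetModel n) (retMap n M) q v =
      (v.1, fderiv ℝ (retNat (minkowski n)).toFun q.val v.2) := (retNat (minkowski n)).tmap_tot q v

theorem isSmoothForm_contactEDS {a : Σ k : ℕ, DForm (MetricJetModel n) (MetricJet n M) k}
    (ha : a ∈ contactEDS n M) : IsSmoothForm a.2 :=
  diffIdeal_smooth contactEDS_generators_smooth ha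

theorem pullback_retMap_mem [T2Space M] {a : Σ k : ℕ, DForm (MetricJetModel n) (MetricJet n M) k}
    (ha : a ∈ contactEDS n M) :
    (⟨a.1, pullback (retMap n M) a.2⟩ : Σ k : ℕ, DForm (ConnMetricModel n) (ConnMetric n M) k) ∈
      reducedPalatiniEDS n M := by
  refine ⟨isSmoothForm_iff.2 fun q => (isSmoothForm_iff.1 (isSmoothForm_contactEDS ha) _).pullback
    (contMDiff_retMap.mapSmoothAt q), ?_⟩
  have h1 : (pullback pH (pullback (retMap n M) a.2 : DForm (ConnMetricModel n) (ConnMetric n M) a.1) :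
      DForm (FrameJetModel n) (FrameJet n M) a.1) = pullback (fun p => retMap n M (pH p)) a.2 :=
    funext fun p => (pullback_comp (contMDiff_retMap.mapSmoothAt _).mdifferentiableAt
      (contMDiff_pH.mapSmoothAt _).mdifferentiableAt _).symm
  rw [h1]
  have hsm : ContMDiff 𝓘(ℝ, FrameJetModel n) 𝓘(ℝ, MetricJetModel n) ∞
    fun p : FrameJet n M => retMap n M (pH p) := contMDiff_retMap.comp contMDiff_pH
  refine mem_diffIdeal_pullback contactEDS_generators_smooth hsm ?_ ha
  rintro _ ⟨α, rfl, hα, hα'⟩ p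
  refine LocallyIn.of_mem (mem_palatiniEDS_of_metricity (isSmoothForm_iff.2 fun p =>
    (isSmoothForm_iff.1 hα _).pullback (hsm.mapSmoothAt p)) fun p v hv => ?_)
  obtain ⟨φ, hφ⟩ := hα' (retMap n M (pH p))
  rw [pullback_apply_vec, hφ, tmap_comp (contMDiff_retMap.mapSmoothAt _).mdifferentiableAt
    (contMDiff_pH.mapSmoothAt _).mdifferentiableAt, ContinuousLinearMap.comp_apply, tmap_pH,
    tmap_retMap, fderiv_retNat_fst (pH p).mem]
  have h2 := covDeriv_eq_zero hv
  refine (congrArg φ h2).trans (map_zero φ)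

end Ideals

theorem exists_local_inverse {E : Type*} [NormedAddCommGroup E] [NormedSpace ℝ E] [CompleteSpace E]
    {f : E → E} {U : Set E} (hU : IsOpen U) (hf : ContDiffOn ℝ ∞ f U) {a : E} (ha : a ∈ U)
    (hd : HasFDerivAt f (ContinuousLinearMap.id ℝ E) a) :
    ∃ g : E → E, g (f a) = a ∧ ∀ᶠ y in 𝓝 (f a), ContDiffAt ℝ ∞ g y ∧ f (g y) = y := by
  have hfa := hf.contDiffAt (hU.mem_nhds ha)
  have hd' : HasFDerivAt f ((ContinuousLinearEquiv.refl ℝ E : E ≃L[ℝ] E) : E →L[ℝ] E) a := hd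
  let e := hfa.toOpenPartialHomeomorph f hd' (by simp)
  have he : a ∈ e.source := hfa.mem_toOpenPartialHomeomorph_source hd' (by simp)
  have hsymm : e.symm (f a) = a := e.left_inv he
  refine ⟨e.symm, hsymm, ?_⟩
  have hcont : ContinuousAt e.symm (f a) := e.continuousAt_symm (e.map_source he)
  have h1 : ∀ᶠ x in 𝓝 a, x ∈ U ∧ IsUnit (fderiv ℝ f x) := by
    have h2 : ContinuousAt (fderiv ℝ f) a :=
      (hfa.fderiv_right (m := 0) (by norm_cast)).continuousAt
    have h3 : IsUnit (fderiv ℝ f a) := by rw [hd.fderiv]; exact isUnit_one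
    filter_upwards [hU.mem_nhds ha, h2.eventually (Units.isOpen.mem_nhds h3)] with x hx hx'
      using ⟨hx, hx'⟩
  rw [← hsymm] at h1
  filter_upwards [hcont.eventually h1, e.open_target.mem_nhds (e.map_source he)] with y hy hy'
  refine ⟨?_, e.right_inv hy'⟩
  obtain ⟨u, hu⟩ := hy.2
  have hy2 := hf.contDiffAt (hU.mem_nhds hy.1)
  refine e.contDiffAt_symm (f₀' := ContinuousLinearEquiv.unitsEquiv ℝ E u) hy' ?_ hy2
  have h4 := (hy2.differentiableAt (by simp)).hasFDerivAt
  rw [← hu] at h4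
  exact h4

section LocalFrames

variable {n : ℕ}

/-- Orthonormal frames can be chosen to depend smoothly on the metric. -/
theorem exists_smooth_frame {e₀ : Op (Vec n)} (he₀ : IsUnit e₀) :
    ∃ F : SymBil (Vec n) → Op (Vec n), F (frameMetric e₀) = e₀ ∧
      ∀ᶠ g in 𝓝 (frameMetric e₀), ContDiffAt ℝ ∞ F g ∧ frameMetric (F g) = g := by
  let T : SymBil (Vec n) →L[ℝ] Op (Vec n) := (-(1 / 2 : ℝ)) •
    (ContinuousLinearMap.compL ℝ (Vec n) (Vec n →L[ℝ] ℝ) (Vec n) (minkowski n).sharp ∘L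
      pullB e₀ ∘L SymBil.toBil)
  have hT : ∀ s x y, etaBil n (T s x) y = -(1 / 2) * (s : Bil (Vec n)) (e₀ x) (e₀ y) := by
    intro s x y
    have h1 := (minkowski n).form_sharp (pullB e₀ (s : Bil (Vec n)) x)
    change etaBil n ((-(1 / 2 : ℝ)) • (minkowski n).sharp (pullB e₀ (s : Bil (Vec n)) x)) y = _
    rw [map_smul, smul_apply, smul_eq_mul]
    exact congrArg (fun f : Vec n →L[ℝ] ℝ => -(1 / 2 : ℝ) * f y) h1
  let E : SymBil (Vec n) → Op (Vec n) := fun s => e₀ + e₀ * T s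
  have hE : ContDiff ℝ ∞ E := contDiff_const.add (contDiff_const.mul T.contDiff)
  have hE0 : E 0 = e₀ := by simp [E]
  have hEd : HasFDerivAt E (postL e₀ ∘L T) 0 :=
    HasFDerivAt.const_add _ ((postL e₀ ∘L T).hasFDerivAt)
  let U : Set (SymBil (Vec n)) := {s | IsUnit (E s)}
  have hU : IsOpen U := Units.isOpen.preimage hE.continuous
  have hf : ContDiffOn ℝ ∞ (fun s => frameMetric (E s)) U :=
    contDiffOn_frameMetric.comp hE.contDiffOn fun s hs => hs
  have h0 : (0 : SymBil (Vec n)) ∈ U := by change IsUnit (E 0); rwa [hE0]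
  have hd : HasFDerivAt (fun s => frameMetric (E s)) (ContinuousLinearMap.id ℝ _) 0 := by
    have h1 : HasFDerivAt frameMetric (fderiv ℝ frameMetric e₀) (E 0) := by
      rw [hE0]
      exact ((contDiffOn_frameMetric.contDiffAt (Units.isOpen.mem_nhds he₀)).differentiableAt
        (by simp)).hasFDerivAt
    have h2 := HasFDerivAt.comp (g := frameMetric) (0 : SymBil (Vec n)) h1 hEd
    have h3 : fderiv ℝ frameMetric e₀ ∘L postL e₀ ∘L T = ContinuousLinearMap.id ℝ _ := by
      refine ContinuousLinearMap.ext fun s => SymBil.ext' fun a b => ?_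
      change (fderiv ℝ frameMetric e₀ (e₀ ∘L T s) : Bil (Vec n)) a b = (s : Bil (Vec n)) a b
      rw [fderiv_frameMetric he₀, ContinuousLinearMap.comp_apply, ContinuousLinearMap.comp_apply,
        inverse_apply he₀, inverse_apply he₀, hT]
      have h4 := ((minkowski n).sym (Ring.inverse e₀ a) (T s (Ring.inverse e₀ b))).trans
        (hT s (Ring.inverse e₀ b) (Ring.inverse e₀ a))
      rw [apply_inverse he₀, apply_inverse he₀] at h4 ⊢
      have h5 : etaBil n (Ring.inverse e₀ a) (T s (Ring.inverse e₀ b)) =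
        -(1 / 2) * (s : Bil (Vec n)) b a := h4
      rw [h5, s.symm b a]
      ring
    rw [h3] at h2
    exact h2
  obtain ⟨g, hg0, hg⟩ := exists_local_inverse hU hf h0 hd
  simp only [hE0] at hg0 hg
  refine ⟨fun x => E (g x), (congrArg E hg0).trans hE0, ?_⟩
  filter_upwards [hg] with y hy
  exact ⟨hE.contDiffAt.comp y hy.1, hy.2⟩

variable {M : Type*} [TopologicalSpace M] [ChartedSpace (Vec n) M] [IsManifold (𝓡 n) ∞ M]

/-- Local sections of `pH`. -/
theorem exists_local_section (p : FrameJet n M) :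
    ∃ ℓ : ConnMetric n M → FrameJet n M,
      MapSmoothAt (ConnMetricModel n) (FrameJetModel n) ℓ (pH p) ∧ ℓ (pH p) = p ∧
      ∀ᶠ q in 𝓝 (pH p), pH (ℓ q) = q := by
  obtain ⟨F, hF0, hF⟩ := exists_smooth_frame p.mem
  set c := chartAt (Vec n) p.base
  have hc : c ∈ atlas (Vec n) M := chart_mem_atlas _ _
  have hp : p.base ∈ c.source := mem_chart_source _ _
  set b₁ := (frameJet (Vec n)).bchart c hc
  set b₂ := ((connB (Vec n)).prod (metricB (minkowski n))).bchart c hc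
  have hb₁ : b₁ ∈ atlas _ (FrameJet n M) := NatBundle.bchart_mem_atlas _ hc
  have hb₂ : b₂ ∈ atlas _ (ConnMetric n M) := NatBundle.bchart_mem_atlas _ hc
  let Φ : ConnMetricModel n → FrameJetModel n := fun y =>
    (y.1, (F y.2.2, -(preL (F y.2.2) ∘L y.2.1)))
  have hp1 : b₁ p = (c p.base, p.val) := (frameJet (Vec n)).chartAt_self p
  have hp2 : b₂ (pH p) = (c p.base, (pH p).val) :=
    ((connB (Vec n)).prod (metricB (minkowski n))).chartAt_self (pH p)
  have hev : ∀ᶠ y in 𝓝 (b₂ (pH p)), ContDiffAt ℝ ∞ F y.2.2 ∧ frameMetric (F y.2.2) = y.2.2 ∧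
      IsUnit (F y.2.2) := by
    have h1 : Filter.Tendsto (fun y : ConnMetricModel n => y.2.2) (𝓝 (b₂ (pH p)))
        (𝓝 (frameMetric p.val.1)) := by
      rw [hp2]
      exact (continuous_snd.comp continuous_snd).tendsto _
    have h2 : ∀ᶠ g in 𝓝 (frameMetric p.val.1), IsUnit (F g) := by
      have h3 : ContinuousAt F (frameMetric p.val.1) := hF.self_of_nhds.1.continuousAt
      refine h3.eventually (Units.isOpen.mem_nhds ?_)
      rw [hF0]
      exact p.mem
    filter_upwards [h1.eventually hF, h1.eventually h2] with y hy hy' using ⟨hy.1, hy.2, hy'⟩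
  have hΦ : MapSmoothAt (ConnMetricModel n) (FrameJetModel n) Φ (b₂ (pH p)) := by
    filter_upwards [hev] with y hy
    have h1 : ContDiffAt ℝ ∞ (fun y : ConnMetricModel n => F y.2.2) y :=
      ContDiffAt.comp (g := F) y hy.1 (contDiff_snd.comp contDiff_snd).contDiffAt
    exact (contDiff_fst.contDiffAt.prodMk (h1.prodMk ((contDiff_preL.contDiffAt.comp y h1).clm_comp
      (contDiff_fst.comp contDiff_snd).contDiffAt).neg)).contMDiffAt
  have hΦp : Φ (b₂ (pH p)) = b₁ p := by
    rw [hp1, hp2]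
    refine Prod.ext rfl (Prod.ext hF0 ?_)
    ext1 u; ext1 a
    change -((pH p).val.1 u (F (frameMetric p.val.1) a)) = _
    rw [hF0]
    change -(-(p.val.2 u (Ring.inverse p.val.1 (p.val.1 a)))) = _
    rw [inverse_apply p.mem, neg_neg]
  have hb₁s : MapSmoothAt (FrameJetModel n) (FrameJetModel n) b₁.symm (Φ (b₂ (pH p))) := by
    rw [hΦp]; exact mapSmoothAt_chart_symm hb₁ (b₁.map_source hp)
  have hb₂s : MapSmoothAt (ConnMetricModel n) (ConnMetricModel n) b₂ (pH p) :=
    mapSmoothAt_chart hb₂ (x := pH p) hp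
  refine ⟨fun q => b₁.symm (Φ (b₂ q)), MapSmoothAt.comp (f := b₁.symm) hb₁s
    (MapSmoothAt.comp (f := Φ) hΦ hb₂s), ?_, ?_⟩
  · exact (congrArg b₁.symm hΦp).trans (b₁.left_inv hp)
  · filter_upwards [b₂.open_source.mem_nhds (x := pH p) hp,
      hb₂s.contMDiffAt.continuousAt.eventually hev] with q hq hq'
    have ht : Φ (b₂ q) ∈ b₁.target := ⟨(b₂.map_source hq).1, hq'.2.2⟩
    have hs : b₁.symm (Φ (b₂ q)) ∈ b₁.source := b₁.map_target ht
    have h1 := (pHNat n).bchart_tot hc hs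
    have h2 : b₁ (b₁.symm (Φ (b₂ q))) = Φ (b₂ q) := b₁.right_inv ht
    refine b₂.injOn (show pH (b₁.symm (Φ (b₂ q))) ∈ b₂.source from hs) hq ?_
    refine h1.trans ?_
    rw [h2]
    refine Prod.ext rfl (Prod.ext ?_ hq'.2.1)
    ext1 u; ext1 a
    change -(-((b₂ q).2.1 u (F (b₂ q).2.2 (Ring.inverse (F (b₂ q).2.2) a)))) = _
    rw [apply_inverse hq'.2.2, neg_neg]

/-- Every point of `C(LM) ×_M Σ` comes from a frame. -/
theorem exists_pH_eq (q : ConnMetric n M) {e : Op (Vec n)} (he : IsUnit e)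
    (h : ∀ v w, (q.val.2 : Bil (Vec n)) (e v) (e w) = etaBil n v w) :
    ∃ p : FrameJet n M, p.val.1 = e ∧ pH p = q := by
  obtain ⟨x, ⟨Γ, g⟩, hq⟩ := q
  refine ⟨⟨x, (e, -(preL e ∘L Γ)), he⟩, rfl, ?_⟩
  have h1 : -(preL (Ring.inverse e) ∘L (-(preL e ∘L Γ))) = Γ := by
    ext1 u; ext1 a
    change -(-(Γ u (e (Ring.inverse e a)))) = _
    rw [apply_inverse he, neg_neg]
  have h2 : frameMetric e = g := SymBil.ext' fun a b => by
    rw [frameMetric_apply, ← h, apply_inverse he, apply_inverse he]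
  simp only [pH, h1, h2]

end LocalFrames

section Correspondence

variable {n : ℕ} {M : Type*} [TopologicalSpace M] [ChartedSpace (Vec n) M] [IsManifold (𝓡 n) ∞ M]

theorem tmap_rhoMap (q : MetricJet n M) (v : MetricJetModel n) :
    tmap (MetricJetModel n) (ConnMetricModel n) (rhoMap n M) q v =
      (v.1, fderiv ℝ (rhoNat (minkowski n)).toFun q.val v.2) := (rhoNat (minkowski n)).tmap_tot q v

theorem fderiv_rhoNat_snd {w : SymBil (Vec n) × (Vec n →L[ℝ] SymBil (Vec n))}
    (hw : w ∈ (metricJet (minkowski n)).fib) (d : SymBil (Vec n) × (Vec n →L[ℝ] SymBil (Vec n))) :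
    (fderiv ℝ (rhoNat (minkowski n)).toFun w d).2 = d.1 := by
  have hd : HasFDerivAt (rhoNat (minkowski n)).toFun (fderiv ℝ (rhoNat (minkowski n)).toFun w) w :=
    (((rhoNat (minkowski n)).contDiffOn.contDiffAt
      ((metricJet (minkowski n)).isOpen_fib.mem_nhds hw)).differentiableAt
      (by simp)).hasFDerivAt
  exact congrArg (fun A : SymBil (Vec n) × (Vec n →L[ℝ] SymBil (Vec n)) →L[ℝ] SymBil (Vec n) => A d)
    (hd.snd.unique hasFDerivAt_fst)

theorem exists_pH_eq' (q : ConnMetric n M) : ∃ p : FrameJet n M, pH p = q := by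
  obtain ⟨e, he, h⟩ := q.mem.2
  obtain ⟨p, -, hp⟩ := exists_pH_eq q he h
  exact ⟨p, hp⟩

theorem covDeriv_of_tmap {p : FrameJet n M} {j : MetricJet n M} (hp : pH p = rhoMap n M j)
    {w : FrameJetModel n} {v : MetricJetModel n}
    (h : tmap (FrameJetModel n) (ConnMetricModel n) pH p w =
      tmap (MetricJetModel n) (ConnMetricModel n) (rhoMap n M) j v) :
    covDeriv p w = v.2.1 - j.val.2 v.1 := by
  rw [tmap_pH, tmap_rhoMap] at h
  have h1 : w.1 = v.1 := congrArg Prod.fst h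
  have h2 : fderiv ℝ (pHNat n).toFun p.val w.2 = fderiv ℝ (rhoNat (minkowski n)).toFun j.val v.2 :=
    congrArg Prod.snd h
  have h3 : parallelJet (rhoMap n M j).val.1 (rhoMap n M j).val.2 = j.val.2 :=
    parallelJet_leviCivita j.mem j.val.2
  rw [covDeriv, hp, h1, h2, h3, fderiv_rhoNat_snd j.mem]

theorem exists_metricity_eq (i k : Fin n) {p : FrameJet n M} {j : MetricJet n M}
    (hp : pH p = rhoMap n M j) {A : MetricJetModel n →L[ℝ] FrameJetModel n}
    (h : ∀ v, tmap (FrameJetModel n) (ConnMetricModel n) pH p (A v) =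
      tmap (MetricJetModel n) (ConnMetricModel n) (rhoMap n M) j v) :
    ∃ φ : SymBil (Vec n) →L[ℝ] ℝ, ∀ v, metricity i k p (fun _ => A v) = φ (v.2.1 - j.val.2 v.1) := by
  refine ⟨(-(eta i * eta k)) • (ContinuousLinearMap.apply ℝ ℝ (p.val.1 (ε k)) ∘L
    ContinuousLinearMap.apply ℝ (Vec n →L[ℝ] ℝ) (p.val.1 (ε i)) ∘L SymBil.toBil), fun v => ?_⟩
  rw [metricity_eq, covDeriv_of_tmap hp (h v)]
  rfl

theorem torsion_eq_zero (i : Fin n) {p : FrameJet n M} {j : MetricJet n M}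
    (hp : pH p = rhoMap n M j) : torsion i p = 0 := by
  ext v
  have h : (rhoMap n M j).val.1 (v 0).1 (v 1).1 = (rhoMap n M j).val.1 (v 1).1 (v 0).1 :=
    leviCivita_symm j.mem _ _ _
  rw [torsion_apply, hp, h, sub_self, map_zero]
  rfl

/-- The Levi-Civita connection and the metric lift locally to first jets of frames. -/
theorem exists_frame_lift (j : MetricJet n M) :
    ∃ (f : MetricJet n M → FrameJet n M) (U : Set (MetricJet n M)), IsOpen U ∧ j ∈ U ∧
      (∀ j' ∈ U, MapSmoothAt (MetricJetModel n) (FrameJetModel n) f j') ∧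
      (∀ j' ∈ U, pH (f j') = rhoMap n M j') ∧
      ∀ j' ∈ U, ∀ v, tmap (FrameJetModel n) (ConnMetricModel n) pH (f j')
        (tmap (MetricJetModel n) (FrameJetModel n) f j' v) =
        tmap (MetricJetModel n) (ConnMetricModel n) (rhoMap n M) j' v := by
  obtain ⟨p, hp⟩ := exists_pH_eq' (rhoMap n M j)
  obtain ⟨ℓ, hℓ, hℓp, hℓs⟩ := exists_local_section p
  rw [hp] at hℓ hℓs
  have hρ : ∀ j, MapSmoothAt (MetricJetModel n) (ConnMetricModel n) (rhoMap n M) j :=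
    contMDiff_rhoMap.mapSmoothAt
  have hev : ∀ᶠ j' in 𝓝 j, MapSmoothAt (ConnMetricModel n) (FrameJetModel n) ℓ (rhoMap n M j') ∧
      ∀ᶠ q in 𝓝 (rhoMap n M j'), pH (ℓ q) = q :=
    contMDiff_rhoMap.continuous.continuousAt.eventually
      (hℓ.eventually.and (eventually_eventually_nhds.2 hℓs))
  obtain ⟨U, hUsub, hUo, hjU⟩ := eventually_nhds_iff.1 hev
  have hsm : ∀ j' ∈ U, MapSmoothAt (MetricJetModel n) (FrameJetModel n)
      (fun j => ℓ (rhoMap n M j)) j' := fun j' hj' => (hUsub j' hj').1.comp (hρ j')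
  have hsec : ∀ j' ∈ U, pH (ℓ (rhoMap n M j')) = rhoMap n M j' := fun j' hj' =>
    (hUsub j' hj').2.self_of_nhds
  refine ⟨fun j => ℓ (rhoMap n M j), U, hUo, hjU, hsm, hsec, fun j' hj' v => ?_⟩
  have h1 : (fun j => pH (ℓ (rhoMap n M j))) =ᶠ[𝓝 j'] rhoMap n M := by
    filter_upwards [hUo.mem_nhds hj'] with j'' hj'' using hsec j'' hj''
  have h2 := tmap_comp (f := (pH : FrameJet n M → ConnMetric n M))
    (g := fun j => ℓ (rhoMap n M j)) (x := j')
    (contMDiff_pH.mapSmoothAt _).mdifferentiableAt (hsm j' hj').mdifferentiableAt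
  rw [← tmap_congr h1, h2]
  rfl

/-- `J¹Σ → C(LM) ×_M Σ` pulls the reduced exterior differential system back to the contact
structure. -/
theorem pullback_rhoMap_mem [T2Space M]
    {a : Σ k : ℕ, DForm (ConnMetricModel n) (ConnMetric n M) k} (ha : a ∈ reducedPalatiniEDS n M) :
    (⟨a.1, pullback (rhoMap n M) a.2⟩ : Σ k : ℕ, DForm (MetricJetModel n) (MetricJet n M) k) ∈
      contactEDS n M := by
  refine mem_diffIdeal_of_locallyIn fun j => ?_
  obtain ⟨f, U, hUo, hjU, hsm, hsec, htan⟩ := exists_frame_lift j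
  have h1 : LocallyIn (contactEDS n M) (pullback f
      (pullback pH a.2 : DForm (FrameJetModel n) (FrameJet n M) a.1) :
      DForm (MetricJetModel n) (MetricJet n M) a.1) j := by
    refine locallyIn_pullback (palatiniEDS_generators_smooth n M) hsm ?_ ha.2 j hjU
    rintro _ (⟨i, k, rfl⟩ | ⟨i, rfl⟩) j' hj'
    · have hform : FormSmoothAt (pullback f (metricity i k) :
          DForm (MetricJetModel n) (MetricJet n M) 1) j' :=
        (isSmoothForm_iff.1 (isSmoothForm_metricity i k) _).pullback (hsm j' hj')
      obtain ⟨χ, hχ, hχ1, hχs, hχf⟩ := hform.exists_extension (hUo.mem_nhds hj')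
      refine (LocallyIn.of_mem (IsContactForm.mem ⟨hχf, fun j₁ => ?_⟩)).congr ?_
      · by_cases hj₁ : j₁ ∈ U
        · obtain ⟨φ, hφ⟩ := exists_metricity_eq i k (hsec j₁ hj₁) (htan j₁ hj₁)
          refine ⟨χ j₁ • φ, fun v => ?_⟩
          rw [ContinuousAlternatingMap.smul_apply, pullback_apply_vec, hφ]
          rfl
        · refine ⟨0, fun v => ?_⟩
          have : χ j₁ = 0 := image_eq_zero_of_notMem_tsupport fun h => hj₁ (hχs h)
          simp [this]
      · filter_upwards [hχ1] with j₁ hj₁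
        rw [hj₁, one_smul]
    · refine LocallyIn.zero.congr ?_
      filter_upwards [hUo.mem_nhds hj'] with j₁ hj₁
      rw [pullback_apply, torsion_eq_zero i (hsec j₁ hj₁)]
      rfl
  refine h1.congr ?_
  filter_upwards [hUo.mem_nhds hjU] with j' hj'
  have e1 : (fun j => pH (f j)) =ᶠ[𝓝 j'] rhoMap n M := by
    filter_upwards [hUo.mem_nhds hj'] with j'' hj'' using hsec j'' hj''
  rw [← pullback_congr e1, ← pullback_comp (f := (pH : FrameJet n M → ConnMetric n M))
    (contMDiff_pH.mapSmoothAt _).mdifferentiableAt (hsm j' hj').mdifferentiableAt]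

theorem isSmoothForm_reducedPalatiniEDS
    {a : Σ k : ℕ, DForm (ConnMetricModel n) (ConnMetric n M) k} (ha : a ∈ reducedPalatiniEDS n M) :
    IsSmoothForm a.2 := ha.1

/-- Derivative of a section. -/
theorem tmap_section_fst {W : Type} [NormedAddCommGroup W] [NormedSpace ℝ W]
    {b : NatBundle (Vec n) W} {s : M → Tot b M} {x : M} (hs : MapSmoothAt (Vec n) (Vec n × W) s x)
    (hb : ∀ᶠ y in 𝓝 x, (s y).base = y) (u : Vec n) : (tmap (Vec n) (Vec n × W) s x u).1 = u := by
  have h1 := tmap_comp (f := (Tot.base : Tot b M → M)) (g := s) (x := x)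
    (b.mapSmoothAt_base _).mdifferentiableAt hs.mdifferentiableAt
  have h2 : (fun y => (s y).base) =ᶠ[𝓝 x] fun y => y := hb
  rw [tmap_congr h2, tmap_id, b.tmap_base] at h1
  exact (congrArg (fun A : Vec n →L[ℝ] Vec n => A u) h1).symm

/-- Integral sections of the reduced exterior differential system are torsion-free. -/
theorem conn_symm_of_isIntegralAt [T2Space M] {s : M → ConnMetric n M} {x : M}
    (hs : MapSmoothAt (Vec n) (ConnMetricModel n) s x) (hb : ∀ᶠ y in 𝓝 x, (s y).base = y)
    (h : IsIntegralAt (n := n) (reducedPalatiniEDS n M) s x) (u v : Vec n) :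
    (s x).val.1 u v = (s x).val.1 v u := by
  rw [← sub_eq_zero]
  by_contra hne
  obtain ⟨φ, -, hφ⟩ := exists_dual_vector ℝ _ (norm_ne_zero_iff.2 hne)
  obtain ⟨γ, hγ, hγ'⟩ := exists_torsionForm (s x) φ
  have h1 := congrArg (fun a : Vec n [⋀^Fin 2]→L[ℝ] ℝ => a ![u, v]) (h _ hγ)
  change γ (s x) (fun i => tmap (Vec n) (ConnMetricModel n) s x (![u, v] i)) = 0 at h1
  rw [hγ'.self_of_nhds] at h1
  have h2 := torM_bchart (chart_mem_atlas (Vec n) (s x).base) φ (q := s x)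
    (mem_chart_source (Vec n) _) (fun i => tmap (Vec n) (ConnMetricModel n) s x (![u, v] i))
  rw [tmap_section_fst hs hb, tmap_section_fst hs hb, jac_self _ (mem_chart_source (Vec n) _)] at h2
  have h3 := h2.symm.trans h1
  change φ ((s x).val.1 u v - (s x).val.1 v u) = 0 at h3
  rw [hφ] at h3
  exact hne (norm_eq_zero.1 (by exact_mod_cast h3))

theorem extDeriv_torM (φ : Vec n →L[ℝ] ℝ) (y : ConnMetricModel n) (v : Fin 3 → ConnMetricModel n)
    (hv : (v 0).1 = 0) :
    extDeriv (torM φ) y v = φ ((v 0).2.1 (v 1).1 (v 2).1 - (v 0).2.1 (v 2).1 (v 1).1) := by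
  have h1 : ∀ w : Fin 2 → ConnMetricModel n, ∀ u, fderiv ℝ (fun y => torM φ y w) y u =
      φ (u.2.1 (w 0).1 (w 1).1 - u.2.1 (w 1).1 (w 0).1) := by
    intro w u
    let A : ∀ a b : Vec n, ConnMetricModel n →L[ℝ] Vec n := fun a b =>
      ContinuousLinearMap.apply ℝ (Vec n) b ∘L ContinuousLinearMap.apply ℝ (Op (Vec n)) a ∘L
        ContinuousLinearMap.fst ℝ _ _ ∘L ContinuousLinearMap.snd ℝ _ _
    have h2 : (fun y => torM φ y w) = φ ∘L (A (w 0).1 (w 1).1 - A (w 1).1 (w 0).1) :=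
      funext fun y => torM_apply φ y w
    rw [h2, ContinuousLinearMap.fderiv]
    rfl
  refine (extDeriv_apply ((contDiff_torM φ).differentiable (by simp) y) v).trans ?_
  refine (Fin.sum_univ_three _).trans ?_
  rw [h1, h1, h1]
  change (-1 : ℤ) ^ 0 • φ ((v 0).2.1 (v 1).1 (v 2).1 - (v 0).2.1 (v 2).1 (v 1).1) +
    (-1 : ℤ) ^ 1 • φ ((v 1).2.1 (v 0).1 (v 2).1 - (v 1).2.1 (v 2).1 (v 0).1) +
    (-1 : ℤ) ^ 2 • φ ((v 2).2.1 (v 0).1 (v 1).1 - (v 2).2.1 (v 1).1 (v 0).1) = _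
  rw [hv]
  simp

/-- Admissible variations preserve the symmetry of the connection. -/
theorem variation_symm [T2Space M] {s : M → ConnMetric n M}
    (hs : ContMDiff (𝓡 n) 𝓘(ℝ, ConnMetricModel n) ∞ s) (hb : ∀ x, (s x).base = x)
    {X : VField (ConnMetricModel n) (ConnMetric n M)} (hX : IsSmoothVField X)
    (hXv : ∀ x, (vecAt X (s x)).1 = 0)
    (hXa : ∀ a ∈ reducedPalatiniEDS n M, (pullback s (lieD X a.2) : DForm (Vec n) M a.1) = 0)
    (x : M) (u v : Vec n) : (vecAt X (s x)).2.1 u v = (vecAt X (s x)).2.1 v u := by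
  have hsm := fun x => hs.mapSmoothAt x
  rw [← sub_eq_zero]
  by_contra hne
  obtain ⟨φ, -, hφ⟩ := exists_dual_vector ℝ _ (norm_ne_zero_iff.2 hne)
  obtain ⟨γ, hγ, hγ'⟩ := exists_torsionForm (s x) φ
  have hγs := isSmoothForm_iff.1 hγ.1
  have h1 := congrFun (hXa _ hγ) x
  have h2 : (pullback s (extD (contract X γ)) : DForm (Vec n) M 2) x = 0 := by
    rw [← extD_pullback (hsm x) ((hγs (s x)).contract hX)]
    have h3 : (pullback s (contract X γ) : DForm (Vec n) M 1) =ᶠ[𝓝 x] 0 := by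
      have hq : ∀ᶠ q in 𝓝 (s x), γ q = pullback (chartAt (ConnMetricModel n) (s x)) (torM φ) q ∧
          q.base ∈ (chartAt (Vec n) (s x).base).source :=
        hγ'.and (((connB (Vec n)).prod (metricB (minkowski n))).isOpen_baseSource _
          (chartAt (Vec n) (s x).base).open_source |>.mem_nhds (mem_chart_source (Vec n) _))
      filter_upwards [hs.continuous.continuousAt.eventually hq] with y hy
      ext w
      rw [pullback_apply_vec, contract_apply, hy.1]
      refine (torM_bchart (chart_mem_atlas (Vec n) (s x).base) φ hy.2 _).trans ?_
      rw [Fin.cons_zero, hXv]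
      simp
    rw [extD_congr h3, extD_zero]
    rfl
  have h3 : (pullback s (contract X (extD γ)) : DForm (Vec n) M 2) x = 0 := by
    have h4 : (pullback s (contract X (extD γ)) : DForm (Vec n) M 2) x +
      (pullback s (extD (contract X γ)) : DForm (Vec n) M 2) x = 0 := h1
    rwa [h2, add_zero] at h4
  have h4 := congrArg (fun a : Vec n [⋀^Fin 2]→L[ℝ] ℝ => a ![u, v]) h3
  change (pullback s (contract X (extD γ)) : DForm (Vec n) M 2) x ![u, v] = 0 at h4
  rw [pullback_apply_vec, contract_apply, extD_of_chartAt hγ' (formSmoothAt_of_contDiffOn isOpen_univ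
    (contDiff_torM φ).contDiffOn trivial), extDeriv_torM _ _ _ (by rw [Fin.cons_zero, hXv])] at h4
  change φ ((vecAt X (s x)).2.1 (tmap (Vec n) (ConnMetricModel n) s x u).1
      (tmap (Vec n) (ConnMetricModel n) s x v).1 -
    (vecAt X (s x)).2.1 (tmap (Vec n) (ConnMetricModel n) s x v).1
      (tmap (Vec n) (ConnMetricModel n) s x u).1) = 0 at h4
  rw [tmap_section_fst (hsm x) (Filter.Eventually.of_forall hb),
    tmap_section_fst (hsm x) (Filter.Eventually.of_forall hb), hφ] at h4
  exact hne (norm_eq_zero.1 (by exact_mod_cast h4))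

theorem rhoMap_retMap {q : ConnMetric n M} (h : ∀ u v, q.val.1 u v = q.val.1 v u) :
    rhoMap n M (retMap n M q) = q := by
  obtain ⟨x, ⟨Γ, g⟩, hq⟩ := q
  have h1 := leviCivita_parallelJet hq.2 h
  change (⟨x, (leviCivita g (parallelJet Γ g), g), _⟩ : ConnMetric n M) = _
  simp only [h1]

theorem retMap_rhoMap (j : MetricJet n M) : retMap n M (rhoMap n M j) = j := by
  obtain ⟨x, ⟨g, h⟩, hj⟩ := j
  have h1 := parallelJet_leviCivita hj h
  change (⟨x, (g, parallelJet (leviCivita g h) g), _⟩ : MetricJet n M) = _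
  simp only [h1]

theorem tmap_rhoMap_retMap {q : ConnMetric n M} (h : ∀ u v, q.val.1 u v = q.val.1 v u)
    {X : ConnMetricModel n} (hX : ∀ u v, X.2.1 u v = X.2.1 v u) :
    tmap (MetricJetModel n) (ConnMetricModel n) (rhoMap n M) (retMap n M q)
      (tmap (ConnMetricModel n) (MetricJetModel n) (retMap n M) q X) = X := by
  rw [tmap_retMap, tmap_rhoMap]
  refine Prod.ext rfl ?_
  set b := (connB (Vec n)).prod (metricB (minkowski n))
  have h1 : HasFDerivAt (retNat (minkowski n)).toFun
      (fderiv ℝ (retNat (minkowski n)).toFun q.val) q.val :=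
    (((retNat (minkowski n)).contDiffOn.contDiffAt (b.isOpen_fib.mem_nhds q.mem)).differentiableAt
      (by simp)).hasFDerivAt
  have h2 : HasFDerivAt (rhoNat (minkowski n)).toFun
      (fderiv ℝ (rhoNat (minkowski n)).toFun (retMap n M q).val)
      ((retNat (minkowski n)).toFun q.val) :=
    (((rhoNat (minkowski n)).contDiffOn.contDiffAt
      ((metricJet (minkowski n)).isOpen_fib.mem_nhds (retMap n M q).mem)).differentiableAt
      (by simp)).hasFDerivAt
  have h3 := HasFDerivAt.comp (g := (rhoNat (minkowski n)).toFun) q.val h2 h1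
  have hline : HasDerivAt (fun t : ℝ => q.val + t • X.2) X.2 0 := by
    simpa using ((hasDerivAt_id (0 : ℝ)).smul_const X.2).const_add q.val
  have h0 : q.val = q.val + (0 : ℝ) • X.2 := by simp
  have h4 := HasFDerivAt.comp_hasDerivAt_of_eq (0 : ℝ) h3 hline h0
  have h5 : (fun t : ℝ => ((rhoNat (minkowski n)).toFun ∘ (retNat (minkowski n)).toFun)
      (q.val + t • X.2)) =ᶠ[𝓝 0] fun t => q.val + t • X.2 := by
    have h6 : ∀ᶠ t : ℝ in 𝓝 0, q.val + t • X.2 ∈ b.fib := by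
      have hcont : ContinuousAt (fun t : ℝ => q.val + t • X.2) 0 := hline.continuousAt
      refine hcont.eventually (b.isOpen_fib.mem_nhds ?_)
      simpa using q.mem
    filter_upwards [h6] with t ht
    refine Prod.ext (leviCivita_parallelJet ht.2 fun u v => ?_) rfl
    change q.val.1 u v + t • X.2.1 u v = q.val.1 v u + t • X.2.1 v u
    rw [h, hX]
  exact (h4.congr_of_eventuallyEq h5.symm).unique hline

end Correspondence

section Transport

variable {E : Type} [NormedAddCommGroup E] [NormedSpace ℝ E] {N N' : Type*} [TopologicalSpace N]
  [TopologicalSpace N'] [ChartedSpace E N]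

/-- The manifold structure transported along a homeomorphism. -/
abbrev transportChartedSpace (Φ : N' ≃ₜ N) : ChartedSpace E N' where
  atlas := Φ.transOpenPartialHomeomorph '' atlas E N
  chartAt q := Φ.transOpenPartialHomeomorph (chartAt E (Φ q))
  mem_chart_source q := mem_chart_source E (Φ q)
  chart_mem_atlas q := ⟨_, chart_mem_atlas E (Φ q), rfl⟩

theorem isManifold_transport [IsManifold 𝓘(ℝ, E) ∞ N] (Φ : N' ≃ₜ N) :
    letI := transportChartedSpace (E := E) Φ
    IsManifold 𝓘(ℝ, E) ∞ N' := by
  let _ := transportChartedSpace (E := E) Φ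
  refine isManifold_of_contDiffOn _ _ _ ?_
  rintro _ _ ⟨c, hc, rfl⟩ ⟨c', hc', rfl⟩
  refine ((contDiffOn_change hc hc').congr fun y _ => ?_).mono fun y hy => ?_
  · change c' (Φ (Φ.symm (c.symm y))) = c' (c.symm y)
    rw [Φ.apply_symm_apply]
  · have h1 : y ∈ c.target ∧ Φ (Φ.symm (c.symm y)) ∈ c'.source := hy.1
    rw [Φ.apply_symm_apply] at h1
    simpa using h1

theorem contMDiff_transport [IsManifold 𝓘(ℝ, E) ∞ N] (Φ : N' ≃ₜ N) :
    letI := transportChartedSpace (E := E) Φ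
    ContMDiff 𝓘(ℝ, E) 𝓘(ℝ, E) ∞ Φ := by
  let _ := transportChartedSpace (E := E) Φ
  have := isManifold_transport (E := E) Φ
  intro q
  have h1 := mapSmoothAt_chart (chart_mem_atlas E q) (mem_chart_source E q)
  have h2 := mapSmoothAt_chart_symm (chart_mem_atlas E (Φ q)) (mem_chart_target E (Φ q))
  refine ((MapSmoothAt.comp (f := (chartAt E (Φ q)).symm) (g := chartAt E q) h2 h1).congr
    ?_).contMDiffAt
  filter_upwards [(chartAt E q).open_source.mem_nhds (mem_chart_source E q)] with y hy
  exact ((chartAt E (Φ q)).left_inv hy).symm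

theorem contMDiff_transport_symm [IsManifold 𝓘(ℝ, E) ∞ N] (Φ : N' ≃ₜ N) :
    letI := transportChartedSpace (E := E) Φ
    ContMDiff 𝓘(ℝ, E) 𝓘(ℝ, E) ∞ Φ.symm := by
  let _ := transportChartedSpace (E := E) Φ
  have := isManifold_transport (E := E) Φ
  intro p
  have hc : Φ.transOpenPartialHomeomorph (chartAt E p) ∈ atlas E N' := ⟨_, chart_mem_atlas E p, rfl⟩
  have h1 := mapSmoothAt_chart (chart_mem_atlas E p) (mem_chart_source E p)
  have h2 := mapSmoothAt_chart_symm hc (y := chartAt E p p) (mem_chart_target E p)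
  refine ((MapSmoothAt.comp (f := (Φ.transOpenPartialHomeomorph (chartAt E p)).symm)
    (g := chartAt E p) h2 h1).congr ?_).contMDiffAt
  filter_upwards [(chartAt E p).open_source.mem_nhds (mem_chart_source E p)] with y hy
  exact congrArg Φ.symm ((chartAt E p).left_inv hy).symm

end Transport

section LeviCivitaSubmanifold

variable {n : ℕ} {M : Type*} [TopologicalSpace M] [ChartedSpace (Vec n) M] [IsManifold (𝓡 n) ∞ M]

variable (n M) in
/-- `J¹Σ → C(LM) ×_M J¹Σ`, given by the Levi-Civita connection. -/
abbrev sigMap : MetricJet n M → ConnMetricJet n M := (sigNat (minkowski n)).tot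

theorem contMDiff_sigMap :
    ContMDiff 𝓘(ℝ, MetricJetModel n) 𝓘(ℝ, ConnMetricJetModel n) ∞ (sigMap n M) :=
  (sigNat (minkowski n)).contMDiff_tot

theorem contMDiff_p2 :
    ContMDiff 𝓘(ℝ, ConnMetricJetModel n) 𝓘(ℝ, MetricJetModel n) ∞ (p2 : ConnMetricJet n M → _) :=
  (p2Nat (minkowski n)).contMDiff_tot

theorem contMDiff_projCM :
    ContMDiff 𝓘(ℝ, ConnMetricJetModel n) 𝓘(ℝ, ConnMetricModel n) ∞
      (projCM : ConnMetricJet n M → _) :=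
  (projNat (minkowski n)).contMDiff_tot

variable (n M) in
/-- The submanifold of `C(LM) ×_M J¹Σ` on which the connection is the Levi-Civita connection. -/
def lcSet : Set (ConnMetricJet n M) := {q | sigMap n M (p2 q) = q}

theorem sigMap_mem (j : MetricJet n M) : sigMap n M j ∈ lcSet n M := rfl

variable (n M) in
/-- `p₂` restricted to `lcSet`. -/
def lcHomeo : lcSet n M ≃ₜ MetricJet n M where
  toFun q := p2 q.1
  invFun j := ⟨sigMap n M j, sigMap_mem j⟩
  left_inv q := Subtype.ext q.2
  right_inv _ := rfl
  continuous_toFun := contMDiff_p2.continuous.comp continuous_subtype_val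
  continuous_invFun := contMDiff_sigMap.continuous.subtype_mk _

instance : ChartedSpace (MetricJetModel n) (lcSet n M) := transportChartedSpace (lcHomeo n M)

instance : IsManifold 𝓘(ℝ, MetricJetModel n) ∞ (lcSet n M) := isManifold_transport (lcHomeo n M)

theorem contMDiff_lcHomeo :
    ContMDiff 𝓘(ℝ, MetricJetModel n) 𝓘(ℝ, MetricJetModel n) ∞ (lcHomeo n M) :=
  contMDiff_transport (lcHomeo n M)

theorem contMDiff_lcHomeo_symm :
    ContMDiff 𝓘(ℝ, MetricJetModel n) 𝓘(ℝ, MetricJetModel n) ∞ (lcHomeo n M).symm :=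
  contMDiff_transport_symm (lcHomeo n M)

theorem contMDiff_lcSet_val :
    ContMDiff 𝓘(ℝ, MetricJetModel n) 𝓘(ℝ, ConnMetricJetModel n) ∞
      (Subtype.val : lcSet n M → ConnMetricJet n M) :=
  (contMDiff_sigMap.comp contMDiff_lcHomeo).congr fun q => q.2.symm

variable (n) in
/-- Subtraction of the Levi-Civita connection, in coordinates. -/
def shear : OpenPartialHomeomorph (ConnMetricJetModel n) (ConnMetricJetModel n) where
  toFun y := (y.1, y.2.1 - leviCivita y.2.2.1 y.2.2.2, y.2.2)
  invFun y := (y.1, y.2.1 + leviCivita y.2.2.1 y.2.2.2, y.2.2)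
  source := {y | y.2.2 ∈ (metricJet (minkowski n)).fib}
  target := {y | y.2.2 ∈ (metricJet (minkowski n)).fib}
  map_source' _ h := h
  map_target' _ h := h
  left_inv' y _ := by simp
  right_inv' y _ := by simp
  open_source := (metricJet (minkowski n)).isOpen_fib.preimage (by fun_prop)
  open_target := (metricJet (minkowski n)).isOpen_fib.preimage (by fun_prop)
  continuousOn_toFun := by
    have h : ContinuousOn (fun y : ConnMetricJetModel n => leviCivita y.2.2.1 y.2.2.2)
      {y | y.2.2 ∈ (metricJet (minkowski n)).fib} :=
        (contDiffOn_leviCivita (minkowski n)).continuousOn.comp (by fun_prop) fun _ h => h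
    fun_prop
  continuousOn_invFun := by
    have h : ContinuousOn (fun y : ConnMetricJetModel n => leviCivita y.2.2.1 y.2.2.2)
      {y | y.2.2 ∈ (metricJet (minkowski n)).fib} :=
        (contDiffOn_leviCivita (minkowski n)).continuousOn.comp (by fun_prop) fun _ h => h
    fun_prop

theorem contDiffOn_leviCivita_model :
    ContDiffOn ℝ ∞ (fun y : ConnMetricJetModel n => leviCivita y.2.2.1 y.2.2.2)
      {y | y.2.2 ∈ (metricJet (minkowski n)).fib} :=
  (contDiffOn_leviCivita (minkowski n)).comp (by fun_prop) fun _ h => h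

theorem contDiffOn_shear : ContDiffOn ℝ ∞ (shear n) (shear n).source := by
  have h := contDiffOn_leviCivita_model (n := n)
  change ContDiffOn ℝ ∞ (fun y : ConnMetricJetModel n =>
    (y.1, y.2.1 - leviCivita y.2.2.1 y.2.2.2, y.2.2)) {y | y.2.2 ∈ (metricJet (minkowski n)).fib}
  fun_prop

theorem contDiffOn_shear_symm : ContDiffOn ℝ ∞ (shear n).symm (shear n).target := by
  have h := contDiffOn_leviCivita_model (n := n)
  change ContDiffOn ℝ ∞ (fun y : ConnMetricJetModel n =>
    (y.1, y.2.1 + leviCivita y.2.2.1 y.2.2.2, y.2.2)) {y | y.2.2 ∈ (metricJet (minkowski n)).fib}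
  fun_prop

theorem bchart_trans_shear_mem {c : OpenPartialHomeomorph M (Vec n)} (hc : c ∈ atlas (Vec n) M) :
    ((connB (Vec n)).prod (metricJet (minkowski n))).bchart c hc ≫ₕ shear n ∈
      IsManifold.maximalAtlas 𝓘(ℝ, ConnMetricJetModel n) ∞ (ConnMetricJet n M) := by
  set b := ((connB (Vec n)).prod (metricJet (minkowski n))).bchart c hc
  have hb : b ∈ IsManifold.maximalAtlas 𝓘(ℝ, ConnMetricJetModel n) ∞ (ConnMetricJet n M) :=
    IsManifold.subset_maximalAtlas (NatBundle.bchart_mem_atlas _ hc)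
  refine OpenPartialHomeomorph.mem_maximalAtlas_of_contMDiffOn (I := 𝓘(ℝ, ConnMetricJetModel n))
    (n := ∞) (b ≫ₕ shear n) ?_ ?_
  · exact contDiffOn_shear.contMDiffOn.comp ((contMDiffOn_of_mem_maximalAtlas hb).mono
      fun q hq => (by simpa using hq.1)) fun q hq => (by simpa using hq.2)
  · refine (contMDiffOn_symm_of_mem_maximalAtlas hb).comp (contDiffOn_shear_symm.contMDiffOn.mono
      fun q hq => (by simpa using hq.1)) fun q hq => (by simpa using hq.2)

variable (n) in
/-- Reordering of the coordinates. -/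
def reorder : (MetricJetModel n × Op2 (Vec n)) ≃L[ℝ] ConnMetricJetModel n :=
  ContinuousLinearEquiv.equivOfInverse
    ((ContinuousLinearMap.fst ℝ _ _ ∘L ContinuousLinearMap.fst ℝ _ _).prod
      ((ContinuousLinearMap.snd ℝ _ _).prod
        (ContinuousLinearMap.snd ℝ _ _ ∘L ContinuousLinearMap.fst ℝ _ _)))
    (((ContinuousLinearMap.fst ℝ _ _).prod
      (ContinuousLinearMap.snd ℝ _ _ ∘L ContinuousLinearMap.snd ℝ _ _)).prod
        (ContinuousLinearMap.fst ℝ _ _ ∘L ContinuousLinearMap.snd ℝ _ _))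
    (fun _ => rfl) (fun _ => rfl)

theorem isSmoothEmbedding_lcSet_val :
    Manifold.IsSmoothEmbedding 𝓘(ℝ, MetricJetModel n) 𝓘(ℝ, ConnMetricJetModel n) ∞
      (Subtype.val : lcSet n M → ConnMetricJet n M) := by
  refine ⟨Manifold.IsImmersionOfComplement.isImmersion (F := Op2 (Vec n)) fun q => ?_,
    Topology.IsEmbedding.subtypeVal⟩
  set c := chartAt (Vec n) q.1.base
  have hc : c ∈ atlas (Vec n) M := chart_mem_atlas _ _
  have hq : q.1.base ∈ c.source := mem_chart_source _ _
  set b := ((connB (Vec n)).prod (metricJet (minkowski n))).bchart c hc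
  set b' := (metricJet (minkowski n)).bchart c hc
  refine Manifold.IsImmersionAtOfComplement.mk_of_continuousAt continuous_subtype_val.continuousAt
    (reorder n) (chartAt (MetricJetModel n) q) (b ≫ₕ shear n) (mem_chart_source _ _) ?_
    (IsManifold.chart_mem_maximalAtlas q) (bchart_trans_shear_mem hc) ?_
  · rw [OpenPartialHomeomorph.trans_source]
    exact ⟨hq, (b.map_source hq).2.2⟩
  · intro y hy
    have hy' : y ∈ b'.target := by
      have h0 : y ∈ (chartAt (MetricJetModel n) q).target := by simpa using hy
      exact h0
    have h1 : b (sigMap n M (b'.symm y)) = (y.1, leviCivita y.2.1 y.2.2, y.2) := by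
      have h2 : (b'.symm y).base ∈ c.source := b'.map_target hy'
      refine ((sigNat (minkowski n)).bchart_tot hc h2).trans ?_
      have h3 : b' (b'.symm y) = y := b'.right_inv hy'
      rw [h3]
      rfl
    have h4 : (shear n) (b (sigMap n M (b'.symm y))) = reorder n (y, 0) := by
      rw [h1]
      refine Prod.ext rfl (Prod.ext (sub_self _) rfl)
    exact h4

end LeviCivitaSubmanifold

section IntegralManifolds

theorem pullback_pullback {E E' E'' : Type*} [NormedAddCommGroup E] [NormedSpace ℝ E]
    [NormedAddCommGroup E'] [NormedSpace ℝ E'] [NormedAddCommGroup E''] [NormedSpace ℝ E'']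
    {N N' N'' : Type*} [TopologicalSpace N] [ChartedSpace E N] [TopologicalSpace N']
    [ChartedSpace E' N'] [TopologicalSpace N''] [ChartedSpace E'' N''] {k : ℕ}
    {f : N' → N} {g : N'' → N'} (hf : ContMDiff 𝓘(ℝ, E') 𝓘(ℝ, E) ∞ f)
    (hg : ContMDiff 𝓘(ℝ, E'') 𝓘(ℝ, E') ∞ g) (α : DForm E N k) :
    (pullback g (pullback f α : DForm E' N' k) : DForm E'' N'' k) =
      pullback (fun y => f (g y)) α :=
  funext fun y => (pullback_comp (hf.mapSmoothAt _).mdifferentiableAt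
    (hg.mapSmoothAt y).mdifferentiableAt α).symm

variable {n : ℕ} {M : Type*} [TopologicalSpace M] [ChartedSpace (Vec n) M] [IsManifold (𝓡 n) ∞ M]

theorem IsIntegralAt.comp {E E' : Type*} [NormedAddCommGroup E] [NormedSpace ℝ E]
    [NormedAddCommGroup E'] [NormedSpace ℝ E'] {Λ Λ' : Type*} [TopologicalSpace Λ]
    [ChartedSpace E Λ] [TopologicalSpace Λ'] [ChartedSpace E' Λ'] {I : FormSet E Λ}
    {I' : FormSet E' Λ'} {f : Λ' → Λ} {s : M → Λ'} {x : M} (h : IsIntegralAt (n := n) I' s x)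
    (hf : ContMDiff 𝓘(ℝ, E') 𝓘(ℝ, E) ∞ f) (hs : MapSmoothAt (Vec n) E' s x)
    (hI : ∀ a ∈ I, (⟨a.1, pullback f a.2⟩ : Σ k : ℕ, DForm E' Λ' k) ∈ I') :
    IsIntegralAt (n := n) I (fun y => f (s y)) x := fun a ha =>
  (pullback_comp (hf.mapSmoothAt _).mdifferentiableAt hs.mdifferentiableAt a.2).trans
    (h _ (hI a ha))

theorem pullback_p2_mem {a : Σ k : ℕ, DForm (MetricJetModel n) (MetricJet n M) k}
    (ha : a ∈ contactEDS n M) : (⟨a.1, pullback p2 a.2⟩ :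
      Σ k : ℕ, DForm (ConnMetricJetModel n) (ConnMetricJet n M) k) ∈ idealJ n M :=
  diffIdeal.of _ (Or.inl ⟨a, ha, rfl⟩)

theorem pullback_projCM_mem {a : Σ k : ℕ, DForm (ConnMetricModel n) (ConnMetric n M) k}
    (ha : a ∈ reducedPalatiniEDS n M) : (⟨a.1, pullback projCM a.2⟩ :
      Σ k : ℕ, DForm (ConnMetricJetModel n) (ConnMetricJet n M) k) ∈ idealJ n M :=
  diffIdeal.of _ (Or.inr ⟨a, ha, rfl⟩)

theorem idealJ_generators_smooth :
    ∀ a ∈ (pullbackSet p2 (contactEDS n M) ∪ pullbackSet projCM (reducedPalatiniEDS n M) :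
      FormSet (ConnMetricJetModel n) (ConnMetricJet n M)), IsSmoothForm a.2 := by
  rintro _ (⟨a, ha, rfl⟩ | ⟨a, ha, rfl⟩)
  · exact isSmoothForm_iff.2 fun q => (isSmoothForm_iff.1 (isSmoothForm_contactEDS ha) _).pullback
      (contMDiff_p2.mapSmoothAt q)
  · exact isSmoothForm_iff.2 fun q =>
      (isSmoothForm_iff.1 (isSmoothForm_reducedPalatiniEDS ha) _).pullback
        (contMDiff_projCM.mapSmoothAt q)

theorem pullback_sigMap_mem [T2Space M]
    {a : Σ k : ℕ, DForm (ConnMetricJetModel n) (ConnMetricJet n M) k} (ha : a ∈ idealJ n M) :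
    (⟨a.1, pullback (sigMap n M) a.2⟩ : Σ k : ℕ, DForm (MetricJetModel n) (MetricJet n M) k) ∈
      contactEDS n M := by
  refine mem_diffIdeal_pullback idealJ_generators_smooth contMDiff_sigMap ?_ ha
  rintro _ (⟨a, ha, rfl⟩ | ⟨a, ha, rfl⟩) j
  · refine LocallyIn.of_mem ?_
    rw [pullback_pullback contMDiff_p2 contMDiff_sigMap]
    have h : (pullback (fun j => p2 (sigMap n M j)) a.2 : DForm (MetricJetModel n) _ a.1) = a.2 :=
      pullback_id a.2
    rw [h]
    exact ha
  · refine LocallyIn.of_mem ?_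
    rw [pullback_pullback contMDiff_projCM contMDiff_sigMap]
    exact pullback_rhoMap_mem ha

theorem pullbackSet_lcSet [T2Space M] :
    (pullbackSet (fun q : lcSet n M => p2 q.1) (contactEDS n M) :
        FormSet (MetricJetModel n) (lcSet n M)) =
      pullbackSet (Subtype.val : lcSet n M → ConnMetricJet n M) (idealJ n M) := by
  refine Set.Subset.antisymm ?_ ?_
  · rintro _ ⟨a, ha, rfl⟩
    exact ⟨_, pullback_p2_mem ha, congrArg (Sigma.mk a.1)
      (pullback_pullback contMDiff_p2 contMDiff_lcSet_val a.2)⟩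
  · rintro _ ⟨a, ha, rfl⟩
    refine ⟨_, pullback_sigMap_mem ha, ?_⟩
    have h := pullback_pullback contMDiff_sigMap (contMDiff_lcHomeo (n := n) (M := M)) a.2
    have h2 : (fun q : lcSet n M => sigMap n M (lcHomeo n M q)) = Subtype.val :=
      funext fun q => q.2
    rw [h2] at h
    exact congrArg (Sigma.mk a.1) h

theorem tmap_p2 (q : ConnMetricJet n M) (v : ConnMetricJetModel n) :
    tmap (ConnMetricJetModel n) (MetricJetModel n) p2 q v = (v.1, v.2.2) := by
  refine ((p2Nat (minkowski n)).tmap_tot q v).trans ?_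
  have h : HasFDerivAt (p2Nat (minkowski n)).toFun (ContinuousLinearMap.snd ℝ (Op2 (Vec n))
      (SymBil (Vec n) × (Vec n →L[ℝ] SymBil (Vec n)))) q.val := hasFDerivAt_snd
  rw [h.fderiv]
  rfl

theorem tmap_projCM (q : ConnMetricJet n M) (v : ConnMetricJetModel n) :
    tmap (ConnMetricJetModel n) (ConnMetricModel n) projCM q v = (v.1, v.2.1, v.2.2.1) := by
  refine ((projNat (minkowski n)).tmap_tot q v).trans ?_
  have h : HasFDerivAt (projNat (minkowski n)).toFun ((ContinuousLinearMap.fst ℝ (Op2 (Vec n))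
      (SymBil (Vec n) × (Vec n →L[ℝ] SymBil (Vec n)))).prod (ContinuousLinearMap.fst ℝ _ _ ∘L
      ContinuousLinearMap.snd ℝ _ _)) q.val :=
    hasFDerivAt_fst.prodMk (hasFDerivAt_fst.comp q.val hasFDerivAt_snd)
  rw [h.fderiv]
  rfl

theorem mem_lcSet {q : ConnMetricJet n M} (h1 : ∀ u v, q.val.1 u v = q.val.1 v u)
    (h2 : q.val.2.2 = parallelJet q.val.1 q.val.2.1) : q ∈ lcSet n M := by
  obtain ⟨x, ⟨Γ, g, h⟩, hq⟩ := q
  have h3 := leviCivita_parallelJet hq.2 h1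
  have h2' : h = parallelJet Γ g := h2
  subst h2'
  change (⟨x, (leviCivita g (parallelJet Γ g), g, parallelJet Γ g), _⟩ : ConnMetricJet n M) = _
  simp only [h3]

theorem containsIntegralManifolds_lcSet [T2Space M] : ContainsIntegralManifolds (lcSet n M) := by
  intro U s hU hs hb hInt x hx
  have hsm : MapSmoothAt (Vec n) (ConnMetricJetModel n) s x := hs.mapSmoothAt hU hx
  have hbx : ∀ᶠ y in 𝓝 x, (s y).base = y := by filter_upwards [hU.mem_nhds hx] with y hy using hb y hy
  have h2 : IsIntegralAt (n := n) (contactEDS n M) (fun y => p2 (s y)) x :=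
    (hInt x hx).comp contMDiff_p2 hsm fun a ha => pullback_p2_mem ha
  have h3 : IsIntegralAt (n := n) (reducedPalatiniEDS n M) (fun y => projCM (s y)) x :=
    (hInt x hx).comp contMDiff_projCM hsm fun a ha => pullback_projCM_mem ha
  have hpm : MapSmoothAt (Vec n) (ConnMetricModel n) (fun y => projCM (s y)) x :=
    (contMDiff_projCM.mapSmoothAt (s x)).comp hsm
  have h4 : IsIntegralAt (n := n) (contactEDS n M) (fun y => retMap n M (projCM (s y))) x :=
    h3.comp contMDiff_retMap hpm fun a ha => pullback_retMap_mem ha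
  refine mem_lcSet (conn_symm_of_isIntegralAt hpm hbx h3) (ContinuousLinearMap.ext fun u => ?_)
  have h5 := holonomic_of_isIntegralAt h2 u
  have h6 := holonomic_of_isIntegralAt h4 u
  have e2 := tmap_comp (f := p2) (g := s) (x := x)
    (contMDiff_p2.mapSmoothAt (s x)).mdifferentiableAt hsm.mdifferentiableAt
  have e3 := tmap_comp (f := projCM) (g := s) (x := x)
    (contMDiff_projCM.mapSmoothAt (s x)).mdifferentiableAt hsm.mdifferentiableAt
  have e4 := tmap_comp (f := retMap n M) (g := fun y => projCM (s y)) (x := x)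
    (contMDiff_retMap.mapSmoothAt _).mdifferentiableAt hpm.mdifferentiableAt
  have hw := tmap_section_fst hsm hbx u
  rw [e2, ContinuousLinearMap.comp_apply, tmap_p2, hw] at h5
  rw [e4, e3, ContinuousLinearMap.comp_apply, ContinuousLinearMap.comp_apply, tmap_projCM,
    tmap_retMap, hw] at h6
  have h7 := fderiv_retNat_fst (projCM (s x)).mem ((tmap (Vec n) (ConnMetricJetModel n) s x u).2.1,
    (tmap (Vec n) (ConnMetricJetModel n) s x u).2.2.1)
  exact (h5.symm.trans h7.symm).trans h6

/-- Every 1-jet of a metric is the value of a holonomic local section. -/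
theorem exists_holonomic_section [T2Space M] (j : MetricJet n M) :
    ∃ (U : Set M) (s : M → MetricJet n M), IsOpen U ∧ j.base ∈ U ∧ s j.base = j ∧
      (∀ x ∈ U, MapSmoothAt (Vec n) (MetricJetModel n) s x) ∧ (∀ x ∈ U, (s x).base = x) ∧
      ∀ x ∈ U, IsIntegralAt (n := n) (contactEDS n M) s x := by
  set c := chartAt (Vec n) j.base
  have hc : c ∈ atlas (Vec n) M := chart_mem_atlas _ _
  have hj : j.base ∈ c.source := mem_chart_source _ _
  set b := (metricJet (minkowski n)).bchart c hc
  have hb : b ∈ atlas (MetricJetModel n) (MetricJet n M) := NatBundle.bchart_mem_atlas _ hc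
  let G : Vec n → MetricJetModel n := fun y => (y, j.val.1 + j.val.2 (y - c j.base), j.val.2)
  have hG : ∀ y, HasFDerivAt G ((ContinuousLinearMap.id ℝ (Vec n)).prod (j.val.2.prod 0)) y := by
    intro y
    refine (hasFDerivAt_id y).prodMk (HasFDerivAt.prodMk ?_ (hasFDerivAt_const _ _))
    exact (j.val.2.hasFDerivAt.comp y ((hasFDerivAt_id y).sub_const _)).const_add _
  have hGs : ContDiff ℝ ∞ G := by fun_prop
  set V : Set (Vec n) := {y | G y ∈ b.target} with hV
  have hVo : IsOpen V := b.open_target.preimage hGs.continuous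
  set U : Set M := c.source ∩ c ⁻¹' V with hUdef
  have hUo : IsOpen U := c.isOpen_inter_preimage hVo
  have hGj : G (c j.base) = b j := by
    refine Eq.trans ?_ ((metricJet (minkowski n)).chartAt_self j).symm
    simp only [G, sub_self, map_zero, add_zero]
    rfl
  let s : M → MetricJet n M := fun x => b.symm (G (c x))
  have hcs : ∀ x ∈ U, MapSmoothAt (Vec n) (MetricJetModel n) (fun x => G (c x)) x := fun x hx =>
    MapSmoothAt.comp (hGs.contMDiff.mapSmoothAt _) (mapSmoothAt_chart hc hx.1)
  have hs : ∀ x ∈ U, MapSmoothAt (Vec n) (MetricJetModel n) s x := fun x hx =>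
    MapSmoothAt.comp (f := b.symm) (g := fun x => G (c x)) (mapSmoothAt_chart_symm hb hx.2) (hcs x hx)
  have hbase : ∀ x ∈ U, (s x).base = x := fun x hx =>
    (NatBundle.bchart_symm_base _ hc _).trans (c.left_inv hx.1)
  refine ⟨U, s, hUo, ⟨hj, ?_⟩, ?_, hs, hbase, fun x hx => isIntegralAt_of_holonomic hUo hs ?_ hx⟩
  · change G (c j.base) ∈ b.target
    rw [hGj]
    exact b.map_source hj
  · change b.symm (G (c j.base)) = j
    rw [hGj]
    exact b.left_inv hj
  intro x hx u
  have hsx : (s x).base ∈ c.source := by rw [hbase x hx]; exact hx.1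
  have h1 := contactM_bchart hc hsx (tmap (Vec n) (MetricJetModel n) s x u)
  have e1 := tmap_comp (f := b) (g := s) (x := x) (mapSmoothAt_chart hb hsx).mdifferentiableAt
    (hs x hx).mdifferentiableAt
  have e2 : (fun y => b (s y)) =ᶠ[𝓝 x] fun y => G (c y) := by
    filter_upwards [hUo.mem_nhds hx] with y hy using b.right_inv hy.2
  have e3 := tmap_comp (f := G) (g := c) (x := x)
    (hGs.contMDiff.mapSmoothAt _).mdifferentiableAt (mapSmoothAt_chart hc hx.1).mdifferentiableAt
  rw [tmap_congr e2, e3, tmap_eq_fderiv, (hG _).fderiv] at e1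
  have e4 : tmap (MetricJetModel n) (MetricJetModel n) b (s x)
      (tmap (Vec n) (MetricJetModel n) s x u) = (tmap (Vec n) (Vec n) c x u,
        j.val.2 (tmap (Vec n) (Vec n) c x u), 0) :=
    (congrArg (fun A : Vec n →L[ℝ] MetricJetModel n => A u) e1).symm
  have e5 : b (s x) = G (c x) := b.right_inv hx.2
  change contactM (b (s x)) (tmap (MetricJetModel n) (MetricJetModel n) b (s x)
      (tmap (Vec n) (MetricJetModel n) s x u)) = _ at h1
  rw [e4, e5, contactM_apply] at h1
  have h2 : (0 : SymBil (Vec n)) = _ := (sub_self _).symm.trans h1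
  set k := chartAt (Vec n) (s x).base
  have hk : k ∈ atlas (Vec n) M := chart_mem_atlas _ _
  have hxk : (s x).base ∈ k.source := mem_chart_source _ _
  have hJ : ∀ v, jac c k (s x).base (jac k c (s x).base v) = v := fun v => by
    rw [← mul_apply_eq_comp, jac_mul_jac hk hc hxk hsx, one_apply_eq_self]
  rw [← sub_eq_zero]
  set δ : SymBil (Vec n) := (tmap (Vec n) (MetricJetModel n) s x u).2.1 -
    (s x).val.2 (tmap (Vec n) (MetricJetModel n) s x u).1
  refine SymBil.ext' fun v w => ?_
  have hsym : pullB (jac c k (s x).base) (δ : Bil (Vec n)) ∈ symSub (Vec n) := fun v w =>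
    δ.symm (jac c k (s x).base v) (jac c k (s x).base w)
  have h3 := congrArg (fun g : SymBil (Vec n) => (g : Bil (Vec n)) (jac k c (s x).base v)
    (jac k c (s x).base w)) h2
  have h4 := congrArg (fun g : Bil (Vec n) => g (jac k c (s x).base v) (jac k c (s x).base w))
    (symPart_of_sym hsym)
  have h5 := h3.trans h4
  change (0 : ℝ) = (δ : Bil (Vec n)) (jac c k (s x).base (jac k c (s x).base v))
    (jac c k (s x).base (jac k c (s x).base w)) at h5
  rw [hJ, hJ] at h5
  exact h5.symm

theorem lcSet_subset [T2Space M] {N : Set (ConnMetricJet n M)} (hN : ContainsIntegralManifolds N) :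
    lcSet n M ⊆ N := by
  intro q hq
  obtain ⟨U, s, hU, hqU, hsq, hs, hb, hInt⟩ := exists_holonomic_section (p2 q)
  have h := hN U (fun x => sigMap n M (s x)) hU (fun x hx =>
    (MapSmoothAt.comp (contMDiff_sigMap.mapSmoothAt _) (hs x hx)).contMDiffAt.contMDiffWithinAt)
    hb (fun x hx => (hInt x hx).comp contMDiff_sigMap (hs x hx) fun a ha => pullback_sigMap_mem ha)
    _ hqU
  rw [hsq] at h
  have hq' : sigMap n M (p2 q) = q := hq
  rwa [hq'] at h

end IntegralManifolds

section PseudoOrthogonal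

variable {n : ℕ}

/-- The matrix of a linear map in the canonical basis. -/
def matOf (Λ : Op (Vec n)) : Matrix (Fin n) (Fin n) ℝ := Matrix.of fun i k => Λ (ε k) i

theorem matOf_eq_toMatrix (Λ : Op (Vec n)) :
    matOf Λ = LinearMap.toMatrix (EuclideanSpace.basisFun (Fin n) ℝ).toBasis
      (EuclideanSpace.basisFun (Fin n) ℝ).toBasis (Λ : Vec n →ₗ[ℝ] Vec n) := by
  ext i k
  rw [LinearMap.toMatrix_apply]
  simp [matOf]

theorem det_matOf (Λ : Op (Vec n)) : (matOf Λ).det = Λ.det := by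
  rw [matOf_eq_toMatrix, LinearMap.det_toMatrix]

theorem detForm_comp (Λ : Op (Vec n)) (v : Fin n → Vec n) :
    detForm n (fun i => Λ (v i)) = Λ.det * detForm n v :=
  Module.Basis.det_comp (EuclideanSpace.basisFun (Fin n) ℝ).toBasis (Λ : Vec n →ₗ[ℝ] Vec n) v

theorem diagonal_eta_mul_self :
    Matrix.diagonal (eta (n := n)) * Matrix.diagonal eta = 1 := by
  rw [Matrix.diagonal_mul_diagonal, ← Matrix.diagonal_one]
  exact congrArg Matrix.diagonal (funext eta_mul_self)

variable {Λ : Op (Vec n)}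

theorem transpose_matOf_mul (h : ∀ v w, etaBil n (Λ v) (Λ w) = etaBil n v w) :
    (matOf Λ).transpose * Matrix.diagonal eta * matOf Λ = Matrix.diagonal eta := by
  ext i j
  have h1 := h (ε i) (ε j)
  rw [etaBil_ε, etaBil_apply] at h1
  rw [Matrix.mul_apply, Matrix.diagonal_apply]
  simp only [Matrix.mul_diagonal, Matrix.transpose_apply, matOf, Matrix.of_apply]
  have h2 : ∑ x, (Λ (ε i) x * eta x) * Λ (ε j) x = eta j * (ε i : Vec n) j := by
    rw [← h1]
    exact Finset.sum_congr rfl fun x _ => by ring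
  rw [h2]
  by_cases hij : i = j
  · subst hij; simp
  · simp [hij, Ne.symm hij]

theorem matOf_mul_transpose (h : ∀ v w, etaBil n (Λ v) (Λ w) = etaBil n v w) :
    matOf Λ * Matrix.diagonal eta * (matOf Λ).transpose = Matrix.diagonal eta := by
  have h1 : (Matrix.diagonal eta * (matOf Λ).transpose * Matrix.diagonal eta) * matOf Λ = 1 := by
    rw [Matrix.mul_assoc, Matrix.mul_assoc, ← Matrix.mul_assoc _ _ (matOf Λ),
      transpose_matOf_mul h, diagonal_eta_mul_self]
  have h2 := mul_eq_one_comm.1 h1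
  calc matOf Λ * Matrix.diagonal eta * (matOf Λ).transpose
      = (matOf Λ * (Matrix.diagonal eta * (matOf Λ).transpose * Matrix.diagonal eta)) *
          Matrix.diagonal eta := by
        rw [Matrix.mul_assoc, Matrix.mul_assoc, Matrix.mul_assoc, Matrix.mul_assoc,
          diagonal_eta_mul_self, Matrix.mul_one]
    _ = Matrix.diagonal eta := by rw [h2, Matrix.one_mul]

theorem det_eq_one (h : ∀ v w, etaBil n (Λ v) (Λ w) = etaBil n v w) (hpos : 0 < Λ.det) :
    Λ.det = 1 := by
  have h1 := congrArg Matrix.det (transpose_matOf_mul h)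
  rw [Matrix.det_mul, Matrix.det_mul, Matrix.det_transpose, det_matOf] at h1
  have h2 := congrArg Matrix.det (diagonal_eta_mul_self (n := n))
  rw [Matrix.det_mul, Matrix.det_one] at h2
  have h3 : Λ.det * Λ.det = 1 := by
    linear_combination (Matrix.diagonal (eta (n := n))).det * h1 + (1 - Λ.det * Λ.det) * h2
  nlinarith

/-- The contraction of a bilinear form with the inverse of `η` is invariant. -/
theorem sum_eta_bilin (h : ∀ v w, etaBil n (Λ v) (Λ w) = etaBil n v w)
    (B : Vec n →ₗ[ℝ] Vec n →ₗ[ℝ] ℝ) :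
    ∑ k, eta k * B (Λ (ε k)) (Λ (ε k)) = ∑ k, eta k * B (ε k) (ε k) := by
  have h1 : ∀ k, B (Λ (ε k)) (Λ (ε k)) =
      ∑ i, ∑ j, Λ (ε k) i * Λ (ε k) j * B (ε i) (ε j) := by
    intro k
    conv_lhs => rw [← sum_smul_ε (Λ (ε k))]
    simp only [map_sum, map_smul, LinearMap.sum_apply, LinearMap.smul_apply, smul_eq_mul]
    rw [Finset.sum_comm]
    refine Finset.sum_congr rfl fun i _ => ?_
    rw [Finset.mul_sum]
    exact Finset.sum_congr rfl fun j _ => by ring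
  have h2 : ∀ i j, ∑ k, eta k * (Λ (ε k) i * Λ (ε k) j) = Matrix.diagonal eta i j := by
    intro i j
    rw [← matOf_mul_transpose h, Matrix.mul_apply]
    simp only [Matrix.mul_diagonal, Matrix.transpose_apply, matOf, Matrix.of_apply]
    exact Finset.sum_congr rfl fun k _ => by ring
  calc ∑ k, eta k * B (Λ (ε k)) (Λ (ε k))
      = ∑ i, ∑ j, (∑ k, eta k * (Λ (ε k) i * Λ (ε k) j)) * B (ε i) (ε j) := by
        simp only [h1, Finset.mul_sum, Finset.sum_mul]
        rw [Finset.sum_comm]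
        refine Finset.sum_congr rfl fun i _ => ?_
        rw [Finset.sum_comm]
        exact Finset.sum_congr rfl fun j _ => Finset.sum_congr rfl fun k _ => by ring
    _ = ∑ k, eta k * B (ε k) (ε k) := by
        refine Finset.sum_congr rfl fun i _ => ?_
        rw [Finset.sum_eq_single i]
        · rw [h2, Matrix.diagonal_apply_eq]
        · intro j _ hj
          rw [h2, Matrix.diagonal_apply_ne _ hj.symm, zero_mul]
        · simp

variable (n) in
/-- The reflection `diag(-1, 1, …, 1)`. -/
def timeReflection : Op (Vec n) :=
  ∑ i : Fin n, eta i • (EuclideanSpace.proj i : Vec n →L[ℝ] ℝ).smulRight (ε i : Vec n)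

theorem timeReflection_apply (v : Vec n) (i : Fin n) : timeReflection n v i = eta i * v i := by
  simp [timeReflection, Finset.sum_apply, Pi.single_apply]

theorem timeReflection_mul_self : timeReflection n * timeReflection n = 1 := by
  ext v i
  change timeReflection n (timeReflection n v) i = v i
  rw [timeReflection_apply, timeReflection_apply, ← mul_assoc, eta_mul_self, one_mul]

theorem etaBil_timeReflection (v w : Vec n) :
    etaBil n (timeReflection n v) (timeReflection n w) = etaBil n v w := by
  rw [etaBil_apply, etaBil_apply]
  refine Finset.sum_congr rfl fun i _ => ?_
  rw [timeReflection_apply, timeReflection_apply]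
  linear_combination (eta i * v i * w i) * eta_mul_self i

theorem det_timeReflection (m : ℕ) : (timeReflection (m + 2)).det = -1 := by
  rw [← det_matOf]
  have h : matOf (timeReflection (m + 2)) = Matrix.diagonal eta := by
    ext i j
    simp only [matOf, Matrix.of_apply, timeReflection_apply, Matrix.diagonal_apply]
    by_cases hij : i = j
    · subst hij; simp
    · simp [hij]
  rw [h, Matrix.det_diagonal, Fin.prod_univ_succ]
  simp [eta]

end PseudoOrthogonal

section Contraction

variable {m : ℕ}

/-- `∑ k, η_kk det(ε_k, A ε_k, z)`. -/
def etaDet (A : Op (Vec (m + 2))) (z : Fin m → Vec (m + 2)) : ℝ :=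
  ∑ k, eta k * detForm (m + 2) (Fin.cons (ε k) (Fin.cons (A (ε k)) z))

theorem etaDet_conj {Λ Λ' A : Op (Vec (m + 2))} (hΛ : Λ * Λ' = 1)
    (h : ∀ v w, etaBil (m + 2) (Λ v) (Λ w) = etaBil (m + 2) v w) (hdet : Λ.det = 1)
    (z : Fin m → Vec (m + 2)) :
    etaDet (Λ' * A * Λ) (fun i => Λ' (z i)) = etaDet A z := by
  have hΛ' : ∀ x, Λ (Λ' x) = x := fun x => by rw [← mul_apply_eq_comp, hΛ, one_apply_eq_self]
  let B : Vec (m + 2) →ₗ[ℝ] Vec (m + 2) →ₗ[ℝ] ℝ :=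
    LinearMap.mk₂ ℝ (fun x y => (((detForm (m + 2)).curryLeft x).curryLeft (A y)) z)
      (fun x x' y => by rw [map_add]; rfl) (fun r x y => by rw [map_smul]; rfl)
      (fun x y y' => by rw [map_add, map_add]; rfl) (fun r x y => by rw [map_smul, map_smul]; rfl)
  refine Eq.trans (Finset.sum_congr rfl fun k _ => ?_) (sum_eta_bilin h B)
  congr 1
  change _ = detForm (m + 2) (Fin.cons (Λ (ε k)) (Fin.cons (A (Λ (ε k))) z))
  have h1 := detForm_comp Λ (Fin.cons (ε k) (Fin.cons ((Λ' * A * Λ) (ε k)) fun i => Λ' (z i)))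
  rw [hdet, one_mul] at h1
  rw [← h1]
  congr 1
  funext i
  refine Fin.cases rfl (fun i => ?_) i
  refine Fin.cases ?_ (fun i => ?_) i
  · exact hΛ' _
  · exact hΛ' _

end Contraction

section Lagrangian

variable {m : ℕ} {M : Type*} [TopologicalSpace M] [ChartedSpace (Vec (m + 2)) M]
  [IsManifold (𝓡 (m + 2)) ∞ M]

theorem smul_wedgeAlt {E : Type*} [NormedAddCommGroup E] [NormedSpace ℝ E] {k l : ℕ} (r : ℝ)
    (a : E [⋀^Fin k]→L[ℝ] ℝ) (b : E [⋀^Fin l]→L[ℝ] ℝ) :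
    r • wedgeAlt a b = wedgeAlt (r • a) b := by
  ext v
  simp only [ContinuousAlternatingMap.smul_apply, wedgeAlt_apply, smul_eq_mul, Finset.mul_sum]
  exact Finset.sum_congr rfl fun σ _ => by ring

theorem palatiniLagrangian_apply (p : FrameJet (m + 2) M)
    (v : Fin (m + 2) → FrameJetModel (m + 2)) :
    palatiniLagrangian m M p v = ∑ kl : Fin (m + 2) × Fin (m + 2),
      wedgeAlt (eta kl.1 • thetaKL kl.1 kl.2 p) (curvature kl.2 kl.1 p) v := by
  rw [Fintype.sum_prod_type]
  simp only [palatiniLagrangian, Finset.sum_apply, ContinuousAlternatingMap.sum_apply]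
  refine Finset.sum_congr rfl fun k _ => Finset.sum_congr rfl fun l _ => ?_
  rw [← smul_wedgeAlt]
  rfl

/-- The curvature of the connection of a frame, as a linear map. -/
def curvOp (p : FrameJet (m + 2) M) (v : Fin 2 → FrameJetModel (m + 2)) : Op (Vec (m + 2)) :=
  curv (pH p).val.1 (v 0).1 (v 1).1
    (fderiv ℝ (pHNat (m + 2)).toFun p.val (v 0).2).1 (fderiv ℝ (pHNat (m + 2)).toFun p.val (v 1).2).1

theorem sum_thetaKL_curvature (p : FrameJet (m + 2) M) (a : Fin m → FrameJetModel (m + 2))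
    (b : Fin 2 → FrameJetModel (m + 2)) :
    ∑ kl : Fin (m + 2) × Fin (m + 2),
      (eta kl.1 • thetaKL kl.1 kl.2 p) a * curvature kl.2 kl.1 p b =
    etaDet (Ring.inverse p.val.1 * curvOp p b * p.val.1)
      (fun i => Ring.inverse p.val.1 (a i).1) := by
  rw [Fintype.sum_prod_type, etaDet]
  refine Finset.sum_congr rfl fun k _ => ?_
  let F : Vec (m + 2) →L[ℝ] ℝ := LinearMap.toContinuousLinearMap
    { toFun := fun y => (((detForm (m + 2)).curryLeft (ε k)).curryLeft y)
        (fun i => Ring.inverse p.val.1 (a i).1)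
      map_add' := fun y y' => by rw [map_add]; rfl
      map_smul' := fun r y => by rw [map_smul]; rfl }
  have h := sum_clm_ε F ((Ring.inverse p.val.1 * curvOp p b * p.val.1) (ε k))
  refine Eq.trans ?_ (congrArg (eta k * ·) h)
  simp only [Finset.mul_sum]
  refine Finset.sum_congr rfl fun l _ => ?_
  rw [curvature_apply, ← mul_assoc]
  rfl

/-- The Palatini Lagrangian takes the same values at positively oriented frames which are orthonormal
for the same metric. -/
theorem palatiniLagrangian_congr {p p' : FrameJet (m + 2) M} (hp : 0 < p.val.1.det)
    (hp' : 0 < p'.val.1.det) (hpp : pH p = pH p') {v v' : Fin (m + 2) → FrameJetModel (m + 2)}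
    (hv : ∀ i, tmap (FrameJetModel (m + 2)) (ConnMetricModel (m + 2)) pH p (v i) =
      tmap (FrameJetModel (m + 2)) (ConnMetricModel (m + 2)) pH p' (v' i)) :
    palatiniLagrangian m M p v = palatiniLagrangian m M p' v' := by
  simp only [tmap_pH] at hv
  have hv1 : ∀ i, (v i).1 = (v' i).1 := fun i => (Prod.ext_iff.1 (hv i)).1
  have hv2 : ∀ i, fderiv ℝ (pHNat (m + 2)).toFun p.val (v i).2 =
      fderiv ℝ (pHNat (m + 2)).toFun p'.val (v' i).2 := fun i => (Prod.ext_iff.1 (hv i)).2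
  rw [palatiniLagrangian_apply, palatiniLagrangian_apply]
  refine sum_wedgeAlt_congr _ fun f g => ?_
  rw [sum_thetaKL_curvature, sum_thetaKL_curvature]
  have hR : curvOp p (fun j => v (g j)) = curvOp p' (fun j => v' (g j)) := by
    simp only [curvOp, hpp, hv1, hv2]
  simp only [hR, hv1]
  set e := p.val.1
  set e' := p'.val.1
  have he : IsUnit e := p.mem
  have he' : IsUnit e' := p'.mem
  have k1 : Ring.inverse e * e = 1 := Ring.inverse_mul_cancel e he
  have k2 : e * Ring.inverse e = 1 := Ring.mul_inverse_cancel e he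
  have k3 : Ring.inverse e' * e' = 1 := Ring.inverse_mul_cancel e' he'
  have k4 : e' * Ring.inverse e' = 1 := Ring.mul_inverse_cancel e' he'
  have hm : frameMetric e = frameMetric e' := congrArg (fun q => q.val.2) hpp
  have hiso : ∀ x y, etaBil (m + 2) ((Ring.inverse e' * e) x) ((Ring.inverse e' * e) y) =
      etaBil (m + 2) x y := by
    intro x y
    have h1 := congrArg (fun g : SymBil (Vec (m + 2)) => (g : Bil (Vec (m + 2))) (e x) (e y)) hm
    simp only [frameMetric_apply, inverse_apply he] at h1
    exact h1.symm
  have hdet : (Ring.inverse e' * e).det = 1 := by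
    refine det_eq_one hiso ?_
    have h1 : (e' * (Ring.inverse e' * e)).det = e'.det * (Ring.inverse e' * e).det :=
      LinearMap.det_comp _ _
    rw [← mul_assoc, k4, one_mul] at h1
    rw [h1] at hp
    exact (pos_iff_pos_of_mul_pos hp).1 hp'
  have hc := etaDet_conj (Λ := Ring.inverse e' * e) (Λ' := Ring.inverse e * e')
    (A := Ring.inverse e' * curvOp p' (fun j => v' (g j)) * e')
    (by rw [mul_assoc, ← mul_assoc e, k2, one_mul, k3]) hiso hdet
    (fun i => Ring.inverse e' (v' (f i)).1)
  rw [← hc]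
  congr 1
  · simp only [mul_assoc]
    rw [← mul_assoc e' (Ring.inverse e') e, k4, one_mul, ← mul_assoc e' (Ring.inverse e'), k4, one_mul]
  · funext i
    rw [mul_apply_eq_comp, apply_inverse he']

/-- `θ_kl` in coordinates. -/
def thetaKLM (k l : Fin (m + 2)) : DForm (FrameJetModel (m + 2)) (FrameJetModel (m + 2)) m :=
  fun y => (((detForm (m + 2)).curryLeft (ε k)).curryLeft (ε l)).compContinuousLinearMap (thetaM y)

theorem thetaKLM_apply (k l : Fin (m + 2)) (y : FrameJetModel (m + 2))
    (v : Fin m → FrameJetModel (m + 2)) : thetaKLM k l y v =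
      ((detForm (m + 2)).curryLeft (ε k)).curryLeft (ε l) fun i => thetaM y (v i) := rfl

theorem thetaKL_apply (k l : Fin (m + 2)) (p : FrameJet (m + 2) M)
    (v : Fin m → FrameJetModel (m + 2)) : thetaKL k l p v =
      ((detForm (m + 2)).curryLeft (ε k)).curryLeft (ε l) fun i => thetaV p (v i) := rfl

theorem contDiffOn_compContinuousLinearMap {E E' G : Type*} [NormedAddCommGroup E]
    [NormedSpace ℝ E] [FiniteDimensional ℝ E] [NormedAddCommGroup E'] [NormedSpace ℝ E']
    [FiniteDimensional ℝ E'] [NormedAddCommGroup G] [NormedSpace ℝ G] {k : ℕ}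
    (κ : E [⋀^Fin k]→L[ℝ] ℝ) {U : Set G} (hU : IsOpen U) {f : G → E' →L[ℝ] E}
    (hf : ContDiffOn ℝ ∞ f U) :
    ContDiffOn ℝ ∞ (fun y => κ.compContinuousLinearMap (f y)) U := by
  intro y hy
  have h1 : ContDiffAt ℝ ∞ f y := hf.contDiffAt (hU.mem_nhds hy)
  have h2 : ContDiffAt ℝ ∞ (fun _ : G => κ) y := contDiffAt_const
  exact (h2.alternating_comp h1).contDiffWithinAt

theorem contDiffOn_thetaKLM (k l : Fin (m + 2)) :
    ContDiffOn ℝ ∞ (thetaKLM k l) {y | IsUnit y.2.1} :=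
  contDiffOn_compContinuousLinearMap _ isOpen_isUnit_model contDiffOn_thetaM

theorem thetaKL_eq_pullback {c : OpenPartialHomeomorph M (Vec (m + 2))}
    (hc : c ∈ atlas (Vec (m + 2)) M) (k l : Fin (m + 2)) {p : FrameJet (m + 2) M}
    (hp : p.base ∈ c.source) :
    thetaKL k l p = (pullback ((frameJet (Vec (m + 2))).bchart c hc) (thetaKLM k l) :
      DForm (FrameJetModel (m + 2)) (FrameJet (m + 2) M) m) p := by
  ext v
  rw [pullback_apply_vec, thetaKL_apply, thetaKLM_apply]
  congr 1
  funext i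
  exact (thetaM_bchart hc hp (v i)).symm

theorem isSmoothForm_thetaKL (k l : Fin (m + 2)) :
    IsSmoothForm (thetaKL k l : DForm (FrameJetModel (m + 2)) (FrameJet (m + 2) M) m) := by
  refine isSmoothForm_iff.2 fun p => ?_
  have hc := chart_mem_atlas (Vec (m + 2)) p.base
  have hp := mem_chart_source (Vec (m + 2)) p.base
  refine FormSmoothAt.congr (FormSmoothAt.pullback (formSmoothAt_of_contDiffOn isOpen_isUnit_model
    (contDiffOn_thetaKLM k l) (isUnit_bchart hc hp)) (mapSmoothAt_chart
      ((frameJet (Vec (m + 2))).bchart_mem_atlas hc) hp)) ?_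
  filter_upwards [((frameJet (Vec (m + 2))).bchart _ hc).open_source.mem_nhds hp] with q hq
  exact thetaKL_eq_pullback hc k l hq

variable (m M) in
theorem isSmoothForm_palatiniLagrangian : IsSmoothForm (palatiniLagrangian m M) := by
  refine isSmoothForm_iff.2 fun p => FormSmoothAt.sum fun k _ => FormSmoothAt.sum fun l _ => ?_
  exact FormSmoothAt.smul (f := fun _ => eta k) (contMDiff_const.mapSmoothAt p)
    ((isSmoothForm_iff.1 (isSmoothForm_thetaKL k l) p).wedge
      (isSmoothForm_iff.1 (isSmoothForm_curvature l k) p))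

theorem exists_positive_frame (q : ConnMetric (m + 2) M) :
    ∃ p : FrameJet (m + 2) M, 0 < p.val.1.det ∧ pH p = q := by
  obtain ⟨e, he, h⟩ := q.mem.2
  have hne : e.det ≠ 0 := by
    obtain ⟨e', he'⟩ := he.exists_right_inv
    have h1 : (e * e').det = e.det * e'.det := LinearMap.det_comp _ _
    rw [he'] at h1
    have h2 : (1 : Op (Vec (m + 2))).det = 1 := LinearMap.det_id
    intro h0
    rw [h0, h2, zero_mul] at h1
    exact one_ne_zero h1
  rcases lt_or_gt_of_ne hne with hneg | hpos
  · have hT : IsUnit (timeReflection (m + 2)) :=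
      ⟨⟨_, _, timeReflection_mul_self, timeReflection_mul_self⟩, rfl⟩
    obtain ⟨p, hp, hpq⟩ := exists_pH_eq q (he.mul hT) fun v w => by
      rw [mul_apply_eq_comp, mul_apply_eq_comp]
      exact (h _ _).trans (etaBil_timeReflection v w)
    refine ⟨p, ?_, hpq⟩
    have h1 : (e * timeReflection (m + 2)).det = e.det * (timeReflection (m + 2)).det :=
      LinearMap.det_comp _ _
    rw [hp, h1, det_timeReflection]
    linarith
  · obtain ⟨p, hp, hpq⟩ := exists_pH_eq q he h
    exact ⟨p, hp ▸ hpos, hpq⟩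

/-- A local section of `pH` through a positively oriented frame. -/
theorem exists_positive_section (q : ConnMetric (m + 2) M) :
    ∃ ℓ : ConnMetric (m + 2) M → FrameJet (m + 2) M,
      MapSmoothAt (ConnMetricModel (m + 2)) (FrameJetModel (m + 2)) ℓ q ∧ 0 < (ℓ q).val.1.det ∧
      ∀ᶠ q' in 𝓝 q, pH (ℓ q') = q' := by
  obtain ⟨p, hp, rfl⟩ := exists_positive_frame q
  obtain ⟨ℓ, h1, h2, h3⟩ := exists_local_section p
  exact ⟨ℓ, h1, by rwa [h2], h3⟩

theorem tmap_pH_section {ℓ : ConnMetric (m + 2) M → FrameJet (m + 2) M} {q : ConnMetric (m + 2) M}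
    (hℓ : MapSmoothAt (ConnMetricModel (m + 2)) (FrameJetModel (m + 2)) ℓ q)
    (h : ∀ᶠ q' in 𝓝 q, pH (ℓ q') = q') (v : ConnMetricModel (m + 2)) :
    tmap (FrameJetModel (m + 2)) (ConnMetricModel (m + 2)) pH (ℓ q)
      (tmap (ConnMetricModel (m + 2)) (FrameJetModel (m + 2)) ℓ q v) = v := by
  have h1 := tmap_comp (f := pH) (g := ℓ) (x := q) (contMDiff_pH.mapSmoothAt _).mdifferentiableAt
    hℓ.mdifferentiableAt
  have h2 : (fun q' => pH (ℓ q')) =ᶠ[𝓝 q] fun q' => q' := h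
  rw [tmap_congr h2, tmap_id] at h1
  exact (congrArg (fun A : ConnMetricModel (m + 2) →L[ℝ] ConnMetricModel (m + 2) => A v) h1).symm

variable (m M) in
/-- The reduced Palatini Lagrangian. -/
def reducedLagrangian : DForm (ConnMetricModel (m + 2)) (ConnMetric (m + 2) M) (m + 2) := fun q =>
  (pullback (exists_positive_section q).choose (palatiniLagrangian m M) :
    DForm (ConnMetricModel (m + 2)) (ConnMetric (m + 2) M) (m + 2)) q

theorem reducedLagrangian_apply {p : FrameJet (m + 2) M} (hp : 0 < p.val.1.det)
    {q : ConnMetric (m + 2) M} (hpq : pH p = q) {w : Fin (m + 2) → FrameJetModel (m + 2)}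
    {v : Fin (m + 2) → ConnMetricModel (m + 2)}
    (hw : ∀ i, tmap (FrameJetModel (m + 2)) (ConnMetricModel (m + 2)) pH p (w i) = v i) :
    reducedLagrangian m M q v = palatiniLagrangian m M p w := by
  obtain ⟨h1, h2, h3⟩ := (exists_positive_section q).choose_spec
  rw [reducedLagrangian, pullback_apply_vec]
  refine palatiniLagrangian_congr h2 hp (h3.self_of_nhds.trans hpq.symm) fun i => ?_
  rw [hw, tmap_pH_section h1 h3]

theorem pullback_pH_reducedLagrangian {p : FrameJet (m + 2) M} (hp : 0 < p.val.1.det) :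
    (pullback pH (reducedLagrangian m M) :
      DForm (FrameJetModel (m + 2)) (FrameJet (m + 2) M) (m + 2)) p =
      palatiniLagrangian m M p := by
  ext w
  rw [pullback_apply_vec]
  exact reducedLagrangian_apply hp rfl fun i => rfl

theorem eventually_det_pos (hM : IsOrientedAtlas (m + 2) M)
    {ℓ : ConnMetric (m + 2) M → FrameJet (m + 2) M} {q : ConnMetric (m + 2) M}
    (hℓ : ContinuousAt ℓ q) (hq : 0 < (ℓ q).val.1.det) : ∀ᶠ q' in 𝓝 q, 0 < (ℓ q').val.1.det := by
  set c := chartAt (Vec (m + 2)) (ℓ q).base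
  have hc : c ∈ atlas (Vec (m + 2)) M := chart_mem_atlas _ _
  have hx : (ℓ q).base ∈ c.source := mem_chart_source _ _
  set b := (frameJet (Vec (m + 2))).bchart c hc
  have h1 : ContinuousAt (fun q' => (b (ℓ q')).2.1.det) q := by
    have h2 : ContinuousAt (fun q' => b (ℓ q')) q :=
      ContinuousAt.comp (g := b) (b.continuousAt hx) hℓ
    exact ContinuousAt.comp (g := fun A : Op (Vec (m + 2)) => A.det)
      ContinuousLinearMap.continuous_det.continuousAt h2.snd.fst
  have h3 : (b (ℓ q)).2.1 = (ℓ q).val.1 :=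
    congrArg (fun y => y.2.1) ((frameJet (Vec (m + 2))).chartAt_self (ℓ q))
  have h4 : ∀ᶠ q' in 𝓝 q, 0 < (b (ℓ q')).2.1.det := 
    h1.eventually (lt_mem_nhds (lt_of_lt_of_eq hq (congrArg ContinuousLinearMap.det h3.symm)))
  filter_upwards [h4, hℓ.eventually (b.open_source.mem_nhds hx)] with q' h5 h6
  have h7 : (b (ℓ q')).2.1.det =
      (jac (chartAt (Vec (m + 2)) (ℓ q').base) c (ℓ q').base).det * (ℓ q').val.1.det :=
    LinearMap.det_comp _ _
  have h8 : 0 < (jac (chartAt (Vec (m + 2)) (ℓ q').base) c (ℓ q').base).det :=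
    hM _ (chart_mem_atlas _ _) _ hc _ ⟨mem_chart_source _ _, h6⟩
  rw [h7] at h5
  exact (pos_iff_pos_of_mul_pos h5).1 h8

theorem isSmoothForm_reducedLagrangian (hM : IsOrientedAtlas (m + 2) M) :
    IsSmoothForm (reducedLagrangian m M) := by
  refine isSmoothForm_iff.2 fun q => ?_
  obtain ⟨ℓ, h1, h2, h3⟩ := exists_positive_section q
  refine ((isSmoothForm_iff.1 (isSmoothForm_palatiniLagrangian m M) (ℓ q)).pullback h1).congr ?_
  filter_upwards [h1.eventually, h3.eventually_nhds,
    eventually_det_pos hM h1.contMDiffAt.continuousAt h2] with q' h4 h5 h6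
  ext v
  rw [pullback_apply_vec]
  exact reducedLagrangian_apply h6 h5.self_of_nhds fun i => tmap_pH_section h4 h5 (v i)

theorem isReducedLagrangian_reducedLagrangian (hM : IsOrientedAtlas (m + 2) M) :
    IsReducedLagrangian (reducedLagrangian m M) :=
  ⟨isSmoothForm_reducedLagrangian hM, fun _ hp => pullback_pH_reducedLagrangian hp⟩

theorem IsReducedLagrangian.eq
    {lam : DForm (ConnMetricModel (m + 2)) (ConnMetric (m + 2) M) (m + 2)}
    (h : IsReducedLagrangian lam) : lam = reducedLagrangian m M := by
  funext q
  ext v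
  obtain ⟨ℓ, h1, h2, h3⟩ := exists_positive_section q
  have h4 := congrArg (fun a : FrameJetModel (m + 2) [⋀^Fin (m + 2)]→L[ℝ] ℝ => a fun i =>
    tmap (ConnMetricModel (m + 2)) (FrameJetModel (m + 2)) ℓ q (v i)) (h.2 (ℓ q) h2)
  simp only [pullback_apply_vec, tmap_pH_section h1 h3, h3.self_of_nhds] at h4
  rw [h4]
  exact (reducedLagrangian_apply h2 h3.self_of_nhds fun i => tmap_pH_section h1 h3 (v i)).symm

end Lagrangian

section Extremals

variable {n : ℕ} {M : Type*} [TopologicalSpace M] [ChartedSpace (Vec n) M] [IsManifold (𝓡 n) ∞ M]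

theorem contMDiff_projCM_val :
    ContMDiff 𝓘(ℝ, MetricJetModel n) 𝓘(ℝ, ConnMetricModel n) ∞
      (fun q : lcSet n M => projCM q.1) :=
  contMDiff_projCM.comp contMDiff_lcSet_val

theorem rhoMap_p2 (q : lcSet n M) : rhoMap n M (p2 q.1) = projCM q.1 :=
  congrArg projCM (show sigMap n M (p2 q.1) = q.1 from q.2)

theorem pullback_p2_pullback_rhoMap {k : ℕ} (α : DForm (ConnMetricModel n) (ConnMetric n M) k) :
    (pullback (fun q : lcSet n M => p2 q.1) (pullback (rhoMap n M) α :
      DForm (MetricJetModel n) (MetricJet n M) k) : DForm (MetricJetModel n) (lcSet n M) k) =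
    pullback (fun q : lcSet n M => projCM q.1) α := by
  have h := pullback_pullback contMDiff_rhoMap (contMDiff_lcHomeo (n := n) (M := M)) α
  have h2 : (fun q : lcSet n M => rhoMap n M (lcHomeo n M q)) = fun q => projCM q.1 :=
    funext rhoMap_p2
  rw [h2] at h
  exact h

theorem pullback_lcHomeo_symm {k : ℕ} (α : DForm (MetricJetModel n) (MetricJet n M) k) :
    (pullback (lcHomeo n M).symm (pullback (fun q : lcSet n M => p2 q.1) α :
      DForm (MetricJetModel n) (lcSet n M) k) : DForm (MetricJetModel n) (MetricJet n M) k) = α :=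
  (pullback_pullback contMDiff_lcHomeo (contMDiff_lcHomeo_symm (n := n) (M := M)) α).trans
    (pullback_id α)

theorem pullback_p2_eq_iff {k : ℕ} (α : DForm (MetricJetModel n) (MetricJet n M) k)
    (β : DForm (ConnMetricModel n) (ConnMetric n M) k) :
    (pullback (fun q : lcSet n M => p2 q.1) α : DForm (MetricJetModel n) (lcSet n M) k) =
      pullback (fun q : lcSet n M => projCM q.1) β ↔ α = pullback (rhoMap n M) β := by
  rw [← pullback_p2_pullback_rhoMap]
  refine ⟨fun h => ?_, fun h => by rw [h]⟩
  have h1 := congrArg (fun γ : DForm (MetricJetModel n) (lcSet n M) k =>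
    (pullback (lcHomeo n M).symm γ : DForm (MetricJetModel n) (MetricJet n M) k)) h
  simp only [pullback_lcHomeo_symm] at h1
  exact h1

theorem pullback_symm_mem [T2Space M] {a : Σ k : ℕ, DForm (MetricJetModel n) (lcSet n M) k}
    (ha : a ∈ pullbackSet (Subtype.val : lcSet n M → ConnMetricJet n M) (idealJ n M)) :
    (⟨a.1, pullback (lcHomeo n M).symm a.2⟩ :
      Σ k : ℕ, DForm (MetricJetModel n) (MetricJet n M) k) ∈ contactEDS n M := by
  obtain ⟨a, ha, rfl⟩ := ha
  have h := pullback_pullback contMDiff_lcSet_val (contMDiff_lcHomeo_symm (n := n) (M := M)) a.2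
  have h2 := pullback_sigMap_mem ha
  have h3 : (⟨a.1, pullback (lcHomeo n M).symm (pullback (Subtype.val : lcSet n M → _) a.2 :
      DForm (MetricJetModel n) (lcSet n M) a.1)⟩ :
      Σ k : ℕ, DForm (MetricJetModel n) (MetricJet n M) k) = ⟨a.1, pullback (sigMap n M) a.2⟩ :=
    congrArg (Sigma.mk a.1) h
  exact h3 ▸ h2

variable [T2Space M] [SigmaCompactSpace M]

theorem bijOn_extremals_p2 {lam : DForm (ConnMetricModel n) (ConnMetric n M) n}
    (hlam : IsSmoothForm lam) :
    Set.BijOn (fun (τ : M → lcSet n M) (x : M) => p2 (τ x).1)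
      {τ | IsExtremal (fun q : lcSet n M => q.1.base)
        (pullback (fun q : lcSet n M => projCM q.1) lam : DForm (MetricJetModel n) (lcSet n M) n)
        (pullbackSet (Subtype.val : lcSet n M → ConnMetricJet n M) (idealJ n M)) τ}
      {s | IsExtremal (Tot.base : MetricJet n M → M) (pullback (rhoMap n M) lam)
        (contactEDS n M) s} := by
  rw [← pullback_p2_pullback_rhoMap]
  refine bijOn_extremals (ρ := fun q : lcSet n M => p2 q.1) (r := (lcHomeo n M).symm)
    contMDiff_lcHomeo contMDiff_lcHomeo_symm (NatBundle.contMDiff_base _)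
    (lcHomeo n M).symm_apply_apply (fun _ => rfl) (fun _ => rfl) ?_
    (fun a ha => isSmoothForm_contactEDS ha) ?_ (fun a ha => pullback_symm_mem ha)
    (fun _ _ _ _ _ => rfl) ?_ ?_
  · exact isSmoothForm_iff.2 fun q => (isSmoothForm_iff.1 hlam _).pullback
      (contMDiff_rhoMap.mapSmoothAt q)
  · intro a ha
    rw [← pullbackSet_lcSet]
    exact ⟨a, ha, rfl⟩
  · intro s _ _ _ X _ _ _ x
    have h := tmap_comp (f := lcHomeo n M) (g := (lcHomeo n M).symm) (x := s x)
      (contMDiff_lcHomeo.mapSmoothAt _).mdifferentiableAt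
      (contMDiff_lcHomeo_symm.mapSmoothAt _).mdifferentiableAt
    have h2 : (fun y => lcHomeo n M ((lcHomeo n M).symm y)) = fun y => y := rfl
    rw [h2, tmap_id] at h
    exact (congrArg (fun A : MetricJetModel n →L[ℝ] MetricJetModel n => A (vecAt X (s x))) h).symm
  · intro s hs ξ hξ hv
    exact (isAffine_metricJet (minkowski n)).exists_extension hs hξ hv

theorem bijOn_extremals_projCM {lam : DForm (ConnMetricModel n) (ConnMetric n M) n}
    (hlam : IsSmoothForm lam) :
    Set.BijOn (fun (τ : M → lcSet n M) (x : M) => projCM (τ x).1)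
      {τ | IsExtremal (fun q : lcSet n M => q.1.base)
        (pullback (fun q : lcSet n M => projCM q.1) lam : DForm (MetricJetModel n) (lcSet n M) n)
        (pullbackSet (Subtype.val : lcSet n M → ConnMetricJet n M) (idealJ n M)) τ}
      {s | IsExtremal (Tot.base : ConnMetric n M → M) lam (reducedPalatiniEDS n M) s} := by
  have hsymm : ∀ {s : M → ConnMetric n M}, ContMDiff (𝓡 n) 𝓘(ℝ, ConnMetricModel n) ∞ s →
      (∀ x, (s x).base = x) → (∀ x, IsIntegralAt (n := n) (reducedPalatiniEDS n M) s x) →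
      ∀ x u v, (s x).val.1 u v = (s x).val.1 v u := fun hs hb hInt x u v =>
    conn_symm_of_isIntegralAt (hs.mapSmoothAt x) (Filter.Eventually.of_forall hb) (hInt x) u v
  have hr : ContMDiff 𝓘(ℝ, ConnMetricModel n) 𝓘(ℝ, MetricJetModel n) ∞
      (fun q => (lcHomeo n M).symm (retMap n M q)) := contMDiff_lcHomeo_symm.comp contMDiff_retMap
  refine bijOn_extremals (ρ := fun q : lcSet n M => projCM q.1)
    (r := fun q => (lcHomeo n M).symm (retMap n M q)) contMDiff_projCM_val hr
    (NatBundle.contMDiff_base _) ?_ (fun _ => rfl) (fun _ => rfl) hlam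
    (fun a ha => isSmoothForm_reducedPalatiniEDS ha) ?_ ?_ ?_ ?_ ?_
  · intro q
    rw [← rhoMap_p2, retMap_rhoMap]
    exact (lcHomeo n M).symm_apply_apply q
  · intro a ha
    exact ⟨_, pullback_projCM_mem ha,
      congrArg (Sigma.mk a.1) (pullback_pullback contMDiff_projCM contMDiff_lcSet_val a.2)⟩
  · intro a ha
    have h1 := pullback_retMap_mem (pullback_symm_mem ha)
    rwa [pullback_pullback contMDiff_lcHomeo_symm contMDiff_retMap] at h1
  · intro s hs hb hInt x
    exact rhoMap_retMap (hsymm hs hb hInt x)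
  · intro s hs hb hInt X hX hv hXa x
    have hXv : ∀ x, (vecAt X (s x)).1 = 0 := fun x => by
      have h := hv x
      rwa [NatBundle.tmap_base] at h
    have h1 := tmap_rhoMap_retMap (hsymm hs hb hInt x) (variation_symm hs hb hX hXv hXa x)
    have e1 := tmap_comp (f := fun q : lcSet n M => projCM q.1)
      (g := fun q => (lcHomeo n M).symm (retMap n M q)) (x := s x)
      (contMDiff_projCM_val.mapSmoothAt _).mdifferentiableAt (hr.mapSmoothAt _).mdifferentiableAt
    have e2 := tmap_comp (f := rhoMap n M) (g := retMap n M) (x := s x)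
      (contMDiff_rhoMap.mapSmoothAt _).mdifferentiableAt
      (contMDiff_retMap.mapSmoothAt _).mdifferentiableAt
    exact (congrArg (fun A : ConnMetricModel n →L[ℝ] ConnMetricModel n => A (vecAt X (s x)))
      (e1.symm.trans e2)).trans h1
  · intro s hs ξ hξ hv
    exact (isAffine_connMetric (minkowski n)).exists_extension hs hξ hv

end Extremals

end PalatiniEH

end

theorem mainTheorem2 (m : ℕ) (M : Type*) [TopologicalSpace M] [T2Space M] [SigmaCompactSpace M]
    [ChartedSpace (Vec (m + 2)) M] [IsManifold (𝓡 (m + 2)) ∞ M] :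
    ∃ (L : Set (ConnMetricJet (m + 2) M)) (_ : ChartedSpace (MetricJetModel (m + 2)) L)
      (_ : IsManifold 𝓘(ℝ, MetricJetModel (m + 2)) ∞ L),
      -- `L` is an embedded submanifold
      Manifold.IsSmoothEmbedding 𝓘(ℝ, MetricJetModel (m + 2)) 𝓘(ℝ, ConnMetricJetModel (m + 2)) ∞
        (Subtype.val : L → ConnMetricJet (m + 2) M) ∧
      -- it contains all integral manifolds of `𝒥`, and is contained in all sets with this property
      ContainsIntegralManifolds L ∧
      (∀ N : Set (ConnMetricJet (m + 2) M), ContainsIntegralManifolds N → L ⊆ N) ∧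
      -- `p₂` restricts to an isomorphism of bundles over `M` from `L` to `J¹Σ`
      (∃ Φ : L ≃ₘ^∞⟮𝓘(ℝ, MetricJetModel (m + 2)), 𝓘(ℝ, MetricJetModel (m + 2))⟯
          MetricJet (m + 2) M, ∀ q : L, Φ q = p2 q.1 ∧ (Φ q).base = q.1.base) ∧
      -- the contact structure corresponds to the restriction of `𝒥`
      (pullbackSet (fun q : L => p2 q.1) (contactEDS (m + 2) M) :
          FormSet (MetricJetModel (m + 2)) L) =
        pullbackSet (Subtype.val : L → ConnMetricJet (m + 2) M) (idealJ (m + 2) M) ∧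
      -- the variational problems, for oriented `M`
      (IsOrientedAtlas (m + 2) M →
        ∃ lamRed : DForm (ConnMetricModel (m + 2)) (ConnMetric (m + 2) M) (m + 2),
          IsReducedLagrangian lamRed ∧ (∀ lam, IsReducedLagrangian lam → lam = lamRed) ∧
          ∃ lamEH : DForm (MetricJetModel (m + 2)) (MetricJet (m + 2) M) (m + 2),
            IsSmoothForm lamEH ∧
            (∀ lam : DForm (MetricJetModel (m + 2)) (MetricJet (m + 2) M) (m + 2),
              (pullback (fun q : L => p2 q.1) lam : DForm (MetricJetModel (m + 2)) L (m + 2)) =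
                  pullback (fun q : L => projCM q.1) lamRed ↔ lam = lamEH) ∧
            Set.BijOn (fun (τ : M → L) (x : M) => projCM (τ x).1)
              {τ | IsExtremal (fun q : L => q.1.base)
                (pullback (fun q : L => projCM q.1) lamRed :
                  DForm (MetricJetModel (m + 2)) L (m + 2))
                (pullbackSet (Subtype.val : L → ConnMetricJet (m + 2) M) (idealJ (m + 2) M)) τ}
              {s | IsExtremal (Tot.base : ConnMetric (m + 2) M → M) lamRed
                (reducedPalatiniEDS (m + 2) M) s} ∧
            Set.BijOn (fun (τ : M → L) (x : M) => p2 (τ x).1)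
              {τ | IsExtremal (fun q : L => q.1.base)
                (pullback (fun q : L => projCM q.1) lamRed :
                  DForm (MetricJetModel (m + 2)) L (m + 2))
                (pullbackSet (Subtype.val : L → ConnMetricJet (m + 2) M) (idealJ (m + 2) M)) τ}
              {s | IsExtremal (Tot.base : MetricJet (m + 2) M → M) lamEH
                (contactEDS (m + 2) M) s}) := by
  refine ⟨lcSet (m + 2) M, inferInstance, inferInstance, isSmoothEmbedding_lcSet_val,
    containsIntegralManifolds_lcSet, fun N hN => lcSet_subset hN,
    ⟨⟨(lcHomeo (m + 2) M).toEquiv, contMDiff_lcHomeo, contMDiff_lcHomeo_symm⟩,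
      fun q => ⟨rfl, rfl⟩⟩, pullbackSet_lcSet, fun hM => ?_⟩
  have hlam := isSmoothForm_reducedLagrangian hM
  exact ⟨reducedLagrangian m M, isReducedLagrangian_reducedLagrangian hM, fun lam h => h.eq,
    pullback (rhoMap (m + 2) M) (reducedLagrangian m M),
    isSmoothForm_iff.2 fun q => (isSmoothForm_iff.1 hlam _).pullback
      (contMDiff_rhoMap.mapSmoothAt q),
    fun lam => pullback_p2_eq_iff lam _, bijOn_extremals_projCM hlam, bijOn_extremals_p2 hlam⟩
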